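/- For a graph $G$ and integers $\chi_{\rm d}\ge 1$, $\Delta\ge 0$, a $(\chi_{\rm d},\Delta)$-coloring of $G$ is a partition of $V(G)$ into $\chi_{\rm d}$ (possibly empty) sets, each of which induces a subgraph of maximum degree at most $\Delta$. A nice tree decomposition of $G$ is a tree decomposition $(T,\{X_t\}_{t\in V(T)})$ on a rooted tree $T$ each of whose nodes $t$ is a leaf with $|X_t|\le 1$; an introduce node, with exactly one child $s$ and $X_t=X_s\cup\{v\}$ for some $v\notin X_s$; a forget node, with exactly one child $s$ and $X_t=X_s\setminus\{v\}$ for some $v\in X_s$; or a join node, with exactly two children $s_1,s_2$ and $X_t=X_{s_1}=X_{s_2}$. Its width is $\max_t|X_t|-1$ (taken to be $0$ if $G$ has no vertices). **Theorem.** There are an algorithm (a single program for a random access machine with logarithmic cost) and a polynomial $P$ such that the following holds. Given any finite simple graph $G$, integers $\chi_{\rm d}\ge 1$ and $\Delta\ge 0$ (written in binary), and a nice tree decomposition of $G$ of width $\mathrm{tw}$, the algorithm correctly decides whether $G$ admits a $(\chi_{\rm d},\Delta)$-coloring, and it runs in time at most $$P(N)\cdot\bigl(\chi_{\rm d}\cdot(\Delta+1)\bigr)^{\mathrm{tw}}=O^{*}\bigl((\chi_{\rm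 d}(\Delta+1))^{\mathrm{tw}}\bigr),$$ where $N$ is the length of the input (graph, tree decomposition, $\chi_{\rm d}$ and $\Delta$) in bits. -/

import Mathlib

/-! ### Defective coloring -/

open Classical in
/-- `G` admits a `(χ, Δ)`-coloring: its vertex set is split into `χ` (possibly empty) color classes,
each of which induces a subgraph of maximum degree at most `Δ`. -/
def DefectiveColorable {V : Type*} [Fintype V] (G : SimpleGraph V) (χ Δ : ℕ) : Prop :=
  ∃ c : V → Fin χ, ∀ i : Fin χ, (G.induce (c ⁻¹' {i})).maxDegree ≤ Δ

/-! ### Nice tree decompositions -/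

/-- A rooted tree with node set `Fin m`, given by its parent function: following parents leads from
every node to the root. By convention the root is stored as its own parent. -/
structure ParentTree (m : ℕ) where
  root : Fin m
  parent : Fin m → Fin m
  parent_root : parent root = root
  reaches_root : ∀ t, ∃ k : ℕ, parent^[k] t = root

namespace ParentTree

variable {m : ℕ} (T : ParentTree m)

/-- The children of a node. -/
def children (t : Fin m) : Finset (Fin m) :=
  Finset.univ.filter fun s => s ≠ T.root ∧ T.parent s = t

/-- The underlying undirected tree: each node other than the root is joined to its parent. -/
def graph : SimpleGraph (Fin m) :=
  SimpleGraph.fromRel fun s t => T.parent s = t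

end ParentTree

/-- A nice tree decomposition of `G` with node set `Fin m`: a tree decomposition on a rooted tree in
which every node is a leaf, introduce, forget or join node. The root bag is arbitrary, and a leaf bag
may be empty or a singleton. -/
structure NiceTreeDecomposition {n : ℕ} (G : SimpleGraph (Fin n)) (m : ℕ) extends ParentTree m where
  bag : Fin m → Finset (Fin n)
  /-- Every vertex occurs in a bag. -/
  vertex_mem : ∀ v, ∃ t, v ∈ bag t
  /-- Both ends of every edge occur together in a bag. -/
  edge_mem : ∀ u v, G.Adj u v → ∃ t, u ∈ bag t ∧ v ∈ bag t
  /-- The nodes whose bags contain a given vertex induce a connected subgraph of the tree. -/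
  connected : ∀ v, (toParentTree.graph.induce {t | v ∈ bag t}).Connected
  /-- Each node is a leaf, introduce, forget or join node. -/
  nice : ∀ t,
    (toParentTree.children t = ∅ ∧ (bag t).card ≤ 1) ∨
    (∃ s v, toParentTree.children t = {s} ∧ v ∉ bag s ∧ bag t = insert v (bag s)) ∨
    (∃ s v, toParentTree.children t = {s} ∧ v ∈ bag s ∧ bag t = (bag s).erase v) ∨
    (∃ s₁ s₂, s₁ ≠ s₂ ∧ toParentTree.children t = {s₁, s₂} ∧ bag s₁ = bag t ∧ bag s₂ = bag t)

/-- The width: the largest size of a bag, minus one. (For the graph without vertices, whose bags are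
all empty, this is `0`.) -/
def NiceTreeDecomposition.width {n m : ℕ} {G : SimpleGraph (Fin n)}
    (D : NiceTreeDecomposition G m) : ℕ :=
  (Finset.univ.sup fun t => (D.bag t).card) - 1

/-! ### Random access machines with logarithmic cost

A machine has registers, named by the program, and a memory, addressed through registers; all of
them hold natural numbers. Each elementary step is charged the bit lengths of the values and
addresses it handles; multiplication and division are charged as in the schoolbook methods. -/

namespace RAM

/-- Contents of the registers and of the memory. -/
structure State where
  reg : ℕ → ℕ
  mem : ℕ → ℕ

/-- Arithmetic operations: addition, truncated subtraction, multiplication, floor division. -/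
inductive Op
  | add | sub | mul | div

/-- The result of an operation. -/
def Op.eval : Op → ℕ → ℕ → ℕ
  | .add, a, b => a + b
  | .sub, a, b => a - b
  | .mul, a, b => a * b
  | .div, a, b => a / b

/-- The cost of an operation on given operands. -/
def Op.cost : Op → ℕ → ℕ → ℕ
  | .add, a, b => 1 + a.size + b.size
  | .sub, a, b => 1 + a.size + b.size
  | .mul, a, b => (1 + a.size) * (1 + b.size)
  | .div, a, b => (1 + a.size) * (1 + b.size)

/-- Programs. -/
inductive Prog
  | skip
  /-- `reg i := c` -/
  | const (i c : ℕ)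
  /-- `reg i := reg j ∘ reg k` -/
  | op (o : Op) (i j k : ℕ)
  /-- `reg i := mem (reg j)` -/
  | load (i j : ℕ)
  /-- `mem (reg i) := reg j` -/
  | store (i j : ℕ)
  /-- first `p`, then `q` -/
  | seq (p q : Prog)
  /-- `p` if `reg i ≠ 0`, else `q` -/
  | ite (i : ℕ) (p q : Prog)
  /-- repeat `p` as long as `reg i ≠ 0` -/
  | loop (i : ℕ) (p : Prog)

/-- `Exec p s T s'`: the program `p`, started in state `s`, halts in state `s'` after a computation of
total cost `T`. -/
inductive Exec : Prog → State → ℕ → State → Prop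
  | skip (s : State) : Exec .skip s 1 s
  | const (s : State) (i c : ℕ) :
      Exec (.const i c) s (1 + c.size) ⟨Function.update s.reg i c, s.mem⟩
  | op (s : State) (o : Op) (i j k : ℕ) :
      Exec (.op o i j k) s (o.cost (s.reg j) (s.reg k))
        ⟨Function.update s.reg i (o.eval (s.reg j) (s.reg k)), s.mem⟩
  | load (s : State) (i j : ℕ) :
      Exec (.load i j) s (1 + (s.reg j).size + (s.mem (s.reg j)).size)
        ⟨Function.update s.reg i (s.mem (s.reg j)), s.mem⟩
  | store (s : State) (i j : ℕ) :
      Exec (.store i j) s (1 + (s.reg i).size + (s.reg j).size)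
        ⟨s.reg, Function.update s.mem (s.reg i) (s.reg j)⟩
  | seq {p q : Prog} {s s' s'' : State} {T T' : ℕ} :
      Exec p s T s' → Exec q s' T' s'' → Exec (.seq p q) s (T + T') s''
  | ite_true {i : ℕ} {p q : Prog} {s s' : State} {T : ℕ} :
      s.reg i ≠ 0 → Exec p s T s' → Exec (.ite i p q) s (1 + (s.reg i).size + T) s'
  | ite_false {i : ℕ} {p q : Prog} {s s' : State} {T : ℕ} :
      s.reg i = 0 → Exec q s T s' → Exec (.ite i p q) s (1 + (s.reg i).size + T) s'
  | loop_done {i : ℕ} {p : Prog} {s : State} :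
      s.reg i = 0 → Exec (.loop i p) s 1 s
  | loop_step {i : ℕ} {p : Prog} {s s' s'' : State} {T T' : ℕ} :
      s.reg i ≠ 0 → Exec p s T s' → Exec (.loop i p) s' T' s'' →
        Exec (.loop i p) s (1 + (s.reg i).size + T + T') s''

/-- The initial state on an input: the input occupies the first memory cells, and all other cells
and all registers are `0`. -/
def initState (input : List ℕ) : State where
  reg := fun _ => 0
  mem := fun a => input.getD a 0

/-- The length of an input in bits (with one separator per word). -/
def inputLength (input : List ℕ) : ℕ :=
  (input.map fun w => w.size + 1).sum

end RAM

/-! ### Instances as machine inputs -/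

open Classical in
/-- The input listing `n`, `m`, `χ`, `Δ`, the root, the adjacency matrix of the graph (row by row),
the parent array of the tree, and the node-vertex incidence matrix of the bags (row by row). -/
noncomputable def encodeInstance {n m : ℕ} (G : SimpleGraph (Fin n))
    (D : NiceTreeDecomposition G m) (χ Δ : ℕ) : List ℕ :=
  [n, m, χ, Δ, (D.root : ℕ)]
    ++ List.ofFn (fun e : Fin (n * n) => if G.Adj e.divNat e.modNat then 1 else 0)
    ++ List.ofFn (fun t : Fin m => (D.parent t : ℕ))
    ++ List.ofFn (fun e : Fin (m * n) => if e.modNat ∈ D.bag e.divNat then 1 else 0)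

/-! The proof is dynamic programming over the rooted tree, with a fast convolution where branches
meet. An entry of the table of a node `t` gives each vertex of the bag a color and the number of its
equally colored neighbors among `low t`, the vertices already forgotten below `t`. This makes `Q = χ
(Δ + 1)` states per vertex. Edges inside the bag are not counted until an end is forgotten. Since
`low t` is the disjoint union of the sets `lowParent s` over the children `s`, the degrees
contributed by the children add up, and all types of nodes are treated alike
(`partialColoring_low_iff`). Passing from a child to the bag of its parent only requires guessing
color and degree of at most one forgotten vertex (`partialColoring_lowParent_iff`).

Combining children naively takes time quadratic in the table size. Instead, a table `g` is replaced
by its binomial transform, whose value at `x` is the sum of `g a` times the product of the binomial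
coefficients `C(x_i, a_i)` of the degrees, over the entries `a` with the colors of `x`. A product
`C(e, a) C(e, b)` is a nonnegative combination of `C(e, d)` with `d ≤ a + b`, and the coefficient of
`d = a + b` is positive (`sum_chooseMul`). As `C(e, d) = 0` for `d > e`, degrees above `Δ` disappear
by themselves. Hence a pointwise product of transforms is the transform of the wanted convolution
plus contributions at entries of too small total degree (`fwd_mul_fwd`).

To remove the latter, entry `a` is weighted by `B ^ |a|`, where `|a|` is the total degree. Unwanted
contributions then carry a surplus factor `B`, so the array has the form `B ^ |d| (q + B r)`
(`Represents.star`). Here `q` is nonzero exactly on the wanted entries, and the multinomial theorem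
gives `q ≤ c ^ |d| < B` for `c` children, so the residue modulo `B ^ (|d| + 1)` decides (`norm_eq`).
By Pascal's rule the transform is a composition of `n²` passes, each adding to an entry at most one
other entry, and these passes can be undone one by one (`ker_succ`, `inv_eq`). All numbers have
polynomially many bits.

No traversal order is needed: all tables are recomputed in rounds `0, …, m`, and the table of `t` is
right in round `R` as soon as `depth t + R ≥ m` (`table_correct`). The cells of all stages form one
sequence, in which each cell is given by an arithmetic expression in earlier ones (`eval_cellE`);
expressions compile to machine code of polynomial cost (`Expr.Rel.halts_compile`).

Tables have up to `Q ^ (tw + 1)` entries. The exponent drops to `tw` because instances with `χ ≥ n`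
or `Δ ≥ n` are answered at once; otherwise `Q ≤ n²`, and one factor `Q` is polynomial (`K_le`). -/

namespace RAM

/-! ### Bounded executions -/

/-- The program `p`, started in `s`, halts within cost `C` in a state satisfying `Q`. -/
def Halts (p : Prog) (s : State) (C : ℕ) (Q : State → Prop) : Prop :=
  ∃ T s', Exec p s T s' ∧ T ≤ C ∧ Q s'

theorem Halts.mono {p : Prog} {s : State} {C C' : ℕ} {Q Q' : State → Prop}
    (h : Halts p s C Q) (hC : C ≤ C') (hQ : ∀ s', Q s' → Q' s') : Halts p s C' Q' := by
  obtain ⟨T, s', h1, h2, h3⟩ := h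
  exact ⟨T, s', h1, h2.trans hC, hQ _ h3⟩

theorem Halts.seq {p q : Prog} {s : State} {C C' : ℕ} {Q R : State → Prop}
    (h : Halts p s C Q) (h' : ∀ s', Q s' → Halts q s' C' R) : Halts (.seq p q) s (C + C') R := by
  obtain ⟨T, s', h1, h2, h3⟩ := h
  obtain ⟨T', s'', h1', h2', h3'⟩ := h' s' h3
  exact ⟨T + T', s'', .seq h1 h1', by omega, h3'⟩

theorem Halts.skip {s : State} {Q : State → Prop} (h : Q s) : Halts .skip s 1 Q :=
  ⟨1, s, .skip s, le_rfl, h⟩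

theorem Halts.const {s : State} {Q : State → Prop} {i c : ℕ}
    (h : Q ⟨Function.update s.reg i c, s.mem⟩) : Halts (.const i c) s (1 + c.size) Q :=
  ⟨_, _, .const s i c, le_rfl, h⟩

theorem Op.cost_le (o : Op) (a b : ℕ) : o.cost a b ≤ (1 + a.size) * (1 + b.size) := by
  cases o <;> simp only [Op.cost] <;> nlinarith [Nat.zero_le (a.size * b.size)]

theorem Halts.op {s : State} {Q : State → Prop} {o : Op} {i j k A B : ℕ}
    (hA : (s.reg j).size ≤ A) (hB : (s.reg k).size ≤ B)
    (h : Q ⟨Function.update s.reg i (o.eval (s.reg j) (s.reg k)), s.mem⟩) :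
    Halts (.op o i j k) s ((1 + A) * (1 + B)) Q :=
  ⟨_, _, .op s o i j k, (o.cost_le _ _).trans (by gcongr), h⟩

theorem Halts.load {s : State} {Q : State → Prop} {i j A B : ℕ}
    (hA : (s.reg j).size ≤ A) (hB : (s.mem (s.reg j)).size ≤ B)
    (h : Q ⟨Function.update s.reg i (s.mem (s.reg j)), s.mem⟩) :
    Halts (.load i j) s (1 + A + B) Q :=
  ⟨_, _, .load s i j, by omega, h⟩

theorem Halts.store {s : State} {Q : State → Prop} {i j A B : ℕ}
    (hA : (s.reg i).size ≤ A) (hB : (s.reg j).size ≤ B)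
    (h : Q ⟨s.reg, Function.update s.mem (s.reg i) (s.reg j)⟩) :
    Halts (.store i j) s (1 + A + B) Q :=
  ⟨_, _, .store s i j, by omega, h⟩

/-- Both branches are charged, so that cost bounds remain sums and later become polynomials. -/
theorem Halts.ite {s : State} {Q : State → Prop} {p q : Prog} {i A C C' : ℕ}
    (hA : (s.reg i).size ≤ A) (hp : s.reg i ≠ 0 → Halts p s C Q)
    (hq : s.reg i = 0 → Halts q s C' Q) : Halts (.ite i p q) s (1 + A + C + C') Q := by
  by_cases h : s.reg i = 0
  · obtain ⟨T, s', h1, h2, h3⟩ := hq h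
    exact ⟨_, s', .ite_false h h1, by omega, h3⟩
  · obtain ⟨T, s', h1, h2, h3⟩ := hp h
    exact ⟨_, s', .ite_true h h1, by omega, h3⟩

/-- The register `c` counts down from `k`, so each test of the loop condition is charged at most `1
+ k.size`. -/
theorem Halts.loop {c : ℕ} {body : Prog} (k C : ℕ) (Inv : ℕ → State → Prop)
    (hc : ∀ i s, Inv i s → s.reg c = k - i)
    (hbody : ∀ i < k, ∀ s, Inv i s → Halts body s C (Inv (i + 1)))
    {s : State} (h0 : Inv 0 s) :
    Halts (.loop c body) s (k * (C + 1 + k.size) + 1) (Inv k) := by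
  -- Induction on the number `j` of iterations that remain.
  have key : ∀ j ≤ k, ∀ s, Inv (k - j) s →
      Halts (.loop c body) s (j * (C + 1 + k.size) + 1) (Inv k) := by
    intro j
    induction j with
    | zero =>
      intro _ s hs
      have := hc _ s hs
      exact ⟨1, s, .loop_done (by omega), by omega, by simpa using hs⟩
    | succ j ih =>
      intro hj s hs
      have hr : s.reg c = j + 1 := by have := hc _ s hs; omega
      obtain ⟨T, s', h1, h2, h3⟩ := hbody (k - (j + 1)) (by omega) s hs
      rw [show k - (j + 1) + 1 = k - j by omega] at h3
      obtain ⟨T', s'', h1', h2', h3'⟩ := ih (by omega) s' h3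
      refine ⟨_, s'', .loop_step (by omega) h1 h1', ?_, h3'⟩
      have : (s.reg c).size ≤ k.size := Nat.size_le_size (by omega)
      linarith
  exact key k le_rfl s (by simpa using h0)

/-! ### Expressions -/

/-- Arithmetic expressions with memory access, conditionals and bounded sums and products, in
parametric higher-order syntax. The range of a sum or product is given by one of two
distinguished numbers `n` and `m`. -/
inductive Expr (V : Type) where
  | var (x : V)
  | const (c : ℕ)
  | op (o : Op) (a b : Expr V)
  | load (a : Expr V)
  | ite (c a b : Expr V)
  | big (prod overM : Bool) (f : V → Expr V)

/-- A sum or a product over `i < k`. -/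
def bigVal (prod : Bool) (k : ℕ) (g : ℕ → ℕ) : ℕ :=
  if prod then ∏ i ∈ Finset.range k, g i else ∑ i ∈ Finset.range k, g i

/-- The accumulating operation of a sum or product. -/
def bigOp (prod : Bool) : Op := if prod then .mul else .add

/-- The start value of a sum or product. -/
def bigInit (prod : Bool) : ℕ := if prod then 1 else 0

theorem bigVal_zero (b : Bool) (g : ℕ → ℕ) : bigVal b 0 g = bigInit b := by
  cases b <;> simp [bigVal, bigInit]

theorem bigVal_succ (b : Bool) (k : ℕ) (g : ℕ → ℕ) :
    bigVal b (k + 1) g = (bigOp b).eval (bigVal b k g) (g k) := by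
  cases b <;> simp [bigVal, bigOp, Op.eval, Finset.sum_range_succ, Finset.prod_range_succ]

/-- The value of an expression. -/
def Expr.eval (n m : ℕ) (μ : ℕ → ℕ) : Expr ℕ → ℕ
  | .var x => x
  | .const c => c
  | .op o a b => o.eval (a.eval n m μ) (b.eval n m μ)
  | .load a => μ (a.eval n m μ)
  | .ite c a b => if c.eval n m μ ≠ 0 then a.eval n m μ else b.eval n m μ
  | .big p k f => bigVal p (if k then m else n) fun i => (f i).eval n m μ

/-- Code for an expression whose variables are numbers of registers: variable `x < δ` is held in
register `2 * x`. The result is left in register `2 * d + 1`; the variables below `δ` and the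
registers `2 * i + 1` for `i < d` are preserved. -/
def Expr.compile : Expr ℕ → ℕ → ℕ → Prog
  | .var x, d, _ => .seq (.const (2 * d + 3) 0) (.op .add (2 * d + 1) (2 * x) (2 * d + 3))
  | .const c, d, _ => .const (2 * d + 1) c
  | .op o a b, d, δ => .seq (a.compile d δ)
      (.seq (b.compile (d + 1) δ) (.op o (2 * d + 1) (2 * d + 1) (2 * d + 3)))
  | .load a, d, δ => .seq (a.compile d δ) (.load (2 * d + 1) (2 * d + 1))
  | .ite c a b, d, δ => .seq (c.compile d δ) (.ite (2 * d + 1) (a.compile d δ) (b.compile d δ))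
  | .big p k f, d, δ =>
      .seq (.const (2 * d + 1) (bigInit p)) <| .seq (.const (2 * d + 3) 1) <|
      .seq (.const (2 * d + 5) 0) <| .seq (.const (2 * δ) 0) <|
      .seq (.op .add (2 * d + 5) (if k then 2 else 0) (2 * d + 5)) <|
      .loop (2 * d + 5) <|
        .seq ((f δ).compile (d + 3) (δ + 1)) <|
        .seq (.op (bigOp p) (2 * d + 1) (2 * d + 1) (2 * d + 7)) <|
        .seq (.op .add (2 * δ) (2 * δ) (2 * d + 3))
          (.op .sub (2 * d + 5) (2 * d + 5) (2 * d + 3))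

open Polynomial in
/-- A bound on the bit length of the value of an expression, in terms of a bound on the bit lengths
of the variables and memory cells and on the ranges of sums and products. -/
noncomputable def Expr.sizeBound : Expr ℕ → ℕ → ℕ[X]
  | .var _, _ => X
  | .const c, _ => C c.size
  | .op _ a b, δ => a.sizeBound δ + b.sizeBound δ + 1
  | .load _, _ => X
  | .ite _ a b, δ => a.sizeBound δ + b.sizeBound δ
  | .big _ _ f, δ => X * (f δ).sizeBound (δ + 1) + X + 1

open Polynomial in
/-- A bound on the cost of evaluating an expression. -/
noncomputable def Expr.costBound : Expr ℕ → ℕ → ℕ[X]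
  | .var _, _ => 2 + X
  | .const c, _ => 1 + C c.size
  | .op _ a b, δ => a.costBound δ + b.costBound δ + (1 + a.sizeBound δ) * (1 + b.sizeBound δ)
  | .load a, δ => a.costBound δ + (1 + a.sizeBound δ + X)
  | .ite c a b, δ => c.costBound δ + (1 + c.sizeBound δ + a.costBound δ + b.costBound δ)
  | .big p k f, δ => 8 + X + X * ((f δ).costBound (δ + 1) +
      (1 + (Expr.big p k f).sizeBound δ) * (1 + (f δ).sizeBound (δ + 1)) + 5 * X + 10)

/-- `Rel n m δ ρ e e'`: the expression `e` over values arises from the expression `e'` over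
registers when variable `x < δ` has value `ρ x`. -/
inductive Expr.Rel (n m : ℕ) : ℕ → (ℕ → ℕ) → Expr ℕ → Expr ℕ → Prop
  | var {δ : ℕ} {ρ : ℕ → ℕ} {v x : ℕ} : x < δ → ρ x = v → Rel n m δ ρ (.var v) (.var x)
  | const {δ : ℕ} {ρ : ℕ → ℕ} {c : ℕ} : Rel n m δ ρ (.const c) (.const c)
  | op {δ : ℕ} {ρ : ℕ → ℕ} {o : Op} {a b a' b' : Expr ℕ} :
      Rel n m δ ρ a a' → Rel n m δ ρ b b' → Rel n m δ ρ (.op o a b) (.op o a' b')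
  | load {δ : ℕ} {ρ : ℕ → ℕ} {a a' : Expr ℕ} :
      Rel n m δ ρ a a' → Rel n m δ ρ (.load a) (.load a')
  | ite {δ : ℕ} {ρ : ℕ → ℕ} {c a b c' a' b' : Expr ℕ} :
      Rel n m δ ρ c c' → Rel n m δ ρ a a' → Rel n m δ ρ b b' →
        Rel n m δ ρ (.ite c a b) (.ite c' a' b')
  | big {δ : ℕ} {ρ : ℕ → ℕ} {p k : Bool} {f f' : ℕ → Expr ℕ} :
      (∀ i, i < (if k then m else n) → Rel n m (δ + 1) (Function.update ρ δ i) (f i) (f' δ)) →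
        Rel n m δ ρ (.big p k f) (.big p k f')

/-! ### Bit lengths of the values of expressions -/

theorem size_add_le (a b : ℕ) : (a + b).size ≤ a.size + b.size + 1 := by
  rw [Nat.size_le]
  have ha := Nat.lt_size_self a
  have hb := Nat.lt_size_self b
  calc a + b < 2 ^ a.size + 2 ^ b.size := by omega
    _ ≤ 2 ^ (a.size + b.size) + 2 ^ (a.size + b.size) :=
        add_le_add (Nat.pow_le_pow_right (by norm_num) (by omega))
          (Nat.pow_le_pow_right (by norm_num) (by omega))
    _ = 2 ^ (a.size + b.size + 1) := by ring

theorem size_mul_le (a b : ℕ) : (a * b).size ≤ a.size + b.size := by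
  rcases Nat.eq_zero_or_pos b with rfl | hb0
  · simp
  rw [Nat.size_le, pow_add]
  exact Nat.mul_lt_mul_of_lt_of_le (Nat.lt_size_self a) (Nat.lt_size_self b).le (by positivity)

theorem Op.size_eval_le (o : Op) (a b : ℕ) : (o.eval a b).size ≤ a.size + b.size + 1 := by
  cases o
  · exact size_add_le a b
  · exact (Nat.size_le_size (Nat.sub_le a b)).trans (by omega)
  · exact (size_mul_le a b).trans (by omega)
  · exact (Nat.size_le_size (Nat.div_le_self a b)).trans (by omega)

/-- A product of at most `N` factors bounded by `2 ^ σ` is at most `2 ^ (N σ)`, and a sum of `k ≤ N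
< 2 ^ N` such terms is less than `2 ^ (N + σ)`; one bound covers both. -/
theorem size_bigVal_le (p : Bool) {k N σ : ℕ} {g : ℕ → ℕ} (hk : k ≤ N)
    (hg : ∀ i < k, (g i).size ≤ σ) : (bigVal p k g).size ≤ N * σ + N + 1 := by
  have hg' : ∀ i ∈ Finset.range k, g i ≤ 2 ^ σ := fun i hi =>
    (Nat.size_le.1 (hg i (Finset.mem_range.1 hi))).le
  rw [Nat.size_le]
  cases p
  · simp only [bigVal, Bool.false_eq_true, if_false]
    rcases Nat.eq_zero_or_pos k with rfl | hk0
    · simp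
    calc ∑ i ∈ Finset.range k, g i ≤ k * 2 ^ σ := by
          simpa using Finset.sum_le_card_nsmul _ _ _ hg'
      _ < 2 ^ N * 2 ^ σ :=
          Nat.mul_lt_mul_of_pos_right (hk.trans_lt Nat.lt_two_pow_self) (by positivity)
      _ = 2 ^ (N + σ) := by rw [pow_add]
      _ ≤ _ := Nat.pow_le_pow_right (by norm_num) (by nlinarith)
  · simp only [bigVal, if_true]
    calc ∏ i ∈ Finset.range k, g i ≤ (2 ^ σ) ^ k := by
          simpa using Finset.prod_le_pow_card _ _ _ hg'
      _ = 2 ^ (k * σ) := by rw [← pow_mul, mul_comm]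
      _ < _ := Nat.pow_lt_pow_right (by norm_num) (by nlinarith)

/-- The polynomial comes from the register form `e'` alone, so it does not depend on the input. An
index of a sum or product is below `N` and is itself an admissible variable value. -/
theorem Expr.Rel.size_eval_le {n m δ : ℕ} {ρ : ℕ → ℕ} {e e' : Expr ℕ} (h : Rel n m δ ρ e e')
    {N : ℕ} {μ : ℕ → ℕ} (hn : n ≤ N) (hm : m ≤ N) (hμ : ∀ a, (μ a).size ≤ N)
    (hρ : ∀ x < δ, (ρ x).size ≤ N) : (e.eval n m μ).size ≤ (e'.sizeBound δ).eval N := by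
  induction h with
  | var hx hv => subst hv; simpa [eval, sizeBound] using hρ _ hx
  | const => simp [eval, sizeBound]
  | @op _ _ o a b a' b' _ _ iha ihb =>
    have := o.size_eval_le (a.eval n m μ) (b.eval n m μ)
    have := iha hρ
    have := ihb hρ
    simp only [eval, sizeBound, Polynomial.eval_add, Polynomial.eval_one]
    omega
  | load _ _ => simpa [eval, sizeBound] using hμ _
  | ite _ _ _ _ iha ihb =>
    have := iha hρ
    have := ihb hρ
    simp only [eval, sizeBound, Polynomial.eval_add]
    split_ifs <;> omega
  | @big δ ρ p k f f' _ ih =>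
    have hk : (if k then m else n) ≤ N := by split_ifs <;> assumption
    have := size_bigVal_le p (g := fun i => (f i).eval n m μ) hk fun i hi => ih i hi fun x hx => by
      rcases eq_or_ne x δ with rfl | hne
      · simpa using (Nat.size_le.2 (Nat.lt_two_pow_self (n := i))).trans (by omega)
      · rw [Function.update_of_ne hne]; exact hρ x (by omega)
    simpa [eval, sizeBound] using this

/-! ### Correctness and cost of compiled expressions -/

/-- `s'` has the memory of `s`, its first `δ` variables and its first `d` temporary registers. -/
structure Keeps (d δ : ℕ) (s s' : State) : Prop where
  mem : s'.mem = s.mem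
  var : ∀ x < δ, s'.reg (2 * x) = s.reg (2 * x)
  tmp : ∀ i < d, s'.reg (2 * i + 1) = s.reg (2 * i + 1)

theorem Keeps.refl (d δ : ℕ) (s : State) : Keeps d δ s s := ⟨rfl, fun _ _ => rfl, fun _ _ => rfl⟩

theorem Keeps.trans {d δ : ℕ} {s s' s'' : State} (h : Keeps d δ s s') (h' : Keeps d δ s' s'') :
    Keeps d δ s s'' :=
  ⟨h'.mem.trans h.mem, fun x hx => (h'.var x hx).trans (h.var x hx),
    fun i hi => (h'.tmp i hi).trans (h.tmp i hi)⟩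

theorem Keeps.mono {d d' δ δ' : ℕ} {s s' : State} (h : Keeps d δ s s') (hd : d' ≤ d)
    (hδ : δ' ≤ δ) : Keeps d' δ' s s' :=
  ⟨h.mem, fun x hx => h.var x (by omega), fun i hi => h.tmp i (by omega)⟩

theorem Keeps.update_tmp {d δ : ℕ} {s s' : State} (h : Keeps d δ s s') {i : ℕ} (hi : d ≤ i)
    (v : ℕ) : Keeps d δ s ⟨Function.update s'.reg (2 * i + 1) v, s'.mem⟩ :=
  ⟨h.mem, fun x hx => by simp only; rw [Function.update_of_ne (by omega), h.var x hx],
    fun j hj => by simp only; rw [Function.update_of_ne (by omega), h.tmp j hj]⟩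

theorem Keeps.update_var {d δ : ℕ} {s s' : State} (h : Keeps d δ s s') {x : ℕ} (hx : δ ≤ x)
    (v : ℕ) : Keeps d δ s ⟨Function.update s'.reg (2 * x) v, s'.mem⟩ :=
  ⟨h.mem, fun y hy => by simp only; rw [Function.update_of_ne (by omega), h.var y hy],
    fun j hj => by simp only; rw [Function.update_of_ne (by omega), h.tmp j hj]⟩

/-- Odd registers form an evaluation stack with top `2 * d + 1`, and even registers hold the bound
variables. Variables 0 and 1 must hold `n` and `m`, because sums and products load their ranges from
there. -/
theorem Expr.Rel.halts_compile {n m δ : ℕ} {ρ : ℕ → ℕ} {e e' : Expr ℕ} (h : Rel n m δ ρ e e')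
    {N : ℕ} {μ : ℕ → ℕ} (hn : n ≤ N) (hm : m ≤ N) (hμ : ∀ a, (μ a).size ≤ N)
    (hρ : ∀ x < δ, (ρ x).size ≤ N) (hδ : 2 ≤ δ) (hρ0 : ρ 0 = n) (hρ1 : ρ 1 = m)
    {d : ℕ} {s : State} (hs : s.mem = μ) (hreg : ∀ x < δ, s.reg (2 * x) = ρ x) :
    Halts (e'.compile d δ) s ((e'.costBound δ).eval N)
      fun s' => Keeps d δ s s' ∧ s'.reg (2 * d + 1) = e.eval n m μ := by
  induction h generalizing d s with
  | @var δ ρ v x hx hv =>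
    -- A register is copied by adding a zero to it.
    refine Halts.mono (Halts.seq (Halts.const rfl) fun s' hs' => ?_)
      (C := 1 + Nat.size 0 + (1 + N) * (1 + 0)) (by simp [costBound]; omega) fun _ h => h
    subst hs'
    refine Halts.op ?_ ?_ ⟨?_, ?_⟩
    · simp only; rw [Function.update_of_ne (by omega), hreg x hx]; exact hρ x hx
    · simp
    · exact ((Keeps.refl d δ s).update_tmp (i := d + 1) (by omega) 0).update_tmp le_rfl _
    · simp only [Function.update_self, Op.eval, eval, Nat.add_zero]
      rw [Function.update_of_ne (by omega), hreg x hx, hv]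
  | @const δ ρ c =>
    refine Halts.mono (Halts.const ⟨(Keeps.refl d δ s).update_tmp le_rfl _, ?_⟩)
      (by simp [costBound]) fun _ h => h
    simp [eval]
  | @op δ ρ o a b a' b' ha hb iha ihb =>
    have hsa := ha.size_eval_le hn hm hμ hρ
    have hsb := hb.size_eval_le hn hm hμ hρ
    refine Halts.mono (Halts.seq (iha hρ hδ hρ0 hρ1 (d := d) hs hreg) fun s1 hs1 =>
      Halts.seq (ihb hρ hδ hρ0 hρ1 (d := d + 1) (hs1.1.mem.trans hs)
        (fun x hx => (hs1.1.var x hx).trans (hreg x hx))) fun s2 hs2 => ?_)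
      (C := (a'.costBound δ).eval N + ((b'.costBound δ).eval N +
        (1 + (a'.sizeBound δ).eval N) * (1 + (b'.sizeBound δ).eval N)))
      (by simp only [costBound, Polynomial.eval_add, Polynomial.eval_mul, Polynomial.eval_one]
          omega) fun _ h => h
    have h1 : s2.reg (2 * d + 1) = a.eval n m μ := (hs2.1.tmp d (by omega)).trans hs1.2
    have h2 : s2.reg (2 * d + 3) = b.eval n m μ := hs2.2
    refine Halts.op (by rw [h1]; exact hsa) (by rw [h2]; exact hsb) ⟨?_, ?_⟩
    · exact (hs1.1.trans (hs2.1.mono (by omega) le_rfl)).update_tmp le_rfl _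
    · simp [h1, h2, eval]
  | @load δ ρ a a' ha iha =>
    have hsa := ha.size_eval_le hn hm hμ hρ
    refine Halts.mono (Halts.seq (iha hρ hδ hρ0 hρ1 (d := d) hs hreg) fun s1 hs1 => ?_)
      (C := (a'.costBound δ).eval N + (1 + (a'.sizeBound δ).eval N + N))
      (by simp [costBound]) fun _ h => h
    refine Halts.load (by rw [hs1.2]; exact hsa) (by rw [hs1.1.mem, hs]; exact hμ _) ⟨?_, ?_⟩
    · exact hs1.1.update_tmp le_rfl _
    · simp [hs1.2, hs1.1.mem, hs, eval]
  | @ite δ ρ c a b c' a' b' hc ha hb ihc iha ihb =>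
    have hsc := hc.size_eval_le hn hm hμ hρ
    refine Halts.mono (Halts.seq (ihc hρ hδ hρ0 hρ1 (d := d) hs hreg) fun s1 hs1 => ?_)
      (C := (c'.costBound δ).eval N + (1 + (c'.sizeBound δ).eval N + (a'.costBound δ).eval N
        + (b'.costBound δ).eval N))
      (by simp [costBound]) fun _ h => h
    have hreg1 : ∀ x < δ, s1.reg (2 * x) = ρ x := fun x hx => (hs1.1.var x hx).trans (hreg x hx)
    refine Halts.ite (by rw [hs1.2]; exact hsc) (fun h0 => ?_) fun h0 => ?_
    · refine (iha hρ hδ hρ0 hρ1 (d := d) (hs1.1.mem.trans hs) hreg1).mono le_rfl fun s2 hs2 =>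
        ⟨hs1.1.trans hs2.1, ?_⟩
      rw [hs1.2] at h0
      simp only [eval, if_pos h0, hs2.2]
    · refine (ihb hρ hδ hρ0 hρ1 (d := d) (hs1.1.mem.trans hs) hreg1).mono le_rfl fun s2 hs2 =>
        ⟨hs1.1.trans hs2.1, ?_⟩
      rw [hs1.2] at h0
      simp only [eval, h0, ne_eq, not_true_eq_false, if_false, hs2.2]
  | @big δ ρ p k f f' hf ih =>
    set K := if k then m else n with hK
    have hKN : K ≤ N := by rw [hK]; split_ifs <;> assumption
    set σ := ((f' δ).sizeBound (δ + 1)).eval N with hσ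
    set S := ((Expr.big p k f').sizeBound δ).eval N with hS
    have hSσ : S = N * σ + N + 1 := by simp [hS, hσ, sizeBound]
    set g := fun i => (f i).eval n m μ with hg
    have hsz : ∀ i : ℕ, i ≤ N → i.size ≤ N := fun i hi =>
      (Nat.size_le.2 (Nat.lt_two_pow_self (n := i))).trans hi
    have hρ' : ∀ i < K, ∀ x < δ + 1, (Function.update ρ δ i x).size ≤ N := fun i hi x hx => by
      rcases eq_or_ne x δ with rfl | hne
      · simpa using hsz i (by omega)
      · rw [Function.update_of_ne hne]; exact hρ x (by omega)
    have hgσ : ∀ i < K, (g i).size ≤ σ := fun i hi =>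
      (hf i hi).size_eval_le hn hm hμ (hρ' i hi)
    have hacc : ∀ i ≤ K, (bigVal p i g).size ≤ S := fun i hi => by
      rw [hSσ]; exact size_bigVal_le p (by omega) fun j hj => hgσ j (by omega)
    have hKreg : ∀ s : State, (∀ x < δ, s.reg (2 * x) = ρ x) →
        s.reg (if k then 2 else 0) = K := fun s h => by
      cases k
      · simpa [hK, hρ0] using h 0 (by omega)
      · simpa [hK, hρ1] using h 1 (by omega)
    -- Register `2 * δ` is the running index, `2 * d + 3` the constant 1 for stepping, `2 * d + 5`
    -- the count of remaining iterations and `2 * d + 1` the accumulator. The body is therefore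
    -- evaluated at depth `d + 3` and delivers its value in `2 * d + 7`.
    let Inv : ℕ → State → Prop := fun i t => Keeps d δ s t ∧ t.reg (2 * δ) = i ∧
      t.reg (2 * d + 3) = 1 ∧ t.reg (2 * d + 5) = K - i ∧ t.reg (2 * d + 1) = bigVal p i g
    set A := ((f' δ).costBound (δ + 1)).eval N with hA
    have hinit : (bigInit p).size ≤ 1 := by cases p <;> simp [bigInit]
    refine Halts.mono (Halts.seq (Halts.const rfl) fun s1 hs1 =>
      Halts.seq (Halts.const rfl) fun s2 hs2 => Halts.seq (Halts.const rfl) fun s3 hs3 =>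
      Halts.seq (Halts.const rfl) fun s4 hs4 =>
      Halts.seq (Q := Inv 0) (Halts.op (A := N) (B := 0) ?_ ?_ ?_) fun s5 hs5 =>
        Halts.loop (c := 2 * d + 5) K (A + ((1 + S) * (1 + σ) + ((1 + N) * (1 + 1)
          + (1 + N) * (1 + 1)))) Inv (fun i t ht => ht.2.2.2.1) ?_ hs5) ?_ ?_
    · have : s4.reg (if k then 2 else 0) = K := hKreg s4 fun x hx => by
        subst hs1 hs2 hs3 hs4
        simp only
        rw [Function.update_of_ne (by omega), Function.update_of_ne (by omega),
          Function.update_of_ne (by omega), Function.update_of_ne (by omega), hreg x hx]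
      rw [this]; exact hsz K hKN
    · have : s4.reg (2 * d + 5) = 0 := by
        subst hs1 hs2 hs3 hs4
        simp only
        rw [Function.update_of_ne (by omega), Function.update_self]
      rw [this]; simp
    · have hk4 : Keeps d δ s s4 := by
        subst hs1 hs2 hs3 hs4
        exact ((((Keeps.refl d δ s).update_tmp le_rfl _).update_tmp (i := d + 1) (by omega)
          _).update_tmp (i := d + 2) (by omega) _).update_var le_rfl _
      have : s4.reg (if k then 2 else 0) = K := hKreg s4 fun x hx =>
        (hk4.var x hx).trans (hreg x hx)
      have h5 : s4.reg (2 * d + 5) = 0 := by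
        subst hs1 hs2 hs3 hs4
        simp only
        rw [Function.update_of_ne (by omega), Function.update_self]
      refine ⟨hk4.update_tmp (i := d + 2) (by omega) _, ?_, ?_, ?_, ?_⟩
      · simp only
        rw [Function.update_of_ne (by omega)]
        subst hs1 hs2 hs3 hs4
        simp
      · simp only
        rw [Function.update_of_ne (by omega)]
        subst hs1 hs2 hs3 hs4
        simp only
        rw [Function.update_of_ne (by omega), Function.update_of_ne (by omega),
          Function.update_self]
      · simp [this, h5, Op.eval]
      · simp only
        rw [Function.update_of_ne (by omega)]
        subst hs1 hs2 hs3 hs4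
        simp only
        rw [Function.update_of_ne (by omega), Function.update_of_ne (by omega),
          Function.update_of_ne (by omega), Function.update_self, bigVal_zero]
    · rintro i hi t ⟨h1, h2, h3, h4, h5⟩
      refine Halts.seq (ih i hi (hρ' i hi) (by omega)
        (by rw [Function.update_of_ne (by omega), hρ0])
        (by rw [Function.update_of_ne (by omega), hρ1]) (d := d + 3) (h1.mem.trans hs)
        fun x hx => ?_) fun t1 ht1 => ?_
      · rcases eq_or_ne x δ with rfl | hne
        · simpa using h2
        · rw [Function.update_of_ne hne, h1.var x (by omega), hreg x (by omega)]
      have e1 : t1.reg (2 * d + 1) = bigVal p i g := (ht1.1.tmp d (by omega)).trans h5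
      have e3 : t1.reg (2 * d + 3) = 1 := (ht1.1.tmp (d + 1) (by omega)).trans h3
      have e5 : t1.reg (2 * d + 5) = K - i := (ht1.1.tmp (d + 2) (by omega)).trans h4
      have e7 : t1.reg (2 * d + 7) = g i := ht1.2
      have e0 : t1.reg (2 * δ) = i := (ht1.1.var δ (by omega)).trans h2
      have k1 : Keeps d δ s t1 := h1.trans (ht1.1.mono (by omega) (by omega))
      refine Halts.seq (Halts.op (by rw [e1]; exact hacc i hi.le)
        (by rw [e7]; exact hgσ i hi) rfl) fun t2 ht2 => ?_
      have f1 : t2.reg (2 * d + 1) = bigVal p (i + 1) g := by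
        subst ht2; simp [e1, e7, bigVal_succ]
      have f3 : t2.reg (2 * d + 3) = 1 := by
        subst ht2; simp only; rw [Function.update_of_ne (by omega), e3]
      have f5 : t2.reg (2 * d + 5) = K - i := by
        subst ht2; simp only; rw [Function.update_of_ne (by omega), e5]
      have f0 : t2.reg (2 * δ) = i := by
        subst ht2; simp only; rw [Function.update_of_ne (by omega), e0]
      have k2 : Keeps d δ s t2 := by subst ht2; exact k1.update_tmp le_rfl _
      refine Halts.seq (Halts.op (A := N) (B := 1) (by rw [f0]; exact hsz i (by omega))
        (by rw [f3]; simp) rfl) fun t3 ht3 => ?_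
      have g1 : t3.reg (2 * d + 1) = bigVal p (i + 1) g := by
        subst ht3; simp only; rw [Function.update_of_ne (by omega), f1]
      have g3 : t3.reg (2 * d + 3) = 1 := by
        subst ht3; simp only; rw [Function.update_of_ne (by omega), f3]
      have g5 : t3.reg (2 * d + 5) = K - i := by
        subst ht3; simp only; rw [Function.update_of_ne (by omega), f5]
      have g0 : t3.reg (2 * δ) = i + 1 := by
        subst ht3; simp [f0, f3, Op.eval]
      have k3 : Keeps d δ s t3 := by subst ht3; exact k2.update_var le_rfl _
      refine Halts.op (by rw [g5]; exact hsz (K - i) (by omega)) (by rw [g3]; simp)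
        ⟨k3.update_tmp (i := d + 2) (by omega) _, ?_, ?_, ?_, ?_⟩
      · simp only; rw [Function.update_of_ne (by omega), g0]
      · simp only; rw [Function.update_of_ne (by omega), g3]
      · simp only [Function.update_self, g5, g3, Op.eval]; omega
      · simp only; rw [Function.update_of_ne (by omega), g1]
    · have hKs := hsz K hKN
      simp only [costBound, Polynomial.eval_add, Polynomial.eval_mul, Polynomial.eval_X,
        Polynomial.eval_one, Polynomial.eval_ofNat, ← hA, ← hS, ← hσ, Nat.size_zero, Nat.size_one]
      have : K * (A + ((1 + S) * (1 + σ) + ((1 + N) * (1 + 1) + (1 + N) * (1 + 1))) + 1 + K.size)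
          ≤ N * (A + (1 + S) * (1 + σ) + 5 * N + 10) :=
        Nat.mul_le_mul hKN (by omega)
      omega
    · rintro t ⟨h1, -, -, -, h5⟩
      exact ⟨h1, h5⟩

end RAM

/-! ### The dynamic program -/

/-- The data of an instance, as functions on numbers. -/
structure DPData where
  (n m χ Δ root : ℕ)
  (adj bag : ℕ → ℕ → ℕ)
  (par : ℕ → ℕ)

namespace DPData

open Finset

variable (I : DPData)

/-- The number of possible values of the degree of a vertex. -/
def D : ℕ := I.Δ + 1

/-- The number of states (color and degree) of a vertex. -/
def Q : ℕ := I.χ * I.D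

/-- The `i`-th digit of `x` in base `Q`. -/
def dig (i x : ℕ) : ℕ := x / I.Q ^ i % I.Q

/-- The color in a vertex state. -/
def col (e : ℕ) : ℕ := e / I.D

/-- The degree in a vertex state. -/
def dg (e : ℕ) : ℕ := e % I.D

/-- The position of vertex `v` in the bag of `t`. -/
def rank (t v : ℕ) : ℕ := ∑ u ∈ range I.n, if u < v then I.bag t u else 0

/-- The size of the bag of `t`. -/
def card (t : ℕ) : ℕ := ∑ u ∈ range I.n, I.bag t u

/-- A bound on the length of all tables. -/
def L : ℕ := ∑ t ∈ range I.m, I.Q ^ I.card t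

/-- The base for grading by total degree. -/
def B : ℕ := (I.m + 1) ^ (I.n * I.n)

/-- `B` to the total degree. -/
def wt (x : ℕ) : ℕ := ∏ i ∈ range I.n, I.B ^ I.dg (I.dig i x)

/-- The state of vertex `v` of the bag of `t` in the table entry `z`. -/
def vdig (t z v : ℕ) : ℕ := I.dig (I.rank t v) z

/-- The number of neighbors of `u` of the same color among the vertices that are in the bag of `s`,
but not in that of `t`, when these have color `c`. -/
def hit (s t z c u : ℕ) : ℕ := ∑ v ∈ range I.n,
  if I.bag s v ≠ 0 then if I.bag t v ≠ 0 then 0 else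
    if I.adj u v ≠ 0 then if I.col (I.vdig t z u) = c then 1 else 0 else 0 else 0

/-- Zero if the degrees recorded in the entry `z` are possible, given the color `c` of the vertices
being forgotten. -/
def badKept (s t z c : ℕ) : ℕ := ∑ u ∈ range I.n,
  if I.bag t u ≠ 0 then
    if I.bag s u ≠ 0 then I.hit s t z c u - I.dg (I.vdig t z u) else I.dg (I.vdig t z u)
  else 0

/-- Zero if the vertices being forgotten do not violate the degree bound, given their color `c` and
degree `d` so far. -/
def badForgotten (s t z c d : ℕ) : ℕ := ∑ v ∈ range I.n,
  if I.bag s v ≠ 0 then if I.bag t v ≠ 0 then 0 else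
    (d + ∑ u ∈ range I.n, if I.bag s u ≠ 0 then if I.bag t u ≠ 0 then
      if I.adj u v ≠ 0 then if I.col (I.vdig t z u) = c then 1 else 0 else 0 else 0 else 0) - I.Δ
  else 0

/-- The entry in the table of `s` from which the entry `z` for its parent `t` is obtained. -/
def src (s t z c d : ℕ) : ℕ := ∑ u ∈ range I.n,
  if I.bag s u ≠ 0 then
    (if I.bag t u ≠ 0 then I.vdig t z u - I.hit s t z c u else c * I.D + d) * I.Q ^ I.rank s u
  else 0

/-- The table `f` of `s`, converted to the bag of its parent `t`, and graded. -/
def conv (f : ℕ → ℕ) (s t z : ℕ) : ℕ :=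
  if (∑ c ∈ range I.n, ∑ d ∈ range I.n, if c < I.χ then if d < I.D then
    if I.badKept s t z c + I.badForgotten s t z c d ≠ 0 then 0 else f (I.src s t z c d)
    else 0 else 0) ≠ 0 then I.wt z else 0

/-- The forward transform, pass by pass. -/
def fwd (g : ℕ → ℕ) : ℕ → ℕ → ℕ
  | 0, x => g x
  | p + 1, x => fwd g p x +
      if p % I.n < I.dg (I.dig (p / I.n) x) then fwd g p (x - I.Q ^ (p / I.n)) else 0

/-- Whenever a pass refers to the entry `x - Q ^ i`, this is a genuine, strictly smaller entry; the
recursion `inv` terminates for this reason. -/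
theorem le_of_pos_dg_dig {i x : ℕ} (h : 0 < I.dg (I.dig i x)) : 0 < I.Q ^ i ∧ I.Q ^ i ≤ x := by
  have h1 : I.dig i x ≠ 0 := by rintro h0; simp [h0, dg] at h
  have h2 : x / I.Q ^ i ≠ 0 := by rintro h0; simp [dig, h0] at h1
  rcases Nat.eq_zero_or_pos (I.Q ^ i) with h0 | h0
  · simp [h0] at h2
  · exact ⟨h0, by by_contra hlt; exact h2 (Nat.div_eq_of_lt (by omega))⟩

/-- The inverse transform, pass by pass. -/
def inv (z : ℕ → ℕ) : ℕ → ℕ → ℕ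
  | 0, x => z x
  | j + 1, x => inv z j x -
      if _h : (I.n * I.n - (j + 1)) % I.n < I.dg (I.dig ((I.n * I.n - (j + 1)) / I.n) x) then
        inv z (j + 1) (x - I.Q ^ ((I.n * I.n - (j + 1)) / I.n)) else 0
termination_by j x => (j, x)
decreasing_by
  · exact Prod.Lex.left _ _ (by omega)
  · exact Prod.Lex.right _ (by
      have := I.le_of_pos_dg_dig (Nat.zero_lt_of_lt ‹_›)
      omega)

/-- The indicator of the entries that are not divisible by the next power of `B`. -/
def norm (z : ℕ → ℕ) (x : ℕ) : ℕ := if z x % (I.wt x * I.B) ≠ 0 then 1 else 0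

/-- The product of the transforms of the tables of the children of `t`. -/
def joinAll (f : ℕ → ℕ → ℕ) (t x : ℕ) : ℕ := ∏ s ∈ range I.m,
  if s = I.root then 1 else
    if I.par s = t then I.fwd (I.conv (f s) s t) (I.n * I.n) x else 1

/-- The table of node `t` in round `R`. -/
def table : ℕ → ℕ → ℕ → ℕ
  | 0, _ => I.norm (I.inv (fun _ => 0) (I.n * I.n))
  | R + 1, t => I.norm (I.inv (I.joinAll (table R) t) (I.n * I.n))

/-- The product stage for node `t` in round `R`. -/
def start : ℕ → ℕ → ℕ → ℕ
  | 0, _ => fun _ => 0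
  | R + 1, t => I.joinAll (I.table R) t

theorem table_eq (R t : ℕ) : I.table R t = I.norm (I.inv (I.start R t) (I.n * I.n)) := by
  cases R <;> rfl

/-- The number of stages for a node in a round. -/
def S : ℕ := 2 * (I.n * I.n) + 3

/-- The content of entry `x` at stage `j` for node `t` in round `R`. -/
def cell (R t j x : ℕ) : ℕ :=
  if j ≤ I.n * I.n then I.inv (I.start R t) j x else
  if j = I.n * I.n + 1 then I.table R t x else
    I.fwd (I.conv (I.table R t) t (I.par t)) (j - (I.n * I.n + 2)) x

/-- All cells in one sequence. -/
def cellAt (k : ℕ) : ℕ := I.cell (k / I.L / I.S / I.m) (k / I.L / I.S % I.m) (k / I.L % I.S) (k % I.L)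

/-- Zero if the entry `z` of the root table satisfies the degree bounds. -/
def badRoot (z : ℕ) : ℕ := ∑ v ∈ range I.n,
  if I.bag I.root v ≠ 0 then
    (I.dg (I.vdig I.root z v) + ∑ u ∈ range I.n, if I.bag I.root u ≠ 0 then
      if I.adj u v ≠ 0 then
        if I.col (I.vdig I.root z u) = I.col (I.vdig I.root z v) then 1 else 0 else 0 else 0) - I.Δ
  else 0

/-- The start of the tables in the memory. -/
def base : ℕ := 5 + I.n * I.n + I.m + I.m * I.n

/-- The number of cells. -/
def K : ℕ := (I.m + 1) * I.m * I.S * I.L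

end DPData

namespace RAM.Expr

/-! ### Expressions for the dynamic program -/

section

variable {V : Type}

/-- Remainder. -/
def modE (a b : Expr V) : Expr V := .op .sub a (.op .mul (.op .div a b) b)

/-- Case distinction on `a < b`. -/
def ifLt (a b x y : Expr V) : Expr V := .ite (.op .sub b a) x y

/-- Case distinction on `a = b`. -/
def ifEq (a b x y : Expr V) : Expr V := .ite (.op .add (.op .sub a b) (.op .sub b a)) y x

/-- The number of vertices. -/
def nE : Expr V := .load (.const 0)

/-- The number of nodes. -/
def mE : Expr V := .load (.const 1)

/-- The number of colors. -/
def χE : Expr V := .load (.const 2)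

/-- The degree bound. -/
def ΔE : Expr V := .load (.const 3)

/-- The root. -/
def rootE : Expr V := .load (.const 4)

/-- The square of the number of vertices. -/
def nnE : Expr V := .op .mul nE nE

/-- Adjacency of `u` and `v`. -/
def adjE (u v : Expr V) : Expr V :=
  .load (.op .add (.const 5) (.op .add (.op .mul u nE) v))

/-- The parent of `t`. -/
def parE (t : Expr V) : Expr V := .load (.op .add (.op .add (.const 5) nnE) t)

/-- Membership of `v` in the bag of `t`. -/
def bagE (t v : Expr V) : Expr V :=
  .load (.op .add (.op .add (.op .add (.const 5) nnE) mE) (.op .add (.op .mul t nE) v))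

/-- The first address of the tables. -/
def baseE : Expr V := .op .add (.op .add (.op .add (.const 5) nnE) mE) (.op .mul mE nE)

/-- The number of possible degrees. -/
def DE : Expr V := .op .add ΔE (.const 1)

/-- The number of states of a vertex. -/
def QE : Expr V := .op .mul χE DE

/-- A power with exponent at most `n`. -/
def powE (b e : Expr V) : Expr V := .big true false fun x => ifLt (.var x) e b (.const 1)

/-- The digit of `x` at position `i`. -/
def digE (i x : Expr V) : Expr V := modE (.op .div x (powE QE i)) QE

/-- The color in a state. -/
def colE (e : Expr V) : Expr V := .op .div e DE

/-- The degree in a state. -/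
def dgE (e : Expr V) : Expr V := modE e DE

/-- The position of `v` in the bag of `t`. -/
def rankE (t v : Expr V) : Expr V :=
  .big false false fun u => ifLt (.var u) v (bagE t (.var u)) (.const 0)

/-- The size of the bag of `t`. -/
def cardE (t : Expr V) : Expr V := .big false false fun u => bagE t (.var u)

/-- The length of the tables. -/
def LE : Expr V := .big false true fun t => powE QE (cardE (.var t))

/-- The grading base. -/
def BE : Expr V := .big true false fun _ => .big true false fun _ => .op .add mE (.const 1)

/-- The grading weight. -/
def wtE (x : Expr V) : Expr V := .big true false fun i => powE BE (dgE (digE (.var i) x))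

/-- The state of `v`. -/
def vdigE (t z v : Expr V) : Expr V := digE (rankE t v) z

/-- See `DPData.hit`. -/
def hitE (s t z c u : Expr V) : Expr V := .big false false fun v =>
  .ite (bagE s (.var v)) (.ite (bagE t (.var v)) (.const 0)
    (.ite (adjE u (.var v)) (ifEq (colE (vdigE t z u)) c (.const 1) (.const 0)) (.const 0)))
    (.const 0)

/-- See `DPData.badKept`. -/
def badKeptE (s t z c : Expr V) : Expr V := .big false false fun u =>
  .ite (bagE t (.var u))
    (.ite (bagE s (.var u)) (.op .sub (hitE s t z c (.var u)) (dgE (vdigE t z (.var u))))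
      (dgE (vdigE t z (.var u))))
    (.const 0)

/-- See `DPData.badForgotten`. -/
def badForgottenE (s t z c d : Expr V) : Expr V := .big false false fun v =>
  .ite (bagE s (.var v)) (.ite (bagE t (.var v)) (.const 0)
    (.op .sub (.op .add d (.big false false fun u =>
      .ite (bagE s (.var u)) (.ite (bagE t (.var u)) (.ite (adjE (.var u) (.var v))
        (ifEq (colE (vdigE t z (.var u))) c (.const 1) (.const 0)) (.const 0)) (.const 0))
        (.const 0))) ΔE))
    (.const 0)

/-- See `DPData.src`. -/
def srcE (s t z c d : Expr V) : Expr V := .big false false fun u =>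
  .ite (bagE s (.var u))
    (.op .mul (.ite (bagE t (.var u)) (.op .sub (vdigE t z (.var u)) (hitE s t z c (.var u)))
      (.op .add (.op .mul c DE) d)) (powE QE (rankE s (.var u))))
    (.const 0)

/-- See `DPData.conv`; the table is read from the address `a` on. -/
def convE (a s t z : Expr V) : Expr V :=
  .ite (.big false false fun c => .big false false fun d =>
    ifLt (.var c) χE (ifLt (.var d) DE
      (.ite (.op .add (badKeptE s t z (.var c)) (badForgottenE s t z (.var c) (.var d)))
        (.const 0) (.load (.op .add a (srcE s t z (.var c) (.var d))))) (.const 0)) (.const 0))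
    (wtE z) (.const 0)

/-- The number of stages. -/
def SE : Expr V := .op .add (.op .mul (.const 2) nnE) (.const 3)

/-- The number of cells. -/
def KE (L : Expr V) : Expr V :=
  .op .mul (.op .mul (.op .mul (.op .add mE (.const 1)) mE) SE) L

/-- The content of the cell with number `k`. -/
def cellLoad (k : Expr V) : Expr V := .load (.op .add baseE k)

/-- The test whether pass `p` changes entry `x`. -/
def ifPass (p x y : Expr V) : Expr V :=
  ifLt (modE p nE) (dgE (digE (.op .div p nE) x)) y (.const 0)

/-- The product stage. -/
def startE (L R t x : Expr V) : Expr V :=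
  .ite R (.big true true fun s => ifEq (.var s) rootE (.const 1)
    (ifEq (parE (.var s)) t
      (cellLoad (.op .add (.op .mul (.op .add (.op .mul (.op .add
        (.op .mul (.op .sub R (.const 1)) mE) (.var s)) SE) (.op .sub SE (.const 1))) L) x))
      (.const 1))) (.const 0)

/-- The content of cell `k` at stage `j` for node `t` in round `R`, entry `x`, in terms of the
preceding cells. -/
def stageE (L k R t j x : Expr V) : Expr V :=
  ifEq j (.const 0) (startE L R t x) <|
  ifLt j (.op .add nnE (.const 1))
    (.op .sub (cellLoad (.op .sub k L)) (ifPass (.op .sub nnE j) x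
      (cellLoad (.op .sub k (powE QE (.op .div (.op .sub nnE j) nE)))))) <|
  ifEq j (.op .add nnE (.const 1))
    (.ite (modE (cellLoad (.op .sub k L)) (.op .mul (wtE x) BE)) (.const 1) (.const 0)) <|
  ifEq j (.op .add nnE (.const 2))
    (convE (.op .add baseE (.op .sub (.op .sub k L) x)) t (parE t) x)
    (.op .add (cellLoad (.op .sub k L)) (ifPass (.op .sub j (.op .add nnE (.const 3))) x
      (cellLoad (.op .sub (.op .sub k L)
        (powE QE (.op .div (.op .sub j (.op .add nnE (.const 3))) nE))))))

/-- The content of cell `k` in terms of the preceding cells. -/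
def cellE (L k : Expr V) : Expr V :=
  stageE L k (.op .div (.op .div (.op .div k L) SE) mE) (modE (.op .div (.op .div k L) SE) mE)
    (modE (.op .div k L) SE) (modE k L)

/-- See `DPData.badRoot`. -/
def badRootE (z : Expr V) : Expr V := .big false false fun v =>
  .ite (bagE rootE (.var v))
    (.op .sub (.op .add (dgE (vdigE rootE z (.var v))) (.big false false fun u =>
      .ite (bagE rootE (.var u)) (.ite (adjE (.var u) (.var v))
        (ifEq (colE (vdigE rootE z (.var u))) (colE (vdigE rootE z (.var v)))
          (.const 1) (.const 0)) (.const 0)) (.const 0))) ΔE)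
    (.const 0)

/-- The number of entries of the root table. -/
def rootCountE : Expr V := powE QE (cardE rootE)

/-- Nonzero if the entry `z` of the root table witnesses colorability. -/
def rootOkE (L z : Expr V) : Expr V :=
  .ite (badRootE z) (.const 0) (cellLoad (.op .add (.op .mul (.op .add (.op .mul (.op .add
    (.op .mul mE mE) rootE) SE) (.op .add nnE (.const 1))) L) z))

/-- Nonzero if there are at least `n` colors or the degree bound is at least `n`. -/
def trivialE : Expr V := ifLt χE nE (ifLt ΔE nE (.const 0) (.const 1)) (.const 1)

end

/-! ### Their values -/

/-- The memory holds the instance `I`, and the numbers have the expected ranges. -/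
structure _root_.DPData.Encodes (I : DPData) (μ : ℕ → ℕ) : Prop where
  hn : μ 0 = I.n
  hm : μ 1 = I.m
  hχ : μ 2 = I.χ
  hΔ : μ 3 = I.Δ
  hroot : μ 4 = I.root
  hadj : ∀ u < I.n, ∀ v < I.n, μ (5 + (u * I.n + v)) = I.adj u v
  hpar : ∀ t < I.m, μ (5 + I.n * I.n + t) = I.par t
  hbag : ∀ t < I.m, ∀ v < I.n, μ (5 + I.n * I.n + I.m + (t * I.n + v)) = I.bag t v
  bag_le : ∀ t v, I.bag t v ≤ 1
  par_lt : ∀ t < I.m, I.par t < I.m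
  root_lt : I.root < I.m
  Δ_lt : I.Δ < I.n

open Finset

theorem sub_add_sub_ne_zero {a b : ℕ} : a - b + (b - a) ≠ 0 ↔ a ≠ b := by omega

theorem sub_div_mul (a b : ℕ) : a - a / b * b = a % b := by
  have := Nat.div_add_mod a b
  rw [mul_comm] at this
  omega

section

variable {n m : ℕ} {μ : ℕ → ℕ}

@[simp] theorem eval_modE (a b : Expr ℕ) :
    (modE a b).eval n m μ = a.eval n m μ % b.eval n m μ := by
  simp [modE, eval, Op.eval, sub_div_mul]

@[simp] theorem eval_ifLt (a b x y : Expr ℕ) : (ifLt a b x y).eval n m μ =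
    if a.eval n m μ < b.eval n m μ then x.eval n m μ else y.eval n m μ := by
  simp [ifLt, eval, Op.eval, Nat.sub_ne_zero_iff_lt]

@[simp] theorem eval_ifEq (a b x y : Expr ℕ) : (ifEq a b x y).eval n m μ =
    if a.eval n m μ = b.eval n m μ then x.eval n m μ else y.eval n m μ := by
  simp only [ifEq, eval, Op.eval, sub_add_sub_ne_zero, ite_not]

theorem eval_sumN {f : ℕ → Expr ℕ} {g : ℕ → ℕ} (hg : ∀ i < n, (f i).eval n m μ = g i) :
    (Expr.big false false f).eval n m μ = ∑ i ∈ range n, g i :=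
  sum_congr rfl fun i hi => hg i (mem_range.1 hi)

theorem eval_sumM {f : ℕ → Expr ℕ} {g : ℕ → ℕ} (hg : ∀ i < m, (f i).eval n m μ = g i) :
    (Expr.big false true f).eval n m μ = ∑ i ∈ range m, g i :=
  sum_congr rfl fun i hi => hg i (mem_range.1 hi)

theorem eval_prodN {f : ℕ → Expr ℕ} {g : ℕ → ℕ} (hg : ∀ i < n, (f i).eval n m μ = g i) :
    (Expr.big true false f).eval n m μ = ∏ i ∈ range n, g i :=
  prod_congr rfl fun i hi => hg i (mem_range.1 hi)

theorem eval_prodM {f : ℕ → Expr ℕ} {g : ℕ → ℕ} (hg : ∀ i < m, (f i).eval n m μ = g i) :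
    (Expr.big true true f).eval n m μ = ∏ i ∈ range m, g i :=
  prod_congr rfl fun i hi => hg i (mem_range.1 hi)

/-- The power is a product over the fixed range `n` with factors 1 from the exponent on, so
exponents above `n` would be cut off. Those in use are digit positions, bag sizes and degrees. -/
theorem eval_powE {b e : Expr ℕ} (he : e.eval n m μ ≤ n) :
    (powE b e).eval n m μ = b.eval n m μ ^ e.eval n m μ := by
  have key : (powE b e).eval n m μ =
      ∏ x ∈ range n, if x < e.eval n m μ then b.eval n m μ else 1 :=
    eval_prodN fun x _ => eval_ifLt _ _ _ _
  rw [key, ← prod_filter, prod_const]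
  congr 1
  rw [show (range n).filter (fun x => x < e.eval n m μ) = range (e.eval n m μ) by
    ext x; simp; omega, card_range]

end

variable {I : DPData} {μ : ℕ → ℕ} (h : I.Encodes μ)

local notation "ev" e:max => Expr.eval I.n I.m μ e

include h

theorem eval_nE : ev nE = I.n := h.hn
theorem eval_mE : ev mE = I.m := h.hm
theorem eval_χE : ev χE = I.χ := h.hχ
theorem eval_ΔE : ev ΔE = I.Δ := h.hΔ
theorem eval_rootE : ev rootE = I.root := h.hroot

theorem eval_nnE : ev nnE = I.n * I.n := by simp [nnE, eval, Op.eval, eval_nE h]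

theorem eval_adjE {u v : Expr ℕ} (hu : ev u < I.n) (hv : ev v < I.n) :
    ev (adjE u v) = I.adj (ev u) (ev v) := by
  rw [← h.hadj _ hu _ hv]
  simp [adjE, eval, Op.eval, eval_nE h]

theorem eval_parE {t : Expr ℕ} (ht : ev t < I.m) : ev (parE t) = I.par (ev t) := by
  rw [← h.hpar _ ht]
  simp [parE, eval, Op.eval, eval_nnE h]

theorem eval_bagE {t v : Expr ℕ} (ht : ev t < I.m) (hv : ev v < I.n) :
    ev (bagE t v) = I.bag (ev t) (ev v) := by
  rw [← h.hbag _ ht _ hv]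
  simp [bagE, eval, Op.eval, eval_nE h, eval_nnE h, eval_mE h]

theorem eval_baseE : ev baseE = I.base := by
  simp [baseE, DPData.base, eval, Op.eval, eval_nE h, eval_nnE h, eval_mE h]

theorem eval_DE : ev DE = I.D := by simp [DE, DPData.D, eval, Op.eval, eval_ΔE h]

theorem eval_QE : ev QE = I.Q := by simp [QE, DPData.Q, eval, Op.eval, eval_χE h, eval_DE h]

theorem eval_digE {i x : Expr ℕ} (hi : ev i ≤ I.n) : ev (digE i x) = I.dig (ev i) (ev x) := by
  simp [digE, DPData.dig, eval, Op.eval, eval_powE hi, eval_QE h]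

theorem eval_colE (e : Expr ℕ) : ev (colE e) = I.col (ev e) := by
  simp [colE, DPData.col, eval, Op.eval, eval_DE h]

theorem eval_dgE (e : Expr ℕ) : ev (dgE e) = I.dg (ev e) := by
  simp [dgE, DPData.dg, eval_DE h]

theorem eval_rankE {t v : Expr ℕ} (ht : ev t < I.m) : ev (rankE t v) = I.rank (ev t) (ev v) := by
  refine eval_sumN fun u hu => ?_
  rw [eval_ifLt, eval_bagE h (v := .var u) ht hu]
  rfl

theorem eval_cardE {t : Expr ℕ} (ht : ev t < I.m) : ev (cardE t) = I.card (ev t) :=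
  eval_sumN fun u hu => eval_bagE h (v := .var u) ht hu

omit h in
theorem _root_.DPData.Encodes.rank_le (h : I.Encodes μ) (t v : ℕ) : I.rank t v ≤ I.n := by
  calc I.rank t v ≤ ∑ u ∈ range I.n, 1 := sum_le_sum fun u _ => by
        split_ifs
        · exact h.bag_le t u
        · omega
    _ = I.n := by simp

omit h in
theorem _root_.DPData.Encodes.card_le (h : I.Encodes μ) (t : ℕ) : I.card t ≤ I.n := by
  calc I.card t ≤ ∑ u ∈ range I.n, 1 := sum_le_sum fun u _ => h.bag_le t u
    _ = I.n := by simp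

theorem eval_LE : ev LE = I.L := by
  refine eval_sumM fun t ht => ?_
  have hc := eval_cardE h (t := .var t) ht
  rw [eval_powE (by rw [hc]; exact h.card_le _), hc, eval_QE h]
  rfl

theorem eval_BE : ev BE = I.B := by
  have : ev BE = ∏ _x ∈ range I.n, ∏ _y ∈ range I.n, (I.m + 1) := by
    refine eval_prodN fun x _ => eval_prodN fun y _ => ?_
    simp [eval, Op.eval, eval_mE h]
  rw [this]
  simp [DPData.B, pow_mul]

omit h in
theorem _root_.DPData.dg_le (I : DPData) (e : ℕ) : I.dg e ≤ I.Δ :=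
  Nat.le_of_lt_succ (Nat.mod_lt _ (Nat.succ_pos _))

theorem eval_wtE (x : Expr ℕ) : ev (wtE x) = I.wt (ev x) := by
  refine eval_prodN fun i hi => ?_
  have hd : ev (dgE (digE (.var i) x)) = I.dg (I.dig i (ev x)) := by
    rw [eval_dgE h, eval_digE h (i := .var i) (Nat.le_of_lt hi)]
    rfl
  rw [eval_powE (by rw [hd]; exact (I.dg_le _).trans h.Δ_lt.le), hd, eval_BE h]

theorem eval_vdigE {t z v : Expr ℕ} (ht : ev t < I.m) :
    ev (vdigE t z v) = I.vdig (ev t) (ev z) (ev v) := by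
  have hr := eval_rankE h (v := v) ht
  rw [vdigE, eval_digE h (by rw [hr]; exact h.rank_le _ _), hr]
  rfl

theorem eval_hitE {s t z c u : Expr ℕ} (hs : ev s < I.m) (ht : ev t < I.m) (hu : ev u < I.n) :
    ev (hitE s t z c u) = I.hit (ev s) (ev t) (ev z) (ev c) (ev u) := by
  refine eval_sumN fun v hv => ?_
  have hv' : ev (.var v) < I.n := hv
  -- The equations `eval.eq_2`, …, `eval.eq_5` belong to `const`, `op`, `load` and `ite`; rewriting
  -- with them leaves the named subexpressions folded.
  simp only [eval.eq_5]
  rw [eval_bagE h hs hv', eval_bagE h ht hv', eval_adjE h hu hv', eval_ifEq, eval_colE h,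
    eval_vdigE h ht]
  rfl

theorem eval_badKeptE {s t z c : Expr ℕ} (hs : ev s < I.m) (ht : ev t < I.m) :
    ev (badKeptE s t z c) = I.badKept (ev s) (ev t) (ev z) (ev c) := by
  refine eval_sumN fun u hu => ?_
  have hu' : ev (.var u) < I.n := hu
  simp only [eval.eq_5, eval.eq_3]
  rw [eval_bagE h hs hu', eval_bagE h ht hu', eval_hitE h hs ht hu', eval_dgE h,
    eval_vdigE h ht]
  rfl

theorem eval_badForgottenE {s t z c d : Expr ℕ} (hs : ev s < I.m) (ht : ev t < I.m) :
    ev (badForgottenE s t z c d) = I.badForgotten (ev s) (ev t) (ev z) (ev c) (ev d) := by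
  refine eval_sumN fun v hv => ?_
  have hv' : ev (.var v) < I.n := hv
  simp only [eval.eq_5, eval.eq_3]
  rw [eval_bagE h hs hv', eval_bagE h ht hv', eval_ΔE h]
  have : ev (.big false false fun u =>
      .ite (bagE s (.var u)) (.ite (bagE t (.var u)) (.ite (adjE (.var u) (.var v))
        (ifEq (colE (vdigE t z (.var u))) c (.const 1) (.const 0)) (.const 0)) (.const 0))
        (.const 0)) = ∑ u ∈ range I.n, if I.bag (ev s) u ≠ 0 then if I.bag (ev t) u ≠ 0 then
      if I.adj u v ≠ 0 then if I.col (I.vdig (ev t) (ev z) u) = ev c then 1 else 0 else 0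
        else 0 else 0 := by
    refine eval_sumN fun u hu => ?_
    have hu' : ev (.var u) < I.n := hu
    simp only [eval.eq_5]
    rw [eval_bagE h hs hu', eval_bagE h ht hu', eval_adjE h hu' hv', eval_ifEq, eval_colE h,
      eval_vdigE h ht]
    rfl
  rw [this]
  rfl

theorem eval_srcE {s t z c d : Expr ℕ} (hs : ev s < I.m) (ht : ev t < I.m) :
    ev (srcE s t z c d) = I.src (ev s) (ev t) (ev z) (ev c) (ev d) := by
  refine eval_sumN fun u hu => ?_
  have hu' : ev (.var u) < I.n := hu
  have hr := eval_rankE h (v := .var u) hs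
  simp only [eval.eq_5, eval.eq_3]
  rw [eval_bagE h hs hu', eval_bagE h ht hu', eval_vdigE h ht, eval_hitE h hs ht hu', eval_DE h,
    eval_powE (by rw [hr]; exact h.rank_le _ _), hr, eval_QE h]
  rfl

theorem eval_SE : ev SE = I.S := by
  simp [SE, DPData.S, eval, Op.eval, eval_nnE h]

theorem eval_KE (L : Expr ℕ) : ev (KE L) = (I.m + 1) * I.m * I.S * ev L := by
  simp [KE, eval, Op.eval, eval_mE h, eval_SE h]

theorem eval_cellLoad (k : Expr ℕ) : ev (cellLoad k) = μ (I.base + ev k) := by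
  simp [cellLoad, eval, Op.eval, eval_baseE h]

theorem eval_ifPass {p x y : Expr ℕ} (hp : ev p < I.n * I.n) : ev (ifPass p x y) =
    if ev p % I.n < I.dg (I.dig (ev p / I.n) (ev x)) then ev y else 0 := by
  have h1 : ev (.op .div p nE) = ev p / I.n := by simp [eval, Op.eval, eval_nE h]
  have h2 : ev p / I.n ≤ I.n := (Nat.div_lt_of_lt_mul hp).le
  rw [ifPass, eval_ifLt, eval_modE, eval_nE h, eval_dgE h, eval_digE h (by rw [h1]; exact h2), h1]
  rfl

theorem eval_badRootE (z : Expr ℕ) : ev (badRootE z) = I.badRoot (ev z) := by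
  refine eval_sumN fun v hv => ?_
  have hv' : ev (.var v) < I.n := hv
  have hr : ev rootE < I.m := by rw [eval_rootE h]; exact h.root_lt
  simp only [eval.eq_5, eval.eq_3]
  rw [eval_bagE h hr hv', eval_ΔE h, eval_dgE h, eval_vdigE h hr, eval_rootE h]
  have : ev (.big false false fun u =>
      .ite (bagE rootE (.var u)) (.ite (adjE (.var u) (.var v))
        (ifEq (colE (vdigE rootE z (.var u))) (colE (vdigE rootE z (.var v)))
          (.const 1) (.const 0)) (.const 0)) (.const 0)) =
      ∑ u ∈ range I.n, if I.bag I.root u ≠ 0 then if I.adj u v ≠ 0 then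
        if I.col (I.vdig I.root (ev z) u) = I.col (I.vdig I.root (ev z) v) then 1 else 0
          else 0 else 0 := by
    refine eval_sumN fun u hu => ?_
    have hu' : ev (.var u) < I.n := hu
    simp only [eval.eq_5]
    rw [eval_bagE h hr hu', eval_adjE h hu' hv', eval_ifEq, eval_colE h, eval_colE h,
      eval_vdigE h hr, eval_vdigE h hr, eval_rootE h]
    rfl
  rw [this]
  rfl

theorem eval_rootCountE : ev rootCountE = I.Q ^ I.card I.root := by
  have hr : ev rootE < I.m := by rw [eval_rootE h]; exact h.root_lt
  have hc := eval_cardE h hr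
  rw [rootCountE, eval_powE (by rw [hc]; exact h.card_le _), hc, eval_QE h, eval_rootE h]

theorem eval_rootOkE (L z : Expr ℕ) : ev (rootOkE L z) = if I.badRoot (ev z) ≠ 0 then 0 else
    μ (I.base + ((((I.m * I.m + I.root) * I.S + (I.n * I.n + 1)) * ev L) + ev z)) := by
  simp only [rootOkE, eval.eq_5]
  rw [eval_badRootE h, eval_cellLoad h]
  simp only [eval, Op.eval, eval_mE h, eval_rootE h, eval_SE h, eval_nnE h]

end RAM.Expr

/-! ### Indices of table entries and numbers of cells -/

open Finset

namespace DPData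

variable {I : DPData}

/-- For 0/1-valued `b`, each `u` with `b u ≠ 0` owns the digit position given by the number of its
predecessors, and this is the usual bound on a number with that many base-`q` digits. -/
theorem sum_digits_lt {b e : ℕ → ℕ} {q : ℕ} (k : ℕ) (he : ∀ u < k, b u ≠ 0 → e u < q) :
    (∑ u ∈ range k, if b u ≠ 0 then e u * q ^ (∑ w ∈ range u, b w) else 0) <
      q ^ (∑ u ∈ range k, b u) := by
  induction k with
  | zero => simp
  | succ k ih =>
    have ih' := ih fun u hu => he u (by omega)
    rw [sum_range_succ, sum_range_succ, pow_add]
    set r := q ^ (∑ u ∈ range k, b u)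
    split_ifs with hb
    · have h1 := he k (by omega) hb
      calc _ < r + e k * r := by omega
        _ = r * (e k + 1) := by ring
        _ ≤ r * q := Nat.mul_le_mul_left _ h1
        _ ≤ r * q ^ b k := Nat.mul_le_mul_left _ (Nat.le_self_pow hb q)
    · simp only [ne_eq, not_not] at hb
      simpa [hb] using ih'

theorem rank_eq {t v : ℕ} (hv : v ≤ I.n) : I.rank t v = ∑ u ∈ range v, I.bag t u := by
  rw [rank, ← sum_filter]
  congr 1
  ext u
  simp
  omega

theorem D_pos : 0 < I.D := Nat.succ_pos _

theorem Q_pos (h : 0 < I.χ) : 0 < I.Q := Nat.mul_pos h D_pos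

theorem add_lt_Q {c d : ℕ} (hc : c < I.χ) (hd : d < I.D) : c * I.D + d < I.Q :=
  calc c * I.D + d < (c + 1) * I.D := by rw [Nat.succ_mul]; omega
    _ ≤ I.Q := Nat.mul_le_mul_right _ hc

theorem dig_lt (h : 0 < I.Q) (i x : ℕ) : I.dig i x < I.Q := Nat.mod_lt _ h

/-- The lookup stays inside the table of `s` even when `z` records impossible degrees, because the
truncated subtraction of hits cannot enlarge a digit. -/
theorem src_lt {s t z c d : ℕ} (hc : c < I.χ) (hd : d < I.D) :
    I.src s t z c d < I.Q ^ I.card s := by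
  have hQ : 0 < I.Q := Q_pos (by omega)
  rw [src, card, sum_congr rfl fun u hu => by rw [rank_eq (mem_range.1 hu).le]]
  refine sum_digits_lt (b := I.bag s) (e := fun u =>
    if I.bag t u ≠ 0 then I.vdig t z u - I.hit s t z c u else c * I.D + d) I.n fun u _ _ => ?_
  split_ifs
  · exact (Nat.sub_le _ _).trans_lt (dig_lt hQ _ _)
  · exact add_lt_Q hc hd

theorem pow_card_le_L {s : ℕ} (hs : s < I.m) : I.Q ^ I.card s ≤ I.L :=
  single_le_sum (f := fun t => I.Q ^ I.card t) (fun _ _ => Nat.zero_le _) (mem_range.2 hs)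

/-- Cell numbers are mixed-radix numbers with the digits round, node, stage, entry. -/
theorem cellAt_eq {R t j x : ℕ} (ht : t < I.m) (hj : j < I.S) (hx : x < I.L) :
    I.cellAt (((R * I.m + t) * I.S + j) * I.L + x) = I.cell R t j x := by
  have h1 : ∀ a b c : ℕ, b < c → (a * c + b) / c = a ∧ (a * c + b) % c = b := fun a b c h =>
    ⟨by rw [mul_comm, Nat.mul_add_div (by omega), Nat.div_eq_of_lt h, Nat.add_zero],
      by rw [mul_comm, Nat.mul_add_mod, Nat.mod_eq_of_lt h]⟩
  rw [cellAt, (h1 _ _ _ hx).1, (h1 _ _ _ hx).2, (h1 _ _ _ hj).1, (h1 _ _ _ hj).2,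
    (h1 _ _ _ ht).1, (h1 _ _ _ ht).2]

/-- Mixed-radix numbers are ordered lexicographically; this shows that a cell being read was written
earlier. -/
theorem mul_add_lt {a b x y l : ℕ} (h : a < b) (hx : x < l) : a * l + x < b * l + y :=
  calc a * l + x < (a + 1) * l := by rw [Nat.succ_mul]; omega
    _ ≤ b * l + y := (Nat.mul_le_mul_right _ h).trans (Nat.le_add_right _ _)

end DPData

/-! ### Each cell as an expression in earlier cells -/

namespace RAM.Expr

variable {I : DPData} {μ : ℕ → ℕ} (h : I.Encodes μ)

local notation "ev" e:max => Expr.eval I.n I.m μ e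

include h

theorem eval_convE {a s t z : Expr ℕ} {f : ℕ → ℕ} (hs : ev s < I.m) (ht : ev t < I.m)
    (hf : ∀ y < I.Q ^ I.card (ev s), μ (ev a + y) = f y) :
    ev (convE a s t z) = I.conv f (ev s) (ev t) (ev z) := by
  have : ev (.big false false fun c => .big false false fun d =>
    ifLt (.var c) χE (ifLt (.var d) DE
      (.ite (.op .add (badKeptE s t z (.var c)) (badForgottenE s t z (.var c) (.var d)))
        (.const 0) (.load (.op .add a (srcE s t z (.var c) (.var d))))) (.const 0)) (.const 0)) =
      ∑ c ∈ range I.n, ∑ d ∈ range I.n, if c < I.χ then if d < I.D then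
      if I.badKept (ev s) (ev t) (ev z) c + I.badForgotten (ev s) (ev t) (ev z) c d ≠ 0 then 0
        else f (I.src (ev s) (ev t) (ev z) c d) else 0 else 0 := by
    refine eval_sumN fun c _ => eval_sumN fun d _ => ?_
    rw [eval_ifLt, eval_ifLt, eval_χE h, eval_DE h]
    by_cases hc : c < I.χ
    · by_cases hd : d < I.D
      · rw [if_pos hc, if_pos hd, if_pos (show ev (.var c) < I.χ from hc),
          if_pos (show ev (.var d) < I.D from hd)]
        simp only [eval.eq_5, eval.eq_3, eval.eq_4]
        rw [eval_badKeptE h hs ht, eval_badForgottenE h hs ht, eval_srcE h hs ht]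
        simp only [Op.eval, eval]
        rw [hf _ (DPData.src_lt hc hd)]
        rfl
      · rw [if_pos hc, if_neg hd, if_pos (show ev (.var c) < I.χ from hc),
          if_neg (show ¬ ev (.var d) < I.D from hd)]
        rfl
    · rw [if_neg hc, if_neg (show ¬ ev (.var c) < I.χ from hc)]
      rfl
  simp only [convE, eval.eq_5]
  rw [this, eval_wtE h]
  rfl

/-- The factor of a child `s` is its fully transformed table, found at the last stage `S - 1` of the
preceding round. -/
theorem eval_startE {L R t x : Expr ℕ} (hL : ev L = I.L) (hx : ev x < I.L)
    (hcells : ∀ k < (ev R * I.m + ev t) * I.S * I.L, μ (I.base + k) = I.cellAt k) :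
    ev (startE L R t x) = I.start (ev R) (ev t) (ev x) := by
  simp only [startE, eval.eq_5]
  rcases hR : ev R with _ | R'
  · rw [if_neg (by simp)]; rfl
  rw [if_pos (by simp)]
  refine eval_prodM fun s hs => ?_
  rw [eval_ifEq, eval_ifEq, eval_rootE h, eval_parE h (t := .var s) hs]
  by_cases h1 : s = I.root
  · rw [if_pos h1, if_pos (show ev (.var s) = I.root from h1)]
    rfl
  rw [if_neg h1, if_neg (show ¬ ev (.var s) = I.root from h1)]
  by_cases h2 : I.par s = ev t
  · rw [if_pos h2, if_pos (show I.par (ev (.var s)) = ev t from h2), eval_cellLoad h]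
    have e1 : ev (.op .add (.op .mul (.op .add (.op .mul (.op .add
        (.op .mul (.op .sub R (.const 1)) mE) (.var s)) SE) (.op .sub SE (.const 1))) L) x) =
        ((R' * I.m + s) * I.S + (I.S - 1)) * I.L + ev x := by
      simp [eval, Op.eval, eval_mE h, eval_SE h, hR, hL]
    have hS : 0 < I.S := Nat.succ_pos _
    rw [e1, hcells, DPData.cellAt_eq hs (by omega) hx, ← h2, DPData.cell, if_neg, if_neg]
    · congr 1
      simp only [DPData.S]; omega
    · simp only [DPData.S]; omega
    · simp only [DPData.S]; omega
    -- Everything in round `R'` precedes everything in round `R' + 1`, whatever the order of the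
    -- nodes.
    · have e2 : (R' * I.m + s) * I.S + (I.S - 1) < (ev R * I.m + ev t) * I.S + 0 := by
        refine DPData.mul_add_lt ?_ (by omega)
        rw [hR]
        exact DPData.mul_add_lt (Nat.lt_succ_self _) hs
      exact DPData.mul_add_lt (y := 0) e2 hx
  · rw [if_neg h2, if_neg (show ¬ I.par (ev (.var s)) = ev t from h2)]
    rfl

/-- Stage 0 is the product over the children, stages `1, …, n²` undo the passes, stage `n² + 1` is
the table, stage `n² + 2` its conversion to the parent's bag, and `n²` forward passes follow. After
stage 0, only the preceding stage and, while undoing passes, smaller entries of the same stage are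
read. -/
theorem eval_stageE {L k R t j x : Expr ℕ} (hL : ev L = I.L)
    (hk : ev k = ((ev R * I.m + ev t) * I.S + ev j) * I.L + ev x)
    (ht : ev t < I.m) (hj : ev j < I.S) (hx : ev x < I.L)
    (hcells : ∀ k' < ev k, μ (I.base + k') = I.cellAt k') :
    ev (stageE L k R t j x) = I.cell (ev R) (ev t) (ev j) (ev x) := by
  have hn0 : 0 < I.n := by have := h.Δ_lt; omega
  have hNN : ev (.op .add nnE (.const 1)) = I.n * I.n + 1 := by
    simp [eval, Op.eval, eval_nnE h]
  have hNN2 : ev (.op .add nnE (.const 2)) = I.n * I.n + 2 := by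
    simp [eval, Op.eval, eval_nnE h]
  have hprev : ev (cellLoad (.op .sub k L)) = μ (I.base + (ev k - I.L)) := by
    rw [eval_cellLoad h]; simp [eval, Op.eval, hL]
  set a := ev R * I.m + ev t with ha
  -- Going back by `L` cells keeps the entry and lowers the stage by one.
  have hstep : ∀ j', ev j = j' + 1 → ev k - I.L = (a * I.S + j') * I.L + ev x := fun j' hj' => by
    rw [hk, hj', ← add_assoc, Nat.succ_mul]; omega
  have hcell : ∀ j' x', j' < ev j → x' < I.L →
      μ (I.base + ((a * I.S + j') * I.L + x')) = I.cell (ev R) (ev t) j' x' := fun j' x' h1 h2 => by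
    rw [hcells _ (by rw [hk]; exact DPData.mul_add_lt (by omega) h2), ha,
      DPData.cellAt_eq ht (by omega) h2]
  have hprev' : ∀ j', ev j = j' + 1 → ev (cellLoad (.op .sub k L)) =
      I.cell (ev R) (ev t) j' (ev x) := fun j' hj' => by
    rw [hprev, hstep j' hj', hcell j' _ (by omega) hx]
  have hpow : ∀ p : Expr ℕ, ev p < I.n * I.n →
      ev (powE QE (.op .div p nE)) = I.Q ^ (ev p / I.n) := fun p hp => by
    have h1 : ev (.op .div p nE) = ev p / I.n := by simp [eval, Op.eval, eval_nE h]
    rw [eval_powE (by rw [h1]; exact (Nat.div_lt_of_lt_mul hp).le), h1, eval_QE h]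
  rw [stageE, eval_ifEq, eval_ifLt, eval_ifEq, eval_ifEq, hNN, hNN2]
  simp only [eval.eq_2]
  by_cases c0 : ev j = 0
  · rw [if_pos c0, eval_startE h hL hx fun k' hk' => hcells k' (by
      rw [hk, c0, Nat.add_zero]; rw [← ha] at hk'; omega), c0,
      DPData.cell, if_pos (Nat.zero_le _), DPData.inv]
  rw [if_neg c0]
  obtain ⟨j', hj'⟩ := Nat.exists_eq_succ_of_ne_zero c0
  by_cases c1 : ev j < I.n * I.n + 1
  · have hp : ev (.op .sub nnE j) = I.n * I.n - (j' + 1) := by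
      simp [eval, Op.eval, eval_nnE h, hj']
    have hp' : ev (.op .sub nnE j) < I.n * I.n := by rw [hp]; omega
    rw [if_pos c1]
    simp only [eval.eq_3]
    rw [hprev' j' hj', eval_ifPass h hp', eval_cellLoad h, hp, hj', DPData.cell,
      if_pos (by omega : j' ≤ I.n * I.n), DPData.cell, if_pos (by omega : j' + 1 ≤ I.n * I.n),
      DPData.inv]
    simp only [Op.eval]
    congr 1
    by_cases c : (I.n * I.n - (j' + 1)) % I.n <
        I.dg (I.dig ((I.n * I.n - (j' + 1)) / I.n) (ev x))
    · rw [if_pos c, dif_pos c]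
      have hle := I.le_of_pos_dg_dig (Nat.zero_lt_of_lt c)
      -- An inverse pass subtracts a smaller entry of the same stage, which is already in place.
      have e1 : ev (.op .sub k (powE QE (.op .div (.op .sub nnE j) nE))) =
          (a * I.S + ev j) * I.L + (ev x - I.Q ^ ((I.n * I.n - (j' + 1)) / I.n)) := by
        have := hpow _ hp'
        rw [hp] at this
        simp only [eval.eq_3, Op.eval] at this ⊢
        rw [this, hk]
        omega
      rw [e1, hcells _ (by rw [hk]; omega), ha, DPData.cellAt_eq ht hj (by omega), hj',
        DPData.cell, if_pos (by omega)]
    · rw [if_neg c, dif_neg c]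
  rw [if_neg c1]
  by_cases c2 : ev j = I.n * I.n + 1
  · have hj2 : j' = I.n * I.n := by omega
    rw [if_pos c2]
    simp only [eval.eq_5]
    rw [eval_modE, hprev' j' hj']
    simp only [eval.eq_3, eval.eq_2]
    have hc : I.cell (ev R) (ev t) (I.n * I.n + 1) (ev x) = I.table (ev R) (ev t) (ev x) := by
      rw [DPData.cell, if_neg (by omega), if_pos rfl]
    rw [eval_wtE h, eval_BE h, c2, hc, hj2, DPData.cell, if_pos le_rfl, DPData.table_eq]
    rfl
  rw [if_neg c2]
  by_cases c3 : ev j = I.n * I.n + 2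
  · rw [if_pos c3]
    have hpar := eval_parE h ht
    -- Subtracting `L` and the entry number leads to the first cell of stage `n² + 1`, from which
    -- the whole table is addressed.
    have hA : ev (.op .add baseE (.op .sub (.op .sub k L) x)) =
        I.base + (a * I.S + (I.n * I.n + 1)) * I.L := by
      simp only [eval.eq_3, Op.eval, eval_baseE h, hL]
      rw [hstep (I.n * I.n + 1) c3]
      omega
    rw [eval_convE h (f := I.table (ev R) (ev t)) ht (by rw [hpar]; exact h.par_lt _ ht), hpar, c3,
      DPData.cell, if_neg (by omega), if_neg (by omega), Nat.sub_self, DPData.fwd]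
    intro y hy
    have hy' : y < I.L := hy.trans_le (DPData.pow_card_le_L ht)
    rw [hA, add_assoc, hcell _ _ (by omega) hy', DPData.cell, if_neg (by omega), if_pos rfl]
  rw [if_neg c3]
  have hp : ev (.op .sub j (.op .add nnE (.const 3))) = ev j - (I.n * I.n + 3) := by
    simp [eval, Op.eval, eval_nnE h]
  have hS : I.S = 2 * (I.n * I.n) + 3 := rfl
  have hp' : ev (.op .sub j (.op .add nnE (.const 3))) < I.n * I.n := by rw [hp]; omega
  have hfwd : ∀ x', I.cell (ev R) (ev t) j' x' =
      I.fwd (I.conv (I.table (ev R) (ev t)) (ev t) (I.par (ev t))) (ev j - (I.n * I.n + 3)) x' :=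
    fun x' => by
      rw [DPData.cell, if_neg (by omega), if_neg (by omega)]
      congr 1
      omega
  simp only [eval.eq_3]
  have hcur : I.cell (ev R) (ev t) (ev j) (ev x) =
      I.fwd (I.conv (I.table (ev R) (ev t)) (ev t) (I.par (ev t)))
        (ev j - (I.n * I.n + 3) + 1) (ev x) := by
    rw [DPData.cell, if_neg (by omega), if_neg (by omega)]
    congr 1
    omega
  rw [hprev' j' hj', eval_ifPass h hp', eval_cellLoad h, hp, hcur, DPData.fwd, ← hfwd]
  simp only [Op.eval]
  congr 1
  split_ifs with c
  · have hle := I.le_of_pos_dg_dig (Nat.zero_lt_of_lt c)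
    have e1 : ev (.op .sub (.op .sub k L)
          (powE QE (.op .div (.op .sub j (.op .add nnE (.const 3))) nE))) =
        (a * I.S + j') * I.L + (ev x - I.Q ^ ((ev j - (I.n * I.n + 3)) / I.n)) := by
      have := hpow _ hp'
      rw [hp] at this
      simp only [eval.eq_3, Op.eval] at this ⊢
      rw [this, hL, hstep j' hj']
      omega
    rw [e1, hcell _ _ (by omega) (by omega), hfwd]
  · rfl

theorem eval_cellE {L k : Expr ℕ} (hL : ev L = I.L) (hk : ev k < I.K)
    (hcells : ∀ k' < ev k, μ (I.base + k') = I.cellAt k') :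
    ev (cellE L k) = I.cellAt (ev k) := by
  have hpos : 0 < I.K := by omega
  have hL0 : 0 < I.L := Nat.pos_of_ne_zero fun h0 => by simp [DPData.K, h0] at hpos
  have hm0 : 0 < I.m := Nat.pos_of_ne_zero fun h0 => by simp [DPData.K, h0] at hpos
  have hS0 : 0 < I.S := Nat.succ_pos _
  have e1 : ev (modE k L) = ev k % I.L := by rw [eval_modE, hL]
  have e2 : ev (modE (.op .div k L) SE) = ev k / I.L % I.S := by
    rw [eval_modE, eval_SE h]; simp only [eval, Op.eval, hL]
  have e3 : ev (modE (.op .div (.op .div k L) SE) mE) = ev k / I.L / I.S % I.m := by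
    rw [eval_modE, eval_mE h]; simp only [eval, Op.eval, hL, eval_SE h]
  have e4 : ev (.op .div (.op .div (.op .div k L) SE) mE) = ev k / I.L / I.S / I.m := by
    simp only [eval, Op.eval, hL, eval_SE h, eval_mE h]
  rw [cellE, eval_stageE h hL, e1, e2, e3, e4, DPData.cellAt]
  · rw [e1, e2, e3, e4, mul_comm _ I.m, Nat.div_add_mod, mul_comm _ I.S, Nat.div_add_mod,
      mul_comm _ I.L, Nat.div_add_mod]
  · rw [e3]; exact Nat.mod_lt _ hm0
  · rw [e2]; exact Nat.mod_lt _ hS0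
  · rw [e1]; exact Nat.mod_lt _ hL0
  · exact hcells

end RAM.Expr

/-! ### Sums over digit expansions -/

theorem sum_range_mul_eq {M : Type*} [AddCommMonoid M] (a b : ℕ) (f : ℕ → ℕ → M) :
    ∑ d ∈ range (a * b), f (d % a) (d / a) = ∑ e ∈ range a, ∑ q ∈ range b, f e q := by
  rcases Nat.eq_zero_or_pos a with rfl | ha
  · simp
  rw [← sum_product']
  refine sum_nbij' (fun d => (d % a, d / a)) (fun p => p.2 * a + p.1) ?_ ?_ ?_ ?_ ?_
  · intro d hd
    simp only [mem_product, mem_range] at hd ⊢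
    exact ⟨Nat.mod_lt _ ha, Nat.div_lt_of_lt_mul hd⟩
  · rintro ⟨e, q⟩ hp
    simp only [mem_product, mem_range] at hp ⊢
    calc q * a + e < (q + 1) * a := by rw [Nat.succ_mul]; omega
      _ ≤ b * a := Nat.mul_le_mul_right _ hp.2
      _ = a * b := mul_comm _ _
  · intro d _
    simp only
    rw [mul_comm, Nat.div_add_mod]
  · rintro ⟨e, q⟩ hp
    simp only [mem_product, mem_range] at hp ⊢
    rw [mul_comm, Nat.mul_add_mod, Nat.mod_eq_of_lt hp.1, Nat.mul_add_div ha,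
      Nat.div_eq_of_lt hp.1, Nat.add_zero]
  · intro d _
    rfl

theorem div_mod_pow_succ (q i d : ℕ) : d / q ^ (i + 1) % q = d / q / q ^ i % q := by
  rw [Nat.div_div_eq_div_mul, pow_succ']

/-- Distributivity: base-`q` expansion makes the numbers below `q ^ n` the choices of one digit per
position. Through this, identities for whole entries reduce to identities for one digit. -/
theorem sum_prod_digits (q n : ℕ) (F : ℕ → ℕ → ℕ) :
    ∑ d ∈ range (q ^ n), ∏ i ∈ range n, F i (d / q ^ i % q) =
      ∏ i ∈ range n, ∑ e ∈ range q, F i e := by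
  induction n generalizing F with
  | zero => simp
  | succ n ih =>
    rw [prod_range_succ', ← ih fun i => F (i + 1), pow_succ']
    calc _ = ∑ d ∈ range (q * q ^ n), F 0 (d % q) *
          ∏ i ∈ range n, F (i + 1) (d / q / q ^ i % q) :=
          sum_congr rfl fun d _ => by
            rw [prod_range_succ', mul_comm]
            simp only [div_mod_pow_succ, pow_zero, Nat.div_one]
      _ = _ := by
          rw [sum_range_mul_eq q (q ^ n) fun e d =>
            F 0 e * ∏ i ∈ range n, F (i + 1) (d / q ^ i % q), mul_comm (∑ d ∈ _, _), sum_mul_sum]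

theorem eq_of_digits_eq {q n x y : ℕ} (hx : x < q ^ n) (hy : y < q ^ n)
    (h : ∀ i < n, x / q ^ i % q = y / q ^ i % q) : x = y := by
  induction n generalizing x y with
  | zero => simp at hx hy; omega
  | succ n ih =>
    rw [pow_succ'] at hx hy
    have h0 := h 0 (by omega)
    simp only [pow_zero, Nat.div_one] at h0
    have h1 : x / q = y / q := ih (Nat.div_lt_of_lt_mul hx) (Nat.div_lt_of_lt_mul hy)
      fun i hi => by rw [← div_mod_pow_succ, ← div_mod_pow_succ]; exact h _ (by omega)
    rw [← Nat.div_add_mod x q, ← Nat.div_add_mod y q, h0, h1]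

/-- The hypothesis excludes a carry out of position `j`. -/
theorem digit_add_pow {q y j : ℕ} (hc : y / q ^ j % q + 1 < q) (i : ℕ) :
    (y + q ^ j) / q ^ i % q = y / q ^ i % q + if i = j then 1 else 0 := by
  have hq : 0 < q := by omega
  rcases lt_trichotomy i j with h | rfl | h
  · obtain ⟨k, rfl⟩ := Nat.exists_eq_add_of_lt h
    rw [if_neg (by omega), show q ^ (i + k + 1) = q ^ i * (q * q ^ k) by ring,
      Nat.add_mul_div_left _ _ (by positivity), Nat.add_mul_mod_self_left, Nat.add_zero]
  · rw [if_pos rfl, Nat.add_div_right _ (by positivity)]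
    rw [Nat.add_mod, Nat.mod_eq_of_lt (show 1 < q by omega), Nat.mod_eq_of_lt hc]
  · obtain ⟨k, rfl⟩ := Nat.exists_eq_add_of_lt h
    rw [if_neg (by omega), Nat.add_zero, show q ^ (j + k + 1) = q ^ j * q * q ^ k by ring,
      ← Nat.div_div_eq_div_mul, ← Nat.div_div_eq_div_mul, ← Nat.div_div_eq_div_mul,
      ← Nat.div_div_eq_div_mul, Nat.add_div_right _ (by positivity)]
    congr 2
    set z := y / q ^ j
    have := Nat.div_add_mod z q
    rw [mul_comm] at this
    refine Nat.div_eq_of_lt_le (by omega) ?_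
    rw [Nat.succ_mul]
    omega

/-- The terms before `v` sum to less than the place value of `v`, and those after `v` are multiples
of the next place value. -/
theorem digit_sum {b e : ℕ → ℕ} {q : ℕ} (hb : ∀ u, b u ≤ 1) {k : ℕ}
    (he : ∀ u < k, b u ≠ 0 → e u < q) {v : ℕ} (hv : v < k) (hbv : b v ≠ 0) :
    (∑ u ∈ range k, if b u ≠ 0 then e u * q ^ (∑ w ∈ range u, b w) else 0) /
      q ^ (∑ w ∈ range v, b w) % q = e v := by
  induction k with
  | zero => omega
  | succ k ih =>
    have he' : ∀ u < k, b u ≠ 0 → e u < q := fun u hu => he u (by omega)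
    have hq : 0 < q := (Nat.zero_le _).trans_lt (he v hv hbv)
    rw [sum_range_succ]
    rcases Nat.lt_succ_iff_lt_or_eq.1 hv with h | rfl
    · rw [← ih he' h]
      split_ifs with hk
      · have h1 : ∑ w ∈ range (v + 1), b w ≤ ∑ w ∈ range k, b w :=
          sum_le_sum_of_subset (range_subset_range.2 h)
        have h2 := hb v
        rw [sum_range_succ, show b v = 1 by omega] at h1
        obtain ⟨j, hj⟩ := Nat.exists_eq_add_of_le h1
        rw [hj, show e k * q ^ (∑ w ∈ range v, b w + 1 + j) =
          q ^ (∑ w ∈ range v, b w) * (q * (e k * q ^ j)) by ring,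
          Nat.add_mul_div_left _ _ (by positivity), Nat.add_mul_mod_self_left]
      · rw [Nat.add_zero]
    · rw [if_pos hbv, mul_comm, Nat.add_mul_div_left _ _ (by positivity),
        Nat.div_eq_of_lt (DPData.sum_digits_lt v he'), Nat.zero_add, Nat.mod_eq_of_lt (he v hv hbv)]

theorem exists_digits {q n : ℕ} (e : ℕ → ℕ) (he : ∀ i < n, e i < q) :
    ∃ x < q ^ n, ∀ i < n, x / q ^ i % q = e i := by
  have h1 := DPData.sum_digits_lt (b := fun _ => 1) n fun u hu _ => he u hu
  refine ⟨_, by simpa using h1, fun i hi => ?_⟩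
  simpa using digit_sum (b := fun _ => 1) (fun _ => le_rfl) (fun u hu _ => he u hu) hi one_ne_zero

/-! ### The product of binomial coefficients -/

/-- The coefficients of a product of two binomial coefficients in the basis of binomial
coefficients. -/
def chooseMul (a b d : ℕ) : ℕ :=
  if a ≤ d ∧ d ≤ a + b then d.choose a * a.choose (a + b - d) else 0

theorem chooseMul_self (a b : ℕ) : chooseMul a b (a + b) = (a + b).choose a := by
  simp [chooseMul]

/-- Write `e = a + k`. Vandermonde gives `C(e, b) = ∑ C(a, p) C(k, b - p)`, and `C(e, a) C(k, b - p)
= C(e, d) C(d, a)` for `d = a + b - p`. Cutting the sum off at `D` loses nothing, because `C(e, d) =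
0` for `d ≥ D > e`. -/
theorem sum_chooseMul {D e : ℕ} (he : e < D) (a b : ℕ) :
    ∑ d ∈ range D, chooseMul a b d * e.choose d = e.choose a * e.choose b := by
  have hz : ∀ d, ¬ (a ≤ d ∧ d ≤ a + b) → chooseMul a b d * e.choose d = 0 := fun d hd => by
    rw [chooseMul, if_neg hd, zero_mul]
  have hz' : ∀ d, e < d → chooseMul a b d * e.choose d = 0 := fun d hd => by
    rw [Nat.choose_eq_zero_of_lt hd, mul_zero]
  have h1 : ∑ d ∈ range D, chooseMul a b d * e.choose d =
      ∑ q ∈ range (b + 1), chooseMul a b (a + q) * e.choose (a + q) := by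
    rw [← sum_subset (s₁ := (range D).filter fun d => a ≤ d ∧ d ≤ a + b) (filter_subset _ _)
      (fun d hd hd' => hz d fun h => hd' (mem_filter.2 ⟨hd, h⟩)),
      ← sum_subset (s₁ := (range (b + 1)).filter fun q => a + q < D) (filter_subset _ _)
      (fun q hq hq' => hz' _ (by
        by_contra h
        exact hq' (mem_filter.2 ⟨hq, by omega⟩)))]
    refine sum_nbij' (fun d => d - a) (fun q => a + q) ?_ ?_ ?_ ?_ ?_
    · intro d hd; simp only [mem_filter, mem_range] at hd ⊢; omega
    · intro d hd; simp only [mem_filter, mem_range] at hd ⊢; omega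
    · intro d hd; simp only [mem_filter, mem_range] at hd ⊢; omega
    · intro d hd; simp only [mem_filter, mem_range] at hd ⊢; omega
    · intro d hd
      simp only [mem_filter, mem_range] at hd
      rw [show a + (d - a) = d by omega]
  rw [h1]
  rcases lt_or_ge e a with h | h
  · rw [Nat.choose_eq_zero_of_lt h, zero_mul]
    exact sum_eq_zero fun q _ => by rw [Nat.choose_eq_zero_of_lt (by omega), mul_zero]
  · obtain ⟨k, rfl⟩ := Nat.exists_eq_add_of_le h
    rw [Nat.add_choose_eq a k b, Nat.sum_antidiagonal_eq_sum_range_succ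
      (fun p q => a.choose p * k.choose q), mul_sum, ← sum_range_reflect]
    refine sum_congr rfl fun p hp => ?_
    have hp' : p ≤ b := by simpa [Nat.lt_succ_iff] using hp
    have e1 : b + 1 - 1 - p = b - p := by omega
    rw [e1, chooseMul, if_pos (by omega), show a + b - (a + (b - p)) = p by omega]
    have e2 := Nat.choose_mul (n := a + k) (Nat.le_add_right a (b - p))
    rw [Nat.add_sub_cancel_left, Nat.add_sub_cancel_left] at e2
    calc _ = (a + k).choose (a + (b - p)) * (a + (b - p)).choose a * a.choose p := by ring
      _ = _ := by rw [e2]; ring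

namespace DPData

variable (I : DPData)

/-! ### The transform -/

/-- The kernel of the transform in one digit after `ρ` passes. -/
def ker1 (ρ e a : ℕ) : ℕ :=
  if I.col e = I.col a ∧ I.dg a ≤ I.dg e then (min (I.dg e) ρ).choose (I.dg e - I.dg a) else 0

/-- The kernel of the transform after `p` passes. -/
def ker (p x a : ℕ) : ℕ :=
  ∏ i ∈ range I.n, I.ker1 (min I.n (p - i * I.n)) (I.dig i x) (I.dig i a)

variable {I}

theorem col_dg_ext {e a : ℕ} (h : I.col e = I.col a) (h' : I.dg e = I.dg a) : e = a := by
  rw [← Nat.div_add_mod e I.D, ← Nat.div_add_mod a I.D]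
  rw [col, col] at h
  rw [dg, dg] at h'
  rw [h, h']

theorem dg_lt_D (e : ℕ) : I.dg e < I.D := Nat.mod_lt _ D_pos

theorem col_mul_add {c d : ℕ} (hd : d < I.D) : I.col (c * I.D + d) = c := by
  rw [col, mul_comm, Nat.mul_add_div D_pos, Nat.div_eq_of_lt hd, Nat.add_zero]

theorem dg_mul_add {c d : ℕ} (hd : d < I.D) : I.dg (c * I.D + d) = d := by
  rw [dg, mul_comm, Nat.mul_add_mod, Nat.mod_eq_of_lt hd]

theorem col_mul_add_dg (e : ℕ) : I.col e * I.D + I.dg e = e := by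
  rw [col, dg, mul_comm, Nat.div_add_mod]

theorem col_dg_sub {e k : ℕ} (h : k ≤ I.dg e) :
    I.col (e - k) = I.col e ∧ I.dg (e - k) = I.dg e - k := by
  have h1 : e - k = I.col e * I.D + (I.dg e - k) := by
    have := I.col_mul_add_dg e; omega
  have h2 : I.dg e - k < I.D := (Nat.sub_le _ _).trans_lt (dg_lt_D e)
  rw [h1, col_mul_add h2, dg_mul_add h2]
  exact ⟨rfl, rfl⟩

theorem ker1_zero (e a : ℕ) : I.ker1 0 e a = if e = a then 1 else 0 := by
  rw [ker1]
  by_cases h : e = a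
  · subst h; simp
  · rw [if_neg h]
    split_ifs with h'
    · have : I.dg e ≠ I.dg a := fun h'' => h (col_dg_ext h'.1 h'')
      rw [Nat.min_zero]
      exact Nat.choose_eq_zero_of_lt (by omega)
    · rfl

/-- This is Pascal's rule for the binomial coefficient with upper entry `ρ + 1`. Once `ρ` reaches
the degree of `e`, the minimum in the kernel is constant and the pass leaves the entry unchanged. -/
theorem ker1_succ (ρ e a : ℕ) : I.ker1 (ρ + 1) e a =
    I.ker1 ρ e a + if ρ < I.dg e then I.ker1 ρ (e - 1) a else 0 := by
  by_cases hρ : ρ < I.dg e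
  · obtain ⟨h1, h2⟩ := col_dg_sub (I := I) (e := e) (k := 1) (by omega)
    rw [if_pos hρ, ker1, ker1, ker1, h1, h2]
    by_cases hc : I.col e = I.col a
    · rcases lt_trichotomy (I.dg a) (I.dg e) with h | h | h
      · rw [if_pos ⟨hc, h.le⟩, if_pos ⟨hc, h.le⟩, if_pos ⟨hc, by omega⟩,
          min_eq_right (by omega), min_eq_right (by omega), min_eq_right (by omega),
          show I.dg e - I.dg a = I.dg e - 1 - I.dg a + 1 by omega, Nat.choose_succ_succ, add_comm]
      · rw [if_pos ⟨hc, h.le⟩, if_pos ⟨hc, h.le⟩, if_neg (by omega), h]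
        simp
      · rw [if_neg (by omega), if_neg (by omega), if_neg (by omega)]
    · rw [if_neg (by tauto), if_neg (by tauto), if_neg (by tauto)]
  · rw [if_neg hρ, ker1, ker1, min_eq_left (by omega), min_eq_left (by omega), Nat.add_zero]

/-- After `Δ` passes the cap `ρ` no longer matters, and symmetry of binomial coefficients gives the
binomial transform. -/
theorem ker1_full {ρ : ℕ} (hρ : I.Δ ≤ ρ) (e a : ℕ) :
    I.ker1 ρ e a = if I.col e = I.col a then (I.dg e).choose (I.dg a) else 0 := by
  have := I.dg_le e
  rw [ker1, min_eq_left (by omega)]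
  by_cases hc : I.col e = I.col a
  · by_cases h : I.dg a ≤ I.dg e
    · rw [if_pos ⟨hc, h⟩, if_pos hc, Nat.choose_symm h]
    · rw [if_neg (by tauto), if_pos hc, Nat.choose_eq_zero_of_lt (by omega)]
  · rw [if_neg (by tauto), if_neg hc]

/-- A positive degree means a positive digit, so nothing is borrowed. -/
theorem dig_sub_pow {j x : ℕ} (hQ : 0 < I.Q) (h : 0 < I.dg (I.dig j x)) (i : ℕ) :
    I.dig i (x - I.Q ^ j) = I.dig i x - if i = j then 1 else 0 := by
  obtain ⟨h1, h2⟩ := I.le_of_pos_dg_dig h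
  have h3 : I.dig j x ≠ 0 := by rintro h0; simp [h0, dg] at h
  have hx : x = x - I.Q ^ j + I.Q ^ j := by omega
  set y := x - I.Q ^ j
  -- If digit `j` of `y` were `Q - 1`, adding `Q ^ j` would carry and digit `j` of `x` would be
  -- zero.
  have h4 : y / I.Q ^ j % I.Q + 1 < I.Q := by
    by_contra hc
    have h5 : y / I.Q ^ j % I.Q + 1 = I.Q := by
      have := Nat.mod_lt (y / I.Q ^ j) hQ
      omega
    apply h3
    have e1 : x / I.Q ^ j = y / I.Q ^ j + 1 := by rw [hx, Nat.add_div_right _ h1]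
    have h6 : I.Q ∣ y / I.Q ^ j + 1 := by
      refine ⟨y / I.Q ^ j / I.Q + 1, ?_⟩
      have := Nat.div_add_mod (y / I.Q ^ j) I.Q
      rw [Nat.mul_add]
      omega
    rw [dig, e1]
    exact Nat.mod_eq_zero_of_dvd h6
  rw [hx, dig, dig, digit_add_pow h4]
  omega

/-- Pass `p = j n + r` acts on digit `j` alone, which has undergone `r` passes before; the other
factors of the kernel do not change. -/
theorem ker_succ (hQ : 0 < I.Q) {p : ℕ} (hp : p < I.n * I.n) (x a : ℕ) :
    I.ker (p + 1) x a = I.ker p x a +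
      if p % I.n < I.dg (I.dig (p / I.n) x) then I.ker p (x - I.Q ^ (p / I.n)) a else 0 := by
  have hn : 0 < I.n := Nat.pos_of_ne_zero fun h => by simp [h] at hp
  set j := p / I.n with hj
  have hjn : j < I.n := Nat.div_lt_of_lt_mul hp
  have hpj : p = j * I.n + p % I.n := by rw [hj, mul_comm, Nat.div_add_mod]
  have hr : p % I.n < I.n := Nat.mod_lt _ hn
  set r := p % I.n
  have hρ : min I.n (p - j * I.n) = r := by
    rw [hpj, Nat.add_sub_cancel_left]; omega
  have hρ' : min I.n (p + 1 - j * I.n) = r + 1 := by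
    rw [hpj, Nat.add_assoc, Nat.add_sub_cancel_left]; omega
  have hother : ∀ i, i ≠ j → min I.n (p + 1 - i * I.n) = min I.n (p - i * I.n) := fun i hi => by
    rcases lt_or_gt_of_ne hi with h | h
    · have : (i + 1) * I.n ≤ j * I.n := Nat.mul_le_mul_right _ h
      rw [Nat.succ_mul] at this
      omega
    · have : (j + 1) * I.n ≤ i * I.n := Nat.mul_le_mul_right _ h
      rw [Nat.succ_mul] at this
      omega
  have hmem : j ∈ range I.n := mem_range.2 hjn
  set R := ∏ i ∈ (range I.n).erase j, I.ker1 (min I.n (p - i * I.n)) (I.dig i x) (I.dig i a)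
    with hR
  have h1 : I.ker (p + 1) x a = I.ker1 (r + 1) (I.dig j x) (I.dig j a) * R := by
    rw [ker, ← mul_prod_erase _ _ hmem, hρ', hR]
    congr 1
    exact prod_congr rfl fun i hi => by rw [hother i (ne_of_mem_erase hi)]
  have h2 : I.ker p x a = I.ker1 r (I.dig j x) (I.dig j a) * R := by
    rw [ker, ← mul_prod_erase _ _ hmem, hρ]
  rw [h1, h2, ker1_succ, add_mul]
  congr 1
  split_ifs with hd
  · rw [ker, ← mul_prod_erase _ _ hmem, hρ, dig_sub_pow hQ (by omega), if_pos rfl]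
    congr 1
    refine prod_congr rfl fun i hi => ?_
    rw [dig_sub_pow hQ (by omega), if_neg (ne_of_mem_erase hi), Nat.sub_zero]
  · simp

theorem ker_zero {x a : ℕ} (hx : x < I.Q ^ I.n) (ha : a < I.Q ^ I.n) :
    I.ker 0 x a = if x = a then 1 else 0 := by
  simp only [ker, Nat.zero_sub, Nat.min_zero, ker1_zero]
  split_ifs with h
  · subst h; simp
  · by_contra h0
    refine h (eq_of_digits_eq hx ha fun i hi => ?_)
    have := prod_ne_zero_iff.1 h0 i (mem_range.2 hi)
    by_contra hne
    exact this (if_neg hne)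

theorem fwd_eq (hQ : 0 < I.Q) (w : ℕ → ℕ) {p x : ℕ} (hp : p ≤ I.n * I.n) (hx : x < I.Q ^ I.n) :
    I.fwd w p x = ∑ a ∈ range (I.Q ^ I.n), w a * I.ker p x a := by
  induction p generalizing x with
  | zero =>
    rw [fwd, sum_eq_single x]
    · rw [ker_zero hx hx, if_pos rfl, mul_one]
    · intro a ha hne
      rw [ker_zero hx (mem_range.1 ha), if_neg (Ne.symm hne), mul_zero]
    · intro h; exact absurd (mem_range.2 hx) h
  | succ p ih =>
    rw [fwd, ih (by omega) hx]
    simp only [ker_succ hQ (show p < I.n * I.n by omega), mul_add, sum_add_distrib]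
    congr 1
    split_ifs
    · exact ih (by omega) (by omega)
    · simp

/-- Passes are undone last to first. Within a pass the system is unitriangular in `x`, hence the
strong induction on `x`. The truncated subtraction is exact because the current values are forward
values, each a sum of naturals containing the subtrahend. -/
theorem inv_eq {z w : ℕ → ℕ} (hz : ∀ x < I.Q ^ I.n, z x = I.fwd w (I.n * I.n) x) {j : ℕ}
    (hj : j ≤ I.n * I.n) {x : ℕ} (hx : x < I.Q ^ I.n) :
    I.inv z j x = I.fwd w (I.n * I.n - j) x := by
  induction j generalizing x with
  | zero => rw [inv, hz x hx, Nat.sub_zero]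
  | succ j ih =>
    induction x using Nat.strong_induction_on with
    | _ x ihx =>
      rw [inv, ih (by omega) hx, show I.n * I.n - j = I.n * I.n - (j + 1) + 1 by omega, fwd]
      split_ifs with h
      · have := I.le_of_pos_dg_dig (Nat.zero_lt_of_lt h)
        rw [ihx _ (by omega) (by omega)]
        omega
      · omega

/-! ### Products of transforms -/

/-- The structure constants of one digit. -/
def mulDig (I : DPData) (a b d : ℕ) : ℕ :=
  if I.col a = I.col d ∧ I.col b = I.col d then chooseMul (I.dg a) (I.dg b) (I.dg d) else 0

/-- The array whose transform is the product of the transforms of `f` and `g`. -/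
def star (I : DPData) (f g : ℕ → ℕ) (d : ℕ) : ℕ :=
  ∑ a ∈ range (I.Q ^ I.n), ∑ b ∈ range (I.Q ^ I.n),
    f a * g b * ∏ i ∈ range I.n, I.mulDig (I.dig i a) (I.dig i b) (I.dig i d)

theorem sum_range_Q (F : ℕ → ℕ → ℕ) :
    ∑ e ∈ range I.Q, F (I.col e) (I.dg e) = ∑ c ∈ range I.χ, ∑ d ∈ range I.D, F c d := by
  rw [sum_comm, ← sum_range_mul_eq I.D I.χ fun d c => F c d, mul_comm I.D]
  rfl

theorem sum_range_Q_col {k : ℕ} (hk : k < I.χ) (F : ℕ → ℕ) :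
    ∑ e ∈ range I.Q, (if I.col e = k then F (I.dg e) else 0) = ∑ d ∈ range I.D, F d := by
  rw [sum_range_Q fun c d => if c = k then F d else 0, sum_eq_single k]
  · simp
  · intro c _ hc; simp [hc]
  · intro h; exact absurd (mem_range.2 hk) h

theorem col_lt {e : ℕ} (he : e < I.Q) : I.col e < I.χ :=
  Nat.div_lt_of_lt_mul (by rw [mul_comm]; exact he)

/-- Colors have to agree, so they multiply pointwise; within one color this is `sum_chooseMul`. -/
theorem sum_mulDig {ρ : ℕ} (hρ : I.Δ ≤ ρ) {e : ℕ} (he : e < I.Q) (a b : ℕ) :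
    ∑ d ∈ range I.Q, I.mulDig a b d * I.ker1 ρ e d = I.ker1 ρ e a * I.ker1 ρ e b := by
  simp only [ker1_full hρ]
  have h1 : ∀ d, I.mulDig a b d * (if I.col e = I.col d then (I.dg e).choose (I.dg d) else 0) =
      if I.col d = I.col e then (if I.col a = I.col e ∧ I.col b = I.col e then
        chooseMul (I.dg a) (I.dg b) (I.dg d) else 0) * (I.dg e).choose (I.dg d) else 0 := by
    intro d
    by_cases h : I.col d = I.col e
    · rw [if_pos h, if_pos h.symm, mulDig, h]
    · rw [if_neg h, if_neg (Ne.symm h), mul_zero]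
  rw [sum_congr rfl fun d _ => h1 d, sum_range_Q_col (col_lt he) fun d =>
    (if I.col a = I.col e ∧ I.col b = I.col e then chooseMul (I.dg a) (I.dg b) d else 0) *
      (I.dg e).choose d]
  by_cases h : I.col a = I.col e ∧ I.col b = I.col e
  · simp only [if_pos h, if_pos h.1.symm, if_pos h.2.symm]
    exact sum_chooseMul (dg_lt_D e) _ _
  · simp only [if_neg h, zero_mul, sum_const_zero]
    rw [not_and_or] at h
    rcases h with h | h
    · rw [if_neg (Ne.symm h), zero_mul]
    · rw [if_neg (Ne.symm h), mul_zero]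

/-- After all `n²` passes every digit has had at least `Δ` of its own, so its kernel is complete. -/
theorem le_min_sub {i : ℕ} (hΔ : I.Δ < I.n) (hi : i < I.n) :
    I.Δ ≤ min I.n (I.n * I.n - i * I.n) := by
  rw [← Nat.sub_mul]
  have : 1 * I.n ≤ (I.n - i) * I.n := Nat.mul_le_mul_right _ (by omega)
  omega

/-- The kernel is a product over digits, so its multiplication rule follows from the one-digit rule
by `sum_prod_digits`. -/
theorem fwd_mul_fwd (hQ : 0 < I.Q) (hΔ : I.Δ < I.n) (f g : ℕ → ℕ) {x : ℕ} (hx : x < I.Q ^ I.n) :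
    I.fwd f (I.n * I.n) x * I.fwd g (I.n * I.n) x = I.fwd (I.star f g) (I.n * I.n) x := by
  have key : ∀ a b, ∑ d ∈ range (I.Q ^ I.n),
      (∏ i ∈ range I.n, I.mulDig (I.dig i a) (I.dig i b) (I.dig i d)) * I.ker (I.n * I.n) x d =
      I.ker (I.n * I.n) x a * I.ker (I.n * I.n) x b := by
    intro a b
    simp only [ker, ← prod_mul_distrib]
    refine (sum_prod_digits I.Q I.n fun i e => I.mulDig (I.dig i a) (I.dig i b) e *
      I.ker1 (min I.n (I.n * I.n - i * I.n)) (I.dig i x) e).trans ?_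
    exact prod_congr rfl fun i hi =>
      sum_mulDig (le_min_sub hΔ (mem_range.1 hi)) (dig_lt hQ _ _) _ _
  rw [fwd_eq hQ _ le_rfl hx, fwd_eq hQ _ le_rfl hx, fwd_eq hQ _ le_rfl hx, sum_mul_sum]
  simp only [star, sum_mul]
  conv_rhs => rw [sum_comm]
  refine sum_congr rfl fun a _ => ?_
  conv_rhs => rw [sum_comm]
  refine sum_congr rfl fun b _ => ?_
  calc f a * I.ker (I.n * I.n) x a * (g b * I.ker (I.n * I.n) x b)
      = f a * g b * (I.ker (I.n * I.n) x a * I.ker (I.n * I.n) x b) := by ring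
    _ = _ := by
      rw [← key a b, mul_sum]
      exact sum_congr rfl fun d _ => by ring

end DPData

namespace DPData

variable {I : DPData}

/-! ### Arrays graded by total degree -/

/-- The total degree of an entry. -/
def dgSum (I : DPData) (x : ℕ) : ℕ := ∑ i ∈ range I.n, I.dg (I.dig i x)

theorem wt_eq (x : ℕ) : I.wt x = I.B ^ I.dgSum x := by rw [wt, dgSum, prod_pow_eq_pow_sum]

theorem B_pos : 0 < I.B := pow_pos (Nat.succ_pos _) _

theorem wt_pos (x : ℕ) : 0 < I.wt x := by rw [wt_eq]; exact pow_pos B_pos _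

theorem dgSum_le (x : ℕ) : I.dgSum x ≤ I.n * I.Δ := by
  calc I.dgSum x ≤ ∑ i ∈ range I.n, I.Δ := sum_le_sum fun i _ => I.dg_le _
    _ = I.n * I.Δ := by simp

/-- The leading part of `w`, in the grading by total degree, is at most `c ^ d` in degree `d`, and
it is nonzero exactly on `A`. -/
def Represents (I : DPData) (w : ℕ → ℕ) (A : ℕ → Prop) (c : ℕ) : Prop :=
  ∀ d < I.Q ^ I.n, ∃ q r, w d = I.wt d * (q + I.B * r) ∧ q ≤ c ^ I.dgSum d ∧ (q ≠ 0 ↔ A d)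

/-- The entry `d` is composed of `a` and `b`: the colors agree and the degrees add up. -/
def Splits (I : DPData) (a b d : ℕ) : Prop := ∀ i < I.n,
  I.col (I.dig i a) = I.col (I.dig i d) ∧ I.col (I.dig i b) = I.col (I.dig i d) ∧
    I.dg (I.dig i a) + I.dg (I.dig i b) = I.dg (I.dig i d)

theorem Splits.dgSum_add {a b d : ℕ} (h : I.Splits a b d) : I.dgSum a + I.dgSum b = I.dgSum d := by
  rw [dgSum, dgSum, dgSum, ← sum_add_distrib]
  exact sum_congr rfl fun i hi => (h i (mem_range.1 hi)).2.2

theorem Splits.prod_mulDig {a b d : ℕ} (h : I.Splits a b d) :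
    ∏ i ∈ range I.n, I.mulDig (I.dig i a) (I.dig i b) (I.dig i d) =
      ∏ i ∈ range I.n, (I.dg (I.dig i d)).choose (I.dg (I.dig i a)) :=
  prod_congr rfl fun i hi => by
    obtain ⟨h1, h2, h3⟩ := h i (mem_range.1 hi)
    rw [mulDig, if_pos ⟨h1, h2⟩, ← h3, chooseMul_self]

/-- A nonzero structure constant forces equal colors and `d_i ≤ a_i + b_i` in every digit, so not
splitting means strict inequality in some digit. -/
theorem dgSum_lt_of_not_splits {a b d : ℕ} (h : ¬ I.Splits a b d)
    (h0 : ∏ i ∈ range I.n, I.mulDig (I.dig i a) (I.dig i b) (I.dig i d) ≠ 0) :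
    I.dgSum d < I.dgSum a + I.dgSum b := by
  have h1 : ∀ i < I.n, (I.col (I.dig i a) = I.col (I.dig i d) ∧
      I.col (I.dig i b) = I.col (I.dig i d)) ∧
      I.dg (I.dig i d) ≤ I.dg (I.dig i a) + I.dg (I.dig i b) := fun i hi => by
    have := prod_ne_zero_iff.1 h0 i (mem_range.2 hi)
    rw [mulDig] at this
    split_ifs at this with hc
    · rw [chooseMul] at this
      split_ifs at this with hd
      · exact ⟨hc, hd.2⟩
      · exact absurd rfl this
    · exact absurd rfl this
  rw [Splits] at h
  push Not at h
  obtain ⟨i, hi, hne⟩ := h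
  rw [dgSum, dgSum, dgSum, ← sum_add_distrib]
  refine sum_lt_sum (fun j hj => (h1 j (mem_range.1 hj)).2) ⟨i, mem_range.2 hi, ?_⟩
  obtain ⟨⟨h2, h3⟩, h4⟩ := h1 i hi
  exact lt_of_le_of_ne h4 (Ne.symm (hne h2 h3))

/-- One digit of the bound in `Represents.star`. -/
def splitDig (I : DPData) (c a b d : ℕ) : ℕ :=
  if I.col a = I.col d then if I.col b = I.col d then if I.dg a + I.dg b = I.dg d then
    c ^ I.dg a * (I.dg d).choose (I.dg a) else 0 else 0 else 0

/-- The choice of `a` determines `b`, and what remains is the binomial expansion of `(c + 1) ^ d`.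
-/
theorem sum_splitDig (c : ℕ) {d : ℕ} (hd : d < I.Q) :
    ∑ a ∈ range I.Q, ∑ b ∈ range I.Q, I.splitDig c a b d = (c + 1) ^ I.dg d := by
  have h1 : ∀ a, ∑ b ∈ range I.Q, I.splitDig c a b d = if I.col a = I.col d then
      (if I.dg a ≤ I.dg d then c ^ I.dg a * (I.dg d).choose (I.dg a) else 0) else 0 := by
    intro a
    by_cases hc : I.col a = I.col d
    · simp only [splitDig, if_pos hc]
      rw [sum_range_Q_col (col_lt hd) fun j => if I.dg a + j = I.dg d then
        c ^ I.dg a * (I.dg d).choose (I.dg a) else 0]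
      split_ifs with hle
      · rw [sum_eq_single (I.dg d - I.dg a), if_pos (by omega)]
        · intro j _ hj; rw [if_neg (by omega)]
        · intro h
          exact absurd (mem_range.2 ((Nat.sub_le _ _).trans_lt (dg_lt_D d))) h
      · exact sum_eq_zero fun j _ => by rw [if_neg (by omega)]
    · simp [splitDig, if_neg hc]
  rw [sum_congr rfl fun a _ => h1 a, sum_range_Q_col (col_lt hd) fun j =>
    if j ≤ I.dg d then c ^ j * (I.dg d).choose j else 0, ← sum_filter, add_pow]
  refine sum_congr ?_ fun j _ => by simp
  ext j
  have := dg_lt_D (I := I) d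
  simp only [mem_filter, mem_range]
  omega

theorem sum_sum_splitDig (hQ : 0 < I.Q) (c d : ℕ) :
    ∑ a ∈ range (I.Q ^ I.n), ∑ b ∈ range (I.Q ^ I.n),
      ∏ i ∈ range I.n, I.splitDig c (I.dig i a) (I.dig i b) (I.dig i d) =
      (c + 1) ^ I.dgSum d := by
  have h1 : ∀ a, ∑ b ∈ range (I.Q ^ I.n),
      ∏ i ∈ range I.n, I.splitDig c (I.dig i a) (I.dig i b) (I.dig i d) =
      ∏ i ∈ range I.n, ∑ b ∈ range I.Q, I.splitDig c (I.dig i a) b (I.dig i d) := fun a =>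
    sum_prod_digits I.Q I.n fun i e => I.splitDig c (I.dig i a) e (I.dig i d)
  rw [sum_congr rfl fun a _ => h1 a]
  refine (sum_prod_digits I.Q I.n fun i e =>
    ∑ b ∈ range I.Q, I.splitDig c e b (I.dig i d)).trans ?_
  rw [dgSum, ← prod_pow_eq_pow_sum]
  exact prod_congr rfl fun i _ => sum_splitDig c (dig_lt hQ _ _)

/-- A pair `a, b` enters with weight `B ^ (|a| + |b|)`. This equals the weight of `d` if the pair
splits `d`, and otherwise exceeds it by a power of `B` that goes into the remainder. The leading
part is a sum of nonnegative terms, so nothing cancels: it is nonzero as soon as one splitting pair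
exists. -/
theorem Represents.star (hQ : 0 < I.Q) {f g : ℕ → ℕ} {A A' : ℕ → Prop} {c : ℕ}
    (hf : I.Represents f A c) (hg : I.Represents g A' 1) :
    I.Represents (I.star f g) (fun d => ∃ a < I.Q ^ I.n, ∃ b < I.Q ^ I.n,
      A a ∧ A' b ∧ I.Splits a b d) (c + 1) := by
  classical
  choose! qf rf hf1 hf2 hf3 using hf
  choose! qg rg hg1 hg2 hg3 using hg
  intro d hd
  set P := fun a b => ∏ i ∈ range I.n, I.mulDig (I.dig i a) (I.dig i b) (I.dig i d) with hP
  set T := fun a b => if I.Splits a b d then qf a * qg b * P a b else 0 with hT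
  have hterm : ∀ a b, ∃ r, a < I.Q ^ I.n → b < I.Q ^ I.n →
      f a * g b * P a b = I.wt d * (T a b + I.B * r) := by
    intro a b
    by_cases ha : a < I.Q ^ I.n
    swap
    · exact ⟨0, fun h => absurd h ha⟩
    by_cases hb : b < I.Q ^ I.n
    swap
    · exact ⟨0, fun _ h => absurd h hb⟩
    by_cases hs : I.Splits a b d
    · refine ⟨(qf a * rg b + rf a * qg b + I.B * rf a * rg b) * P a b, fun _ _ => ?_⟩
      rw [hf1 a ha, hg1 b hb, hT, wt_eq, wt_eq, wt_eq, ← hs.dgSum_add, pow_add]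
      simp only [if_pos hs]
      ring
    · by_cases h0 : P a b = 0
      · exact ⟨0, fun _ _ => by simp [hT, hs, h0]⟩
      · have hlt := dgSum_lt_of_not_splits hs h0
        obtain ⟨k, hk⟩ := Nat.exists_eq_add_of_lt hlt
        -- Here `|a| + |b| = |d| + k + 1`; one of the surplus factors `B` is the one required in
        -- front of the remainder.
        refine ⟨I.B ^ k * (qf a + I.B * rf a) * (qg b + I.B * rg b) * P a b, fun _ _ => ?_⟩
        have e : I.wt a * I.wt b = I.wt d * I.B ^ k * I.B := by
          rw [wt_eq, wt_eq, wt_eq, ← pow_add, hk]; ring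
        rw [hf1 a ha, hg1 b hb, hT]
        simp only [if_neg hs]
        calc _ = (I.wt a * I.wt b) * ((qf a + I.B * rf a) * (qg b + I.B * rg b) * P a b) := by ring
          _ = _ := by rw [e]; ring
  choose r hr using hterm
  refine ⟨∑ a ∈ range (I.Q ^ I.n), ∑ b ∈ range (I.Q ^ I.n), T a b,
    ∑ a ∈ range (I.Q ^ I.n), ∑ b ∈ range (I.Q ^ I.n), r a b, ?_, ?_, ?_⟩
  · rw [mul_sum, ← sum_add_distrib, mul_sum]
    refine sum_congr rfl fun a ha => ?_
    rw [mul_sum, ← sum_add_distrib, mul_sum]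
    exact sum_congr rfl fun b hb => hr a b (mem_range.1 ha) (mem_range.1 hb)
  · rw [← sum_sum_splitDig hQ]
    refine sum_le_sum fun a ha => sum_le_sum fun b hb => ?_
    simp only [hT]
    split_ifs with hs
    -- The bound for a splitting pair is the corresponding summand of the expansion of `(c + 1) ^
    -- |d|` in `sum_sum_splitDig`.
    · have e1 : ∏ i ∈ range I.n, I.splitDig c (I.dig i a) (I.dig i b) (I.dig i d) =
          c ^ I.dgSum a * P a b := by
        rw [hP]
        simp only
        rw [hs.prod_mulDig, dgSum, ← prod_pow_eq_pow_sum, ← prod_mul_distrib]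
        refine prod_congr rfl fun i hi => ?_
        obtain ⟨h1, h2, h3⟩ := hs i (mem_range.1 hi)
        rw [splitDig, if_pos h1, if_pos h2, if_pos h3]
      rw [e1]
      have := hf2 a (mem_range.1 ha)
      have h1 := hg2 b (mem_range.1 hb)
      rw [one_pow] at h1
      calc _ ≤ c ^ I.dgSum a * 1 * P a b := by gcongr
        _ = _ := by rw [mul_one]
    · exact Nat.zero_le _
  · constructor
    · intro h
      obtain ⟨a, ha, h⟩ := exists_ne_zero_of_sum_ne_zero h
      obtain ⟨b, hb, h⟩ := exists_ne_zero_of_sum_ne_zero h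
      have ha := mem_range.1 ha
      have hb := mem_range.1 hb
      simp only [hT] at h
      split_ifs at h with hs
      · refine ⟨a, ha, b, hb, (hf3 a ha).1 ?_, (hg3 b hb).1 ?_, hs⟩
        · rintro h0; simp [h0] at h
        · rintro h0; simp [h0] at h
      · exact absurd rfl h
    · rintro ⟨a, ha, b, hb, hA, hA', hs⟩ h0
      have h1 := sum_eq_zero_iff.1 (sum_eq_zero_iff.1 h0 a (mem_range.2 ha)) b (mem_range.2 hb)
      simp only [hT, if_pos hs] at h1
      have h2 : P a b ≠ 0 := by
        simp only [hP]
        rw [hs.prod_mulDig]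
        refine prod_ne_zero_iff.2 fun i hi => (Nat.choose_pos ?_).ne'
        have := (hs i (mem_range.1 hi)).2.2
        omega
      exact mul_ne_zero (mul_ne_zero ((hf3 a ha).2 hA) ((hg3 b hb).2 hA')) h2 h1

/-- The entry `d` is composed of entries of the members of `C`. -/
def SplitsAll (I : DPData) (C : Finset ℕ) (A : ℕ → ℕ → Prop) (d : ℕ) : Prop :=
  ∃ a : ℕ → ℕ, (∀ s ∈ C, a s < I.Q ^ I.n ∧ A s (a s) ∧
    ∀ i < I.n, I.col (I.dig i (a s)) = I.col (I.dig i d)) ∧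
    ∀ i < I.n, ∑ s ∈ C, I.dg (I.dig i (a s)) = I.dg (I.dig i d)

/-- Only degree zero is an empty sum of degrees, which fits the bound `0 ^ |d|` with `0 ^ 0 = 1`.
This array starts the induction on the set of children. -/
theorem represents_unit {A : ℕ → ℕ → Prop} : I.Represents (fun d => if I.dgSum d = 0 then 1 else 0)
    (I.SplitsAll ∅ A) 0 := by
  intro d _
  have hA : I.SplitsAll ∅ A d ↔ I.dgSum d = 0 := by
    simp [SplitsAll, dgSum, sum_eq_zero_iff, eq_comm (a := 0)]
  by_cases h : I.dgSum d = 0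
  · exact ⟨1, 0, by simp [wt_eq, h], by simp [h], by simp [hA, h]⟩
  · exact ⟨0, 0, by simp [h], by simp, by simp [hA, h]⟩

/-- Exactly one entry of total degree zero has the colors of `x`, and its kernel is a product of
coefficients `C(·, 0) = 1`. -/
theorem fwd_unit (hQ : 0 < I.Q) (hΔ : I.Δ < I.n) {x : ℕ} (hx : x < I.Q ^ I.n) :
    I.fwd (fun d => if I.dgSum d = 0 then 1 else 0) (I.n * I.n) x = 1 := by
  rw [fwd_eq hQ _ le_rfl hx]
  have h1 : ∀ a, (if I.dgSum a = 0 then 1 else 0) * I.ker (I.n * I.n) x a =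
      ∏ i ∈ range I.n, (if I.dg (I.dig i a) = 0 then 1 else 0) *
        I.ker1 (min I.n (I.n * I.n - i * I.n)) (I.dig i x) (I.dig i a) := by
    intro a
    rw [prod_mul_distrib, ← ker]
    congr 1
    by_cases h : I.dgSum a = 0
    · rw [if_pos h, prod_eq_one fun i hi => if_pos (sum_eq_zero_iff.1 h i hi)]
    · rw [if_neg h]
      obtain ⟨i, hi, hne⟩ := exists_ne_zero_of_sum_ne_zero h
      exact (prod_eq_zero hi (if_neg hne)).symm
  rw [sum_congr rfl fun a _ => h1 a]
  refine (sum_prod_digits I.Q I.n fun i e => (if I.dg e = 0 then 1 else 0) *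
    I.ker1 (min I.n (I.n * I.n - i * I.n)) (I.dig i x) e).trans ?_
  refine prod_eq_one fun i hi => ?_
  simp only [ker1_full (le_min_sub hΔ (mem_range.1 hi))]
  have h2 : ∀ e, (if I.dg e = 0 then 1 else 0) *
      (if I.col (I.dig i x) = I.col e then (I.dg (I.dig i x)).choose (I.dg e) else 0) =
      if I.col e = I.col (I.dig i x) then (if I.dg e = 0 then 1 else 0) else 0 := by
    intro e
    by_cases h : I.dg e = 0 <;> simp [h, eq_comm]
  rw [sum_congr rfl fun e _ => h2 e, sum_range_Q_col (col_lt (dig_lt hQ _ _)) fun j =>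
    if j = 0 then 1 else 0]
  simp [D_pos]

/-- Children are multiplied in one at a time with `star`; each raises the base of the bound by one,
so it ends at the number of children. -/
theorem exists_represents_prod (hQ : 0 < I.Q) (hΔ : I.Δ < I.n) (C : Finset ℕ) (g : ℕ → ℕ → ℕ)
    (A : ℕ → ℕ → Prop) (hg : ∀ s ∈ C, I.Represents (g s) (A s) 1) :
    ∃ w, (∀ x < I.Q ^ I.n, ∏ s ∈ C, I.fwd (g s) (I.n * I.n) x = I.fwd w (I.n * I.n) x) ∧
      I.Represents w (I.SplitsAll C A) C.card := by
  classical
  induction C using Finset.induction_on with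
  | empty => exact ⟨_, fun x hx => by rw [prod_empty, fwd_unit hQ hΔ hx], represents_unit⟩
  | insert s C hs ih =>
    obtain ⟨w, hw, hr⟩ := ih fun s' hs' => hg s' (mem_insert_of_mem hs')
    refine ⟨I.star w (g s), fun x hx => ?_, ?_⟩
    · rw [prod_insert hs, hw x hx, mul_comm, fwd_mul_fwd hQ hΔ _ _ hx]
    · rw [card_insert_of_notMem hs]
      have := hr.star hQ (hg s (mem_insert_self s C))
      intro d hd
      obtain ⟨q, r, h1, h2, h3⟩ := this d hd
      refine ⟨q, r, h1, h2, h3.trans ⟨?_, ?_⟩⟩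
      · rintro ⟨a, ha, b, hb, ⟨a', ha', ha''⟩, hA, hsp⟩
        refine ⟨Function.update a' s b, fun s' hs' => ?_, fun i hi => ?_⟩
        · rcases mem_insert.1 hs' with rfl | h
          · rw [Function.update_self]
            exact ⟨hb, hA, fun i hi => (hsp i hi).2.1⟩
          · rw [Function.update_of_ne (by rintro rfl; exact hs h)]
            obtain ⟨g1, g2, g3⟩ := ha' s' h
            exact ⟨g1, g2, fun i hi => (g3 i hi).trans (hsp i hi).1⟩
        · rw [sum_insert hs, Function.update_self, ← (hsp i hi).2.2, ← ha'' i hi, add_comm]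
          congr 1
          exact sum_congr rfl fun s' h => by
            rw [Function.update_of_ne (by rintro rfl; exact hs h)]
      · rintro ⟨a, ha, hsum⟩
        have hle : ∀ i < I.n, ∑ s' ∈ C, I.dg (I.dig i (a s')) ≤ I.dg (I.dig i d) := fun i hi => by
          rw [← hsum i hi, sum_insert hs]; omega
        -- The intermediate entry has the colors of `d` and the degrees contributed by the children
        -- other than `s`. These partial sums are at most the degrees of `d`, so they are legal
        -- digits.
        obtain ⟨d', hd', hdig⟩ := exists_digits (q := I.Q) (n := I.n)
          (fun i => I.col (I.dig i d) * I.D + ∑ s' ∈ C, I.dg (I.dig i (a s'))) fun i hi =>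
            add_lt_Q (col_lt (dig_lt hQ _ _)) ((hle i hi).trans_lt (dg_lt_D _))
        have hcol : ∀ i < I.n, I.col (I.dig i d') = I.col (I.dig i d) := fun i hi => by
          rw [dig, hdig i hi, col_mul_add ((hle i hi).trans_lt (dg_lt_D _))]
        have hdg : ∀ i < I.n, I.dg (I.dig i d') = ∑ s' ∈ C, I.dg (I.dig i (a s')) := fun i hi => by
          rw [dig, hdig i hi, dg_mul_add ((hle i hi).trans_lt (dg_lt_D _))]
        obtain ⟨h1, h2, h3⟩ := ha s (mem_insert_self s C)
        refine ⟨d', hd', a s, h1, ⟨a, fun s' hs' => ?_, fun i hi => (hdg i hi).symm⟩, h2,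
          fun i hi => ⟨hcol i hi, h3 i hi, ?_⟩⟩
        · obtain ⟨g1, g2, g3⟩ := ha s' (mem_insert_of_mem hs')
          exact ⟨g1, g2, fun i hi => (g3 i hi).trans (hcol i hi).symm⟩
        · rw [hdg i hi, ← hsum i hi, sum_insert hs, add_comm]

/-- Modulo `B ^ (|x| + 1)`, the value `B ^ |x| (q + B r)` leaves `B ^ |x| q`, provided that `q < B`.
-/
theorem norm_eq {z w : ℕ → ℕ} {A : ℕ → Prop} {c x : ℕ} (hw : I.Represents w A c) (hc : c ≤ I.m)
    (hm : 0 < I.m) (hΔ : I.Δ < I.n) (hx : x < I.Q ^ I.n) (hz : z x = w x) [Decidable (A x)] :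
    I.norm z x = if A x then 1 else 0 := by
  obtain ⟨q, r, h1, h2, h3⟩ := hw x hx
  -- The total degree is at most `n Δ < n²`, the exponent in `B = (m + 1) ^ (n²)`; `m > 0` makes the
  -- power strictly increasing.
  have hq : q < I.B := by
    have e1 : I.dgSum x < I.n * I.n :=
      (dgSum_le x).trans_lt (Nat.mul_lt_mul_of_pos_left hΔ (by omega))
    calc q ≤ c ^ I.dgSum x := h2
      _ ≤ (I.m + 1) ^ I.dgSum x := Nat.pow_le_pow_left (by omega) _
      _ < I.B := Nat.pow_lt_pow_right (by omega) e1
  rw [norm, hz, h1, Nat.mul_mod_mul_left, Nat.add_mul_mod_self_left, Nat.mod_eq_of_lt hq]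
  have hwt := wt_pos (I := I) x
  by_cases hA : A x
  · rw [if_pos hA, if_pos (mul_ne_zero hwt.ne' (h3.2 hA))]
  · rw [if_neg hA, if_neg]
    rw [not_not, mul_eq_zero]
    exact Or.inr (by by_contra h; exact hA (h3.1 h))

theorem represents_conv (f : ℕ → ℕ) (s t : ℕ) :
    I.Represents (I.conv f s t) (fun z => I.conv f s t z ≠ 0) 1 := by
  intro d _
  have hwt := wt_pos (I := I) d
  by_cases h : I.conv f s t d = 0
  · exact ⟨0, 0, by simp [h], by simp, by simp [h]⟩
  · refine ⟨1, 0, ?_, by simp, by simp [h]⟩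
    rw [conv] at h ⊢
    split_ifs at h ⊢ with h'
    · simp
    · exact absurd rfl h

/-- The set of children of `t`. -/
def childSet (I : DPData) (t : ℕ) : Finset ℕ :=
  (range I.m).filter fun s => s ≠ I.root ∧ I.par s = t

-- The product over the children is the transform of an array representing `SplitsAll`; inverting
-- all passes recovers it. There are at most `m` children, as the choice of `B` requires.
open Classical in
theorem table_succ (hQ : 0 < I.Q) (hm : 0 < I.m) (hΔ : I.Δ < I.n) (R t : ℕ) {x : ℕ} (hx : x < I.Q ^ I.n) :
    I.table (R + 1) t x = if I.SplitsAll (I.childSet t)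
      (fun s z => I.conv (I.table R s) s t z ≠ 0) x then 1 else 0 := by
  obtain ⟨w, hw, hr⟩ := exists_represents_prod hQ hΔ (I.childSet t)
    (fun s => I.conv (I.table R s) s t) _ fun s _ => represents_conv (I.table R s) s t
  have hj : ∀ y < I.Q ^ I.n, I.joinAll (I.table R) t y = I.fwd w (I.n * I.n) y := fun y hy => by
    rw [← hw y hy, joinAll, childSet, prod_filter]
    refine prod_congr rfl fun s _ => ?_
    by_cases h1 : s = I.root <;> by_cases h2 : I.par s = t <;> simp [h1, h2]
  refine norm_eq hr ?_ hm hΔ hx ?_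
  · exact (card_filter_le _ _).trans (by simp)
  · rw [inv_eq hj le_rfl hx, Nat.sub_self, fwd]

end DPData

/-! ### Trees given by parent functions -/

namespace ParentTree

variable {m : ℕ} (T : ParentTree m)

open Classical in
/-- The distance to the root. -/
noncomputable def depth (t : Fin m) : ℕ := Nat.find (T.reaches_root t)

/-- `x` lies in the subtree rooted at `s`. -/
def Below (s x : Fin m) : Prop := ∃ k : ℕ, T.parent^[k] x = s

variable {T}

theorem depth_root : T.depth T.root = 0 := by
  classical
  exact (Nat.find_eq_zero _).2 rfl

theorem depth_parent {t : Fin m} (ht : t ≠ T.root) : T.depth t = T.depth (T.parent t) + 1 := by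
  classical
  have h1 : T.parent^[T.depth t] t = T.root := Nat.find_spec (T.reaches_root t)
  have h2 : T.parent^[T.depth (T.parent t)] (T.parent t) = T.root :=
    Nat.find_spec (T.reaches_root (T.parent t))
  have h3 : T.depth t ≤ T.depth (T.parent t) + 1 := Nat.find_min' _ h2
  obtain ⟨k, hk⟩ : ∃ k, T.depth t = k + 1 := Nat.exists_eq_succ_of_ne_zero fun h0 => by
    rw [h0] at h1; exact ht h1
  rw [hk] at h1
  have h4 : T.depth (T.parent t) ≤ k := Nat.find_min' _ h1
  omega

theorem depth_parent_le (t : Fin m) : T.depth (T.parent t) ≤ T.depth t := by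
  by_cases h : t = T.root
  · rw [h, T.parent_root]
  · rw [depth_parent h]; omega

theorem depth_iterate_le (k : ℕ) (t : Fin m) : T.depth (T.parent^[k] t) ≤ T.depth t := by
  induction k with
  | zero => rfl
  | succ k ih => rw [Function.iterate_succ_apply']; exact (depth_parent_le _).trans ih

theorem depth_iterate {t : Fin m} {k : ℕ} (hk : k ≤ T.depth t) :
    T.depth (T.parent^[k] t) = T.depth t - k := by
  induction k with
  | zero => rfl
  | succ k ih =>
    have h1 := ih (by omega)
    have h2 : T.parent^[k] t ≠ T.root := fun h => by rw [h, depth_root] at h1; omega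
    have h3 := depth_parent h2
    rw [Function.iterate_succ_apply']
    omega

/-- The nodes on the path to the root have different depths, so they are `depth t + 1` different
nodes. -/
theorem depth_lt (t : Fin m) : T.depth t < m := by
  have hinj : Function.Injective fun i : Fin (T.depth t + 1) => T.parent^[(i : ℕ)] t := by
    intro i j hij
    have hi := depth_iterate (t := t) (Nat.lt_succ_iff.1 i.2)
    have hj := depth_iterate (t := t) (Nat.lt_succ_iff.1 j.2)
    simp only at hij
    rw [hij] at hi
    exact Fin.ext (by omega)
  simpa using Fintype.card_le_of_injective _ hinj

theorem below_root (x : Fin m) : T.Below T.root x := T.reaches_root x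

theorem below_self (s : Fin m) : T.Below s s := ⟨0, rfl⟩

theorem not_below_parent {s : Fin m} (hs : s ≠ T.root) : ¬ T.Below s (T.parent s) := by
  rintro ⟨k, hk⟩
  have h1 := depth_iterate_le (T := T) k (T.parent s)
  rw [hk, depth_parent hs] at h1
  omega

theorem mem_children {s t : Fin m} : s ∈ T.children t ↔ s ≠ T.root ∧ T.parent s = t := by
  simp [children]

theorem below_iff {t x : Fin m} : T.Below t x ↔ x = t ∨ ∃ s ∈ T.children t, T.Below s x := by
  classical
  constructor
  · intro h
    have h1 := Nat.find_spec h
    rcases hk : Nat.find h with _ | k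
    · rw [hk] at h1; exact Or.inl h1
    · rw [hk, Function.iterate_succ_apply'] at h1
      refine Or.inr ⟨T.parent^[k] x, mem_children.2 ⟨fun h2 => ?_, h1⟩, k, rfl⟩
      -- If the node before `t` were the root, `t` would be the root too and would be reached in `k`
      -- steps, against minimality.
      refine Nat.find_min h (m := k) (by omega) ?_
      rw [h2] at h1 ⊢
      rw [← h1, T.parent_root]
  · rintro (rfl | ⟨s, hs, k, hk⟩)
    · exact below_self _
    · exact ⟨k + 1, by rw [Function.iterate_succ_apply', hk, (mem_children.1 hs).2]⟩

/-- Otherwise two siblings would be ancestors of `x`, so one of them would be a proper ancestor of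
the other, although they have equal depth. -/
theorem not_below_of_ne {s s' t x : Fin m} (hs : s ∈ T.children t) (hs' : s' ∈ T.children t)
    (hne : s ≠ s') (h : T.Below s x) : ¬ T.Below s' x := by
  rw [mem_children] at hs hs'
  rintro ⟨l, hl⟩
  obtain ⟨k, hk⟩ := h
  have hd : T.depth s = T.depth s' := by
    rw [depth_parent hs.1, depth_parent hs'.1, hs.2, hs'.2]
  have key : ∀ {a b : Fin m} {i j : ℕ}, a ≠ T.root → T.depth a = T.depth b → a ≠ b →
      T.parent^[i] x = a → T.parent^[j] x = b → i ≤ j → False := by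
    intro a b i j ha hd hab hi hj hij
    obtain ⟨e, rfl⟩ := Nat.exists_eq_add_of_le' hij
    rw [Function.iterate_add_apply, hi] at hj
    rcases e with _ | e
    · exact hab hj
    · rw [Function.iterate_succ_apply] at hj
      have h1 := depth_iterate_le (T := T) e (T.parent a)
      rw [hj] at h1
      have := depth_parent ha
      omega
  rcases le_total k l with h | h
  · exact key hs.1 hd hne hk hl h
  · exact key hs'.1 hd.symm hne.symm hl hk h

/-- The only edge leaving a subtree joins its root to the parent. -/
theorem below_or_of_adj {s a b : Fin m} (h : T.graph.Adj a b) (ha : T.Below s a) :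
    T.Below s b ∨ (a = s ∧ b = T.parent s) := by
  rw [graph, SimpleGraph.fromRel_adj] at h
  obtain ⟨k, hk⟩ := ha
  rcases h.2 with h | h
  · rcases k with _ | k
    · have hk : a = s := hk
      subst hk
      exact Or.inr ⟨rfl, h.symm⟩
    · rw [Function.iterate_succ_apply, h] at hk
      exact Or.inl ⟨k, hk⟩
  · exact Or.inl ⟨k + 1, by rw [Function.iterate_succ_apply, h, hk]⟩

end ParentTree

/-! ### Separation in tree decompositions -/

namespace NiceTreeDecomposition

variable {n m : ℕ} {G : SimpleGraph (Fin n)} (D : NiceTreeDecomposition G m)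

open Classical in
/-- The vertices in the bags of the subtree rooted at `s`. -/
noncomputable def sub (s : Fin m) : Finset (Fin n) :=
  univ.filter fun v => ∃ x, D.Below s x ∧ v ∈ D.bag x

/-- The vertices in the bags of the subtree of `s` that are not in the bag of `s`. -/
noncomputable def low (s : Fin m) : Finset (Fin n) := D.sub s \ D.bag s

/-- The vertices in the bags of the subtree of `s` that are not in the bag of the parent of `s`. -/
noncomputable def lowParent (s : Fin m) : Finset (Fin n) := D.sub s \ D.bag (D.parent s)

variable {D}

theorem mem_sub {s : Fin m} {v : Fin n} : v ∈ D.sub s ↔ ∃ x, D.Below s x ∧ v ∈ D.bag x := by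
  simp [sub]

theorem bag_subset_sub (s : Fin m) : D.bag s ⊆ D.sub s := fun _ hv =>
  mem_sub.2 ⟨s, ParentTree.below_self s, hv⟩

theorem sub_root : D.sub D.root = univ := by
  ext v
  obtain ⟨t, ht⟩ := D.vertex_mem v
  simpa using mem_sub.2 ⟨t, ParentTree.below_root t, ht⟩

/-- The nodes containing `v` are connected, so a walk among them leaves the subtree of `s`,
necessarily through the edge from `s` to its parent. -/
theorem mem_bag_of_mem_of_mem {s x y : Fin m} {v : Fin n} (hx : D.Below s x) (hvx : v ∈ D.bag x)
    (hy : ¬ D.Below s y) (hvy : v ∈ D.bag y) : v ∈ D.bag s ∧ v ∈ D.bag (D.parent s) := by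
  by_contra hcon
  apply hy
  have h := (D.connected v).preconnected ⟨x, hvx⟩ ⟨y, hvy⟩
  rw [SimpleGraph.reachable_iff_reflTransGen] at h
  have key : ∀ z : {t | v ∈ D.bag t}, Relation.ReflTransGen
      (D.toParentTree.graph.induce {t | v ∈ D.bag t}).Adj ⟨x, hvx⟩ z → D.Below s z := by
    intro z hz
    induction hz with
    | refl => exact hx
    | @tail b c _ hbc ih =>
      have hadj : D.toParentTree.graph.Adj b.1 c.1 := hbc
      rcases ParentTree.below_or_of_adj hadj ih with h | ⟨h1, h2⟩
      · exact h
      · exact absurd ⟨h1 ▸ b.2, h2 ▸ c.2⟩ hcon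
  exact key _ h

theorem mem_bag_of_mem_sub {s : Fin m} (hs : s ≠ D.root) {v : Fin n} (hv : v ∈ D.sub s)
    (hv' : v ∈ D.bag (D.parent s)) : v ∈ D.bag s := by
  obtain ⟨x, hx, hvx⟩ := mem_sub.1 hv
  exact (mem_bag_of_mem_of_mem hx hvx (ParentTree.not_below_parent hs) hv').1

/-- A bag containing the edge cannot lie outside the subtree, since `u` would then be in the bags of
both `s` and its parent. -/
theorem mem_sub_of_adj {s : Fin m} {u w : Fin n} (hu : u ∈ D.sub s)
    (hu' : u ∉ D.bag s ∨ u ∉ D.bag (D.parent s)) (h : G.Adj u w) : w ∈ D.sub s := by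
  obtain ⟨x, hx, hux⟩ := mem_sub.1 hu
  obtain ⟨y, huy, hwy⟩ := D.edge_mem u w h
  by_cases hy : D.Below s y
  · exact mem_sub.2 ⟨y, hy, hwy⟩
  · have := mem_bag_of_mem_of_mem hx hux hy huy
    tauto

theorem low_eq_biUnion (t : Fin m) : D.low t = (D.children t).biUnion D.lowParent := by
  ext v
  simp only [low, lowParent, mem_sdiff, mem_biUnion, mem_sub]
  constructor
  · rintro ⟨⟨x, hx, hvx⟩, hv⟩
    rcases ParentTree.below_iff.1 hx with rfl | ⟨s, hs, hsx⟩
    · exact absurd hvx hv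
    · exact ⟨s, hs, ⟨x, hsx, hvx⟩, by rwa [(ParentTree.mem_children.1 hs).2]⟩
  · rintro ⟨s, hs, ⟨x, hx, hvx⟩, hv⟩
    rw [(ParentTree.mem_children.1 hs).2] at hv
    exact ⟨⟨x, ParentTree.below_iff.2 (Or.inr ⟨s, hs, hx⟩), hvx⟩, hv⟩

/-- A vertex occurring below two siblings also occurs in the bag of their parent. -/
theorem disjoint_lowParent {s s' t : Fin m} (hs : s ∈ D.children t) (hs' : s' ∈ D.children t)
    (hne : s ≠ s') : Disjoint (D.lowParent s) (D.lowParent s') := by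
  rw [Finset.disjoint_left]
  intro v hv hv'
  simp only [lowParent, mem_sdiff, mem_sub] at hv hv'
  obtain ⟨⟨x, hx, hvx⟩, hvt⟩ := hv
  obtain ⟨⟨y, hy, hvy⟩, -⟩ := hv'
  exact hvt (mem_bag_of_mem_of_mem hx hvx
    (ParentTree.not_below_of_ne hs' hs hne.symm hy) hvy).2

theorem lowParent_eq {s : Fin m} (hs : s ≠ D.root) :
    D.lowParent s = D.low s ∪ (D.bag s \ D.bag (D.parent s)) := by
  ext v
  simp only [lowParent, low, mem_union, mem_sdiff]
  constructor
  · tauto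
  · rintro (⟨h1, h2⟩ | ⟨h1, h2⟩)
    · exact ⟨h1, fun h => h2 (mem_bag_of_mem_sub hs h1 h)⟩
    · exact ⟨bag_subset_sub s h1, h2⟩

theorem disjoint_low (s : Fin m) (X : Finset (Fin n)) : Disjoint (D.low s) (D.bag s \ X) := by
  rw [Finset.disjoint_left]
  intro v hv hv'
  exact (mem_sdiff.1 hv).2 (mem_sdiff.1 hv').1

end NiceTreeDecomposition

/-! ### Partial defective colorings -/

section

variable {n m : ℕ} (G : SimpleGraph (Fin n))

open Classical in
/-- The number of neighbors of `v` in `S` that have the color of `v`. -/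
noncomputable def sameColor (ψ : Fin n → ℕ) (S : Finset (Fin n)) (v : Fin n) : ℕ :=
  (S.filter fun u => G.Adj v u ∧ ψ u = ψ v).card

/-- A coloring that is given by `c` on `X`, obeys the degree bound on `F`, and gives the vertices in
`X` the degrees `d` into `F`. -/
def PartialColoring (χ Δ : ℕ) (X F : Finset (Fin n)) (c d : Fin n → ℕ) : Prop :=
  ∃ ψ : Fin n → ℕ, (∀ v, ψ v < χ) ∧ (∀ v ∈ X, ψ v = c v) ∧
    (∀ v ∈ F, sameColor G ψ univ v ≤ Δ) ∧ ∀ v ∈ X, sameColor G ψ F v = d v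

variable {G}

theorem sameColor_congr {ψ ψ' : Fin n → ℕ} {S : Finset (Fin n)} {v : Fin n} (hv : ψ v = ψ' v)
    (h : ∀ u ∈ S, G.Adj v u → ψ u = ψ' u) : sameColor G ψ S v = sameColor G ψ' S v := by
  classical
  rw [sameColor, sameColor]
  congr 1
  refine filter_congr fun u hu => ?_
  refine and_congr_right fun ha => ?_
  rw [h u hu ha, hv]

theorem sameColor_mono (ψ : Fin n → ℕ) {S S' : Finset (Fin n)} (h : S ⊆ S') (v : Fin n) :
    sameColor G ψ S v ≤ sameColor G ψ S' v := by
  classical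
  exact card_le_card (filter_subset_filter _ h)

theorem sameColor_union {ψ : Fin n → ℕ} {S S' : Finset (Fin n)} (h : Disjoint S S') (v : Fin n) :
    sameColor G ψ (S ∪ S') v = sameColor G ψ S v + sameColor G ψ S' v := by
  classical
  rw [sameColor, filter_union, card_union_of_disjoint (disjoint_filter_filter h)]
  rfl

theorem sameColor_eq_of_subset {ψ : Fin n → ℕ} {S S' : Finset (Fin n)} {v : Fin n} (h : S ⊆ S')
    (h' : ∀ u ∈ S', G.Adj v u → u ∈ S) : sameColor G ψ S' v = sameColor G ψ S v := by
  classical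
  rw [sameColor, sameColor]
  congr 1
  ext u
  simp only [mem_filter]
  constructor
  · rintro ⟨h1, h2, h3⟩; exact ⟨h' u h1 h2, h2, h3⟩
  · rintro ⟨h1, h2⟩; exact ⟨h h1, h2⟩

variable {χ Δ : ℕ} {D : NiceTreeDecomposition G m}

theorem sameColor_low (ψ : Fin n → ℕ) (t : Fin m) (v : Fin n) :
    sameColor G ψ (D.low t) v = ∑ s ∈ D.children t, sameColor G ψ (D.lowParent s) v := by
  classical
  rw [sameColor, NiceTreeDecomposition.low_eq_biUnion, filter_biUnion, card_biUnion]
  · rfl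
  · intro s hs s' hs' hne
    exact disjoint_filter_filter (NiceTreeDecomposition.disjoint_lowParent hs hs' hne)

/-- Colorings for the children can be glued: they agree on the bag of `t`, their other parts are
disjoint, and a vertex of `lowParent s` has neighbors only in `lowParent s` and the bag of `t`. The
degrees into the disjoint parts add up. -/
theorem partialColoring_low_iff (hχ : 0 < χ) {t : Fin m} {c d : Fin n → ℕ}
    (hc : ∀ v ∈ D.bag t, c v < χ) :
    PartialColoring G χ Δ (D.bag t) (D.low t) c d ↔ ∃ δ : Fin m → Fin n → ℕ,
      (∀ s ∈ D.children t, PartialColoring G χ Δ (D.bag t) (D.lowParent s) c (δ s)) ∧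
      ∀ v ∈ D.bag t, ∑ s ∈ D.children t, δ s v = d v := by
  classical
  constructor
  · rintro ⟨ψ, h1, h2, h3, h4⟩
    refine ⟨fun s v => sameColor G ψ (D.lowParent s) v, fun s hs =>
      ⟨ψ, h1, h2, fun v hv => h3 v ?_, fun _ _ => rfl⟩, fun v hv => ?_⟩
    · rw [NiceTreeDecomposition.low_eq_biUnion]
      exact mem_biUnion.2 ⟨s, hs, hv⟩
    · rw [← sameColor_low, h4 v hv]
  · rintro ⟨δ, h1, h2⟩
    choose! ψ g1 g2 g3 g4 using h1
    -- Outside the subtree the color is irrelevant; 0 is legal because `χ > 0`.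
    set φ : Fin n → ℕ := fun v => if v ∈ D.bag t then c v else
      if h : ∃ s ∈ D.children t, v ∈ D.lowParent s then ψ h.choose v else 0 with hφ
    have e1 : ∀ v ∈ D.bag t, φ v = c v := fun v hv => if_pos hv
    have e2 : ∀ s ∈ D.children t, ∀ v ∈ D.lowParent s, φ v = ψ s v := by
      intro s hs v hv
      have hvt : v ∉ D.bag t := by
        have := (mem_sdiff.1 hv).2
        rwa [(ParentTree.mem_children.1 hs).2] at this
      have hex : ∃ s ∈ D.children t, v ∈ D.lowParent s := ⟨s, hs, hv⟩
      rw [hφ]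
      simp only [if_neg hvt, dif_pos hex]
      obtain ⟨k1, k2⟩ := hex.choose_spec
      by_contra hne
      refine Finset.disjoint_left.1 (NiceTreeDecomposition.disjoint_lowParent k1 hs ?_) k2 hv
      rintro h; rw [h] at hne; exact hne rfl
    have e3 : ∀ s ∈ D.children t, ∀ v ∈ D.bag t, φ v = ψ s v := fun s hs v hv => by
      rw [e1 v hv, g2 s hs v hv]
    have e4 : ∀ s ∈ D.children t, ∀ v ∈ D.bag t,
        sameColor G φ (D.lowParent s) v = δ s v := fun s hs v hv => by
      rw [← g4 s hs v hv]
      exact sameColor_congr (e3 s hs v hv) fun u hu _ => e2 s hs u hu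
    refine ⟨φ, fun v => ?_, e1, fun v hv => ?_, fun v hv => ?_⟩
    · simp only [hφ]
      split_ifs with h h'
      · exact hc v h
      · exact g1 _ h'.choose_spec.1 v
      · exact hχ
    · rw [NiceTreeDecomposition.low_eq_biUnion] at hv
      obtain ⟨s, hs, hv⟩ := mem_biUnion.1 hv
      refine le_of_eq_of_le (sameColor_congr (e2 s hs v hv) fun u _ hu => ?_) (g3 s hs v hv)
      have hsub := NiceTreeDecomposition.mem_sub_of_adj (mem_sdiff.1 hv).1
        (Or.inr (mem_sdiff.1 hv).2) hu
      by_cases hut : u ∈ D.bag t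
      · exact e3 s hs u hut
      · exact e2 s hs u (mem_sdiff.2 ⟨hsub, by rwa [(ParentTree.mem_children.1 hs).2]⟩)
    · rw [sameColor_low, ← h2 v hv]
      exact sum_congr rfl fun s hs => e4 s hs v hv

open Classical in
/-- The number of neighbors of `u` in `W` if `u` has color `k`. -/
noncomputable def newHits (G : SimpleGraph (Fin n)) (W : Finset (Fin n)) (c : Fin n → ℕ) (k : ℕ)
    (u : Fin n) : ℕ :=
  (W.filter fun w => G.Adj u w ∧ c u = k).card

open Classical in
/-- The number of neighbors of `w` in `X` of color `k`. -/
noncomputable def oldHits (G : SimpleGraph (Fin n)) (X : Finset (Fin n)) (c : Fin n → ℕ) (k : ℕ)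
    (w : Fin n) : ℕ :=
  (X.filter fun u => G.Adj u w ∧ c u = k).card

theorem sameColor_lowParent {s : Fin m} (hs : s ≠ D.root) {ψ c : Fin n → ℕ} {k : ℕ}
    (hk : ∀ w ∈ D.bag s \ D.bag (D.parent s), ψ w = k) {u : Fin n} (hu : ψ u = c u) :
    sameColor G ψ (D.lowParent s) u = sameColor G ψ (D.low s) u +
      newHits G (D.bag s \ D.bag (D.parent s)) c k u := by
  classical
  rw [NiceTreeDecomposition.lowParent_eq hs,
    sameColor_union (NiceTreeDecomposition.disjoint_low s _)]
  congr 1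
  rw [sameColor, newHits]
  congr 1
  refine filter_congr fun w hw => ?_
  rw [hk w hw, hu, eq_comm (a := k)]

/-- When `w` is forgotten, all its neighbors lie in `low s` or in the bag of `s`. Since `w` is the
only vertex dropped, those in the bag also lie in the parent's bag, so the final degree of `w` is
known. -/
theorem sameColor_forgotten {s : Fin m} {ψ c : Fin n → ℕ} {k : ℕ}
    (hW : ∀ w ∈ D.bag s \ D.bag (D.parent s), ∀ w' ∈ D.bag s \ D.bag (D.parent s), w = w')
    {w : Fin n} (hw : w ∈ D.bag s \ D.bag (D.parent s)) (hk : ψ w = k)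
    (hc : ∀ u ∈ D.bag s ∩ D.bag (D.parent s), ψ u = c u) :
    sameColor G ψ univ w = sameColor G ψ (D.low s) w +
      oldHits G (D.bag s ∩ D.bag (D.parent s)) c k w := by
  classical
  have hws := mem_sdiff.1 hw
  have hdisj : Disjoint (D.low s) (D.bag s ∩ D.bag (D.parent s)) := by
    rw [Finset.disjoint_left]
    intro v hv hv'
    exact (mem_sdiff.1 hv).2 (mem_inter.1 hv').1
  rw [sameColor_eq_of_subset (S := D.low s ∪ (D.bag s ∩ D.bag (D.parent s))) (subset_univ _),
    sameColor_union hdisj]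
  · congr 1
    rw [sameColor, oldHits]
    congr 1
    refine filter_congr fun u hu => ?_
    rw [hk, hc u hu, G.adj_comm]
  · intro u _ hu
    have h1 := NiceTreeDecomposition.mem_sub_of_adj
      (NiceTreeDecomposition.bag_subset_sub s hws.1) (Or.inr hws.2) hu
    rw [mem_union, mem_inter, NiceTreeDecomposition.low, mem_sdiff]
    by_cases h2 : u ∈ D.bag s
    · by_cases h3 : u ∈ D.bag (D.parent s)
      · exact Or.inr ⟨h2, h3⟩
      · have := hW u (mem_sdiff.2 ⟨h2, h3⟩) w hw
        subst this
        exact absurd hu (G.loopless.irrefl _)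
    · exact Or.inl ⟨h1, h2⟩

/-- The numbers `k` and `e` are color and degree of the vertex being forgotten, if there is one. A
vertex that is new in the parent's bag has no forgotten neighbor yet; a kept vertex of color `k`
gains one for each adjacent forgotten vertex; the forgotten vertex has to meet the degree bound for
good. -/
theorem partialColoring_lowParent_iff (hχ : 0 < χ) {s : Fin m} (hs : s ≠ D.root)
    (hW : ∀ w ∈ D.bag s \ D.bag (D.parent s), ∀ w' ∈ D.bag s \ D.bag (D.parent s), w = w')
    {c d : Fin n → ℕ} (hc : ∀ v ∈ D.bag (D.parent s), c v < χ) :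
    PartialColoring G χ Δ (D.bag (D.parent s)) (D.lowParent s) c d ↔ ∃ k < χ, ∃ e ≤ Δ,
      (∀ u ∈ D.bag (D.parent s), u ∉ D.bag s → d u = 0) ∧
      (∀ u ∈ D.bag (D.parent s), u ∈ D.bag s →
        newHits G (D.bag s \ D.bag (D.parent s)) c k u ≤ d u) ∧
      (∀ w ∈ D.bag s \ D.bag (D.parent s),
        e + oldHits G (D.bag s ∩ D.bag (D.parent s)) c k w ≤ Δ) ∧
      PartialColoring G χ Δ (D.bag s) (D.low s)
        (fun u => if u ∈ D.bag (D.parent s) then c u else k)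
        (fun u => if u ∈ D.bag (D.parent s) then
          d u - newHits G (D.bag s \ D.bag (D.parent s)) c k u else e) := by
  classical
  set W := D.bag s \ D.bag (D.parent s) with hWdef
  -- A new vertex adjacent to something hidden below would lie in the subtree of `s`, and hence in
  -- the bag of `s`.
  have hW0 : ∀ ψ : Fin n → ℕ, ∀ u ∈ D.bag (D.parent s), u ∉ D.bag s →
      sameColor G ψ (D.lowParent s) u = 0 := by
    intro ψ u hu hus
    rw [sameColor, card_eq_zero, filter_eq_empty_iff]
    rintro w hw ⟨hadj, -⟩
    have hw := mem_sdiff.1 hw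
    exact hus (NiceTreeDecomposition.mem_bag_of_mem_sub hs
      (NiceTreeDecomposition.mem_sub_of_adj hw.1 (Or.inr hw.2) hadj.symm) hu)
  constructor
  · rintro ⟨ψ, h1, h2, h3, h4⟩
    have hWlow : ∀ w ∈ W, w ∈ D.lowParent s := fun w hw => by
      rw [NiceTreeDecomposition.lowParent_eq hs]; exact mem_union_right _ hw
    -- If nothing is forgotten, the guess is idle and any legal values serve.
    obtain ⟨k, hk, e, he, hk', he'⟩ : ∃ k < χ, ∃ e ≤ Δ, (∀ w ∈ W, ψ w = k) ∧
        ∀ w ∈ W, sameColor G ψ (D.low s) w = e := by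
      by_cases hne : W.Nonempty
      · obtain ⟨w, hw⟩ := hne
        exact ⟨ψ w, h1 w, sameColor G ψ (D.low s) w, (sameColor_mono ψ (subset_univ _) w).trans
          (h3 w (hWlow w hw)), fun w' hw' => by rw [hW w' hw' w hw],
          fun w' hw' => by rw [hW w' hw' w hw]⟩
      · rw [not_nonempty_iff_eq_empty] at hne
        exact ⟨0, hχ, 0, Nat.zero_le _, by simp [hne], by simp [hne]⟩
    have hsum : ∀ u ∈ D.bag (D.parent s), sameColor G ψ (D.low s) u + newHits G W c k u = d u :=
      fun u hu => by rw [← h4 u hu, sameColor_lowParent hs hk' (h2 u hu)]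
    refine ⟨k, hk, e, he, fun u hu hus => ?_, fun u hu _ => ?_, fun w hw => ?_, ψ, h1, ?_, ?_, ?_⟩
    · rw [← h4 u hu, hW0 ψ u hu hus]
    · rw [← hsum u hu]; omega
    · rw [← he' w hw, ← sameColor_forgotten hW hw (hk' w hw) fun u hu => h2 u (mem_inter.1 hu).2]
      exact h3 w (hWlow w hw)
    · intro u hu
      by_cases hut : u ∈ D.bag (D.parent s)
      · simp only [if_pos hut]; exact h2 u hut
      · simp only [if_neg hut]; exact hk' u (mem_sdiff.2 ⟨hu, hut⟩)
    · intro v hv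
      refine h3 v ?_
      rw [NiceTreeDecomposition.lowParent_eq hs]; exact mem_union_left _ hv
    · intro u hu
      by_cases hut : u ∈ D.bag (D.parent s)
      · simp only [if_pos hut]; have := hsum u hut; omega
      · simp only [if_neg hut]; exact he' u (mem_sdiff.2 ⟨hu, hut⟩)
  · rintro ⟨k, hk, e, he, h0, h5, h6, ψ, h1, h2, h3, h4⟩
    simp only at h2 h4
    -- Only vertices new in the parent's bag can be recolored inside that bag, and they lie outside
    -- the subtree of `s`; on the subtree `φ` and `ψ` agree.
    set φ : Fin n → ℕ := fun v => if v ∈ D.bag (D.parent s) then c v else ψ v with hφ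
    have e1 : ∀ v ∈ D.bag (D.parent s), φ v = c v := fun v hv => if_pos hv
    have e2 : ∀ v ∈ D.sub s, φ v = ψ v := by
      intro v hv
      by_cases hvt : v ∈ D.bag (D.parent s)
      · rw [e1 v hvt, h2 v (NiceTreeDecomposition.mem_bag_of_mem_sub hs hv hvt), if_pos hvt]
      · exact if_neg hvt
    have e3 : ∀ w ∈ W, ψ w = k := fun w hw => by
      rw [h2 w (mem_sdiff.1 hw).1, if_neg (mem_sdiff.1 hw).2]
    refine ⟨φ, fun v => ?_, e1, fun v hv => ?_, fun v hv => ?_⟩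
    · simp only [hφ]
      split_ifs with h
      · exact hc v h
      · exact h1 v
    · have hv' := mem_sdiff.1 hv
      rw [sameColor_congr (e2 v hv'.1) fun u _ hu => e2 u
        (NiceTreeDecomposition.mem_sub_of_adj hv'.1 (Or.inr hv'.2) hu)]
      rw [NiceTreeDecomposition.lowParent_eq hs, mem_union] at hv
      rcases hv with hv | hv
      · exact h3 v hv
      · rw [sameColor_forgotten hW hv (e3 v hv) fun u hu => by
          rw [h2 u (mem_inter.1 hu).1, if_pos (mem_inter.1 hu).2],
          h4 v (mem_sdiff.1 hv).1, if_neg (mem_sdiff.1 hv).2]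
        exact h6 v hv
    · by_cases hvs : v ∈ D.bag s
      · have hψ : ψ v = c v := by rw [h2 v hvs, if_pos hv]
        rw [sameColor_congr (ψ' := ψ) (S := D.lowParent s) (by rw [e1 v hv, hψ]) fun u hu _ =>
          e2 u (mem_sdiff.1 hu).1, sameColor_lowParent hs e3 hψ, h4 v hvs, if_pos hv,
          Nat.sub_add_cancel (h5 v hv hvs)]
      · rw [hW0 φ v hv hvs, h0 v hv hvs]

/-- The root bag need not be empty, so the neighbors inside it, which the table does not count, are
added at the end. -/
theorem exists_coloring_iff_root : (∃ ψ : Fin n → ℕ, (∀ v, ψ v < χ) ∧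
      ∀ v, sameColor G ψ univ v ≤ Δ) ↔
    ∃ c d : Fin n → ℕ, (∀ v ∈ D.bag D.root, c v < χ) ∧ (∀ v ∈ D.bag D.root, d v ≤ Δ) ∧
      PartialColoring G χ Δ (D.bag D.root) (D.low D.root) c d ∧
      ∀ v ∈ D.bag D.root, d v + oldHits G (D.bag D.root) c (c v) v ≤ Δ := by
  classical
  have huniv : univ = D.low D.root ∪ D.bag D.root := by
    rw [NiceTreeDecomposition.low, NiceTreeDecomposition.sub_root, sdiff_union_of_subset
      (subset_univ _)]
  have hdisj : Disjoint (D.low D.root) (D.bag D.root) := sdiff_disjoint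
  have hold : ∀ {ψ c : Fin n → ℕ} {v : Fin n}, (∀ u ∈ D.bag D.root, ψ u = c u) →
      v ∈ D.bag D.root → sameColor G ψ (D.bag D.root) v = oldHits G (D.bag D.root) c (c v) v := by
    intro ψ c v h hv
    rw [sameColor, oldHits]
    congr 1
    exact filter_congr fun u hu => by rw [h u hu, h v hv, G.adj_comm]
  have hsum : ∀ (ψ : Fin n → ℕ) (v : Fin n), sameColor G ψ univ v =
      sameColor G ψ (D.low D.root) v + sameColor G ψ (D.bag D.root) v := fun ψ v => by
    rw [huniv, sameColor_union hdisj]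
  constructor
  · rintro ⟨ψ, h1, h2⟩
    refine ⟨ψ, sameColor G ψ (D.low D.root), fun v _ => h1 v, fun v _ =>
      (sameColor_mono ψ (subset_univ _) v).trans (h2 v),
      ⟨ψ, h1, fun _ _ => rfl, fun v _ => h2 v, fun _ _ => rfl⟩, fun v hv => ?_⟩
    rw [← hold (ψ := ψ) (fun _ _ => rfl) hv, ← hsum]
    exact h2 v
  · rintro ⟨c, d, -, -, ⟨ψ, h1, h2, h3, h4⟩, h5⟩
    refine ⟨ψ, h1, fun v => ?_⟩
    by_cases hv : v ∈ D.bag D.root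
    · rw [hsum, h4 v hv, hold h2 hv]
      exact h5 v hv
    · refine h3 v ?_
      have := mem_univ v
      rw [huniv, mem_union] at this
      tauto

theorem defectiveColorable_iff : DefectiveColorable G χ Δ ↔
    ∃ ψ : Fin n → ℕ, (∀ v, ψ v < χ) ∧ ∀ v, sameColor G ψ univ v ≤ Δ := by
  classical
  have key : ∀ (c : Fin n → Fin χ) (v : Fin n),
      (G.induce (c ⁻¹' {c v})).degree ⟨v, rfl⟩ = sameColor G (fun u => (c u : ℕ)) univ v := by
    intro c v
    rw [← SimpleGraph.card_neighborFinset_eq_degree, sameColor,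
      ← card_map (Function.Embedding.subtype _)]
    congr 1
    ext u
    simp only [mem_map, SimpleGraph.mem_neighborFinset, mem_filter, mem_univ, true_and]
    constructor
    · rintro ⟨⟨w, hw⟩, h1, rfl⟩
      exact ⟨h1, congrArg Fin.val hw⟩
    · rintro ⟨h1, h2⟩
      exact ⟨⟨u, Fin.ext h2⟩, h1, rfl⟩
  constructor
  · rintro ⟨c, hc⟩
    refine ⟨fun u => c u, fun v => (c v).2, fun v => ?_⟩
    rw [← key]
    refine le_trans ?_ (hc (c v))
    convert (G.induce (c ⁻¹' {c v})).degree_le_maxDegree ⟨v, rfl⟩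
  · rintro ⟨ψ, h1, h2⟩
    refine ⟨fun v => ⟨ψ v, h1 v⟩, fun i => ?_⟩
    refine SimpleGraph.maxDegree_le_of_forall_degree_le _ _ fun ⟨v, hv⟩ => ?_
    have hv' : (⟨ψ v, h1 v⟩ : Fin χ) = i := hv
    subst hv'
    have := key (fun v => ⟨ψ v, h1 v⟩) v
    refine le_trans (le_of_eq ?_) (h2 v)
    rw [← this]

end

/-! ### The numeric instance and the encoding of bag states -/

namespace DPData

variable {I : DPData}

/-- The entry of the table of `t` in which vertex `u` has state `e u`. -/
def enc (I : DPData) (t : ℕ) (e : ℕ → ℕ) : ℕ := ∑ u ∈ range I.n,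
  if I.bag t u ≠ 0 then e u * I.Q ^ I.rank t u else 0

theorem enc_eq (t : ℕ) (e : ℕ → ℕ) : I.enc t e = ∑ u ∈ range I.n,
    if I.bag t u ≠ 0 then e u * I.Q ^ (∑ w ∈ range u, I.bag t w) else 0 :=
  sum_congr rfl fun u hu => by rw [rank_eq (mem_range.1 hu).le]

theorem enc_lt {t : ℕ} {e : ℕ → ℕ} (he : ∀ u < I.n, I.bag t u ≠ 0 → e u < I.Q) :
    I.enc t e < I.Q ^ I.card t := by
  rw [enc_eq]; exact sum_digits_lt I.n he

theorem vdig_enc {t : ℕ} {e : ℕ → ℕ} (hb : ∀ u, I.bag t u ≤ 1)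
    (he : ∀ u < I.n, I.bag t u ≠ 0 → e u < I.Q) {v : ℕ} (hv : v < I.n) (hv' : I.bag t v ≠ 0) :
    I.vdig t (I.enc t e) v = e v := by
  rw [vdig, dig, rank_eq hv.le, enc_eq]
  exact digit_sum hb he hv hv'

/-- Partial sums of a 0/1 sequence grow by steps of at most one and so take every value below the
total. -/
theorem exists_rank_eq {t i : ℕ} (hb : ∀ u, I.bag t u ≤ 1) (hi : i < I.card t) :
    ∃ v < I.n, I.bag t v ≠ 0 ∧ I.rank t v = i := by
  have key : ∀ k, i < ∑ u ∈ range k, I.bag t u →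
      ∃ v < k, I.bag t v ≠ 0 ∧ ∑ u ∈ range v, I.bag t u = i := by
    intro k
    induction k with
    | zero => simp
    | succ k ih =>
      intro h
      rw [sum_range_succ] at h
      have h1 := hb k
      by_cases h2 : i < ∑ u ∈ range k, I.bag t u
      · obtain ⟨v, hv, h3⟩ := ih h2
        exact ⟨v, by omega, h3⟩
      · exact ⟨k, by omega, by omega, by omega⟩
  obtain ⟨v, hv, h1, h2⟩ := key I.n hi
  exact ⟨v, hv, h1, by rw [rank_eq hv.le, h2]⟩

theorem dig_eq_zero {i z k : ℕ} (hQ : 0 < I.Q) (hz : z < I.Q ^ k) (hi : k ≤ i) :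
    I.dig i z = 0 := by
  rw [dig, Nat.div_eq_of_lt (hz.trans_le (Nat.pow_le_pow_right hQ hi)), Nat.zero_mod]

/-- The sums over colors and degrees run over `range n`, which contains all candidates because `χ ≤
n` and `Δ < n`. -/
theorem conv_ne_zero_iff {f : ℕ → ℕ} {s t z : ℕ} (hχ : I.χ ≤ I.n) (hΔ : I.Δ < I.n) :
    I.conv f s t z ≠ 0 ↔ ∃ c < I.χ, ∃ d ≤ I.Δ, I.badKept s t z c = 0 ∧
      I.badForgotten s t z c d = 0 ∧ f (I.src s t z c d) ≠ 0 := by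
  have hwt := (wt_pos (I := I) z).ne'
  rw [conv]
  constructor
  · intro h
    split_ifs at h with h0
    · obtain ⟨c, -, h0⟩ := exists_ne_zero_of_sum_ne_zero h0
      obtain ⟨d, -, h0⟩ := exists_ne_zero_of_sum_ne_zero h0
      split_ifs at h0 with h1 h2 h3
      all_goals first | exact absurd rfl h0 | skip
      exact ⟨c, h1, d, Nat.lt_succ_iff.1 h2, by omega, by omega, h0⟩
    · exact absurd rfl h
  · rintro ⟨c, hc, d, hd, h1, h2, h3⟩
    rw [if_pos]
    · exact hwt
    intro h0
    have h4 := sum_eq_zero_iff.1 (sum_eq_zero_iff.1 h0 c (mem_range.2 (by omega))) d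
      (mem_range.2 (by omega))
    rw [if_pos hc, if_pos (show d < I.D from Nat.lt_succ_iff.2 hd), if_neg (by omega)] at h4
    exact h3 h4

open Classical in
/-- The data of an instance of the coloring problem. -/
noncomputable def ofInstance {n m : ℕ} (G : SimpleGraph (Fin n)) (D : NiceTreeDecomposition G m)
    (χ Δ : ℕ) : DPData where
  n := n
  m := m
  χ := χ
  Δ := Δ
  root := D.root
  adj u v := if ∃ (hu : u < n) (hv : v < n), G.Adj ⟨u, hu⟩ ⟨v, hv⟩ then 1 else 0
  bag t v := if ∃ (ht : t < m) (hv : v < n), (⟨v, hv⟩ : Fin n) ∈ D.bag ⟨t, ht⟩ then 1 else 0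
  par t := if ht : t < m then D.parent ⟨t, ht⟩ else 0

variable {n m : ℕ} {G : SimpleGraph (Fin n)} {D : NiceTreeDecomposition G m} {χ Δ : ℕ}

local notation "Inst" => ofInstance G D χ Δ

theorem adj_ne_zero {u v : Fin n} : (Inst).adj u v ≠ 0 ↔ G.Adj u v := by
  simp [ofInstance]

theorem bag_ne_zero {t : Fin m} {v : Fin n} : (Inst).bag t v ≠ 0 ↔ v ∈ D.bag t := by
  simp [ofInstance]

theorem bag_le_one (t v : ℕ) : (Inst).bag t v ≤ 1 := by
  simp only [ofInstance]
  split_ifs <;> omega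

theorem par_eq (t : Fin m) : (Inst).par t = D.parent t := by
  simp [ofInstance]

theorem sum_childSet {M : Type*} [AddCommMonoid M] (t : Fin m) (F : ℕ → M) :
    ∑ s ∈ (Inst).childSet t, F s = ∑ s ∈ D.children t, F s := by
  rw [show (Inst).childSet t = (D.children t).map Fin.valEmbedding by
    ext s
    simp only [childSet, mem_filter, mem_range, mem_map, Fin.valEmbedding_apply,
      ParentTree.mem_children]
    constructor
    · rintro ⟨h1, h2, h3⟩
      refine ⟨⟨s, h1⟩, ⟨fun h => h2 (congrArg Fin.val h), Fin.ext ?_⟩, rfl⟩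
      rw [← par_eq (χ := χ) (Δ := Δ), h3]
    · rintro ⟨s, ⟨h1, h2⟩, rfl⟩
      exact ⟨s.2, fun h => h1 (Fin.ext h), by rw [par_eq, h2]⟩, sum_map]
  rfl

theorem mem_childSet {t s : Fin m} : (s : ℕ) ∈ (Inst).childSet t ↔ s ∈ D.children t := by
  simp only [childSet, mem_filter, mem_range, ParentTree.mem_children, par_eq]
  constructor
  · rintro ⟨-, h1, h2⟩
    exact ⟨fun h => h1 (congrArg Fin.val h), Fin.ext h2⟩
  · rintro ⟨h1, h2⟩
    exact ⟨s.2, fun h => h1 (Fin.ext h), by rw [h2]⟩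

theorem hit_eq (s t : Fin m) (z c : ℕ) (u : Fin n) : (Inst).hit s t z c u =
    newHits G (D.bag s \ D.bag t) (fun u => (Inst).col ((Inst).vdig t z u)) c u := by
  classical
  have h1 : (Inst).hit s t z c u = ∑ v : Fin n, if v ∈ D.bag s \ D.bag t ∧
      (G.Adj u v ∧ (Inst).col ((Inst).vdig t z u) = c) then 1 else 0 := by
    rw [hit, show (Inst).n = n from rfl]
    refine (sum_range _).trans (sum_congr rfl fun v _ => ?_)
    simp only [bag_ne_zero, adj_ne_zero, mem_sdiff]
    by_cases g1 : v ∈ D.bag s <;> by_cases g2 : v ∈ D.bag t <;> by_cases g3 : G.Adj u v <;>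
      simp [g1, g2, g3]
  rw [h1, newHits, card_filter, ← sum_filter, ← sum_filter, ← filter_filter,
    filter_mem_eq_inter, univ_inter, sum_filter]

theorem sum_range_eq_zero_iff {n : ℕ} {F : ℕ → ℕ} :
    ∑ u ∈ range n, F u = 0 ↔ ∀ u : Fin n, F u = 0 := by
  rw [sum_eq_zero_iff]
  exact ⟨fun h u => h u (mem_range.2 u.2), fun h u hu => h ⟨u, mem_range.1 hu⟩⟩

theorem badKept_eq_zero_iff (s t : Fin m) (z c : ℕ) : (Inst).badKept s t z c = 0 ↔
    (∀ u ∈ D.bag t, u ∉ D.bag s → (Inst).dg ((Inst).vdig t z u) = 0) ∧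
    ∀ u ∈ D.bag t, u ∈ D.bag s → newHits G (D.bag s \ D.bag t)
      (fun u => (Inst).col ((Inst).vdig t z u)) c u ≤ (Inst).dg ((Inst).vdig t z u) := by
  rw [badKept, show (Inst).n = n from rfl]
  refine sum_range_eq_zero_iff.trans ?_
  simp only [bag_ne_zero, hit_eq]
  rw [← forall_and]
  refine forall_congr' fun u => ?_
  by_cases g1 : u ∈ D.bag t <;> by_cases g2 : u ∈ D.bag s <;> simp [g1, g2, Nat.sub_eq_zero_iff_le]

theorem badForgotten_eq_zero_iff (s t : Fin m) (z c d : ℕ) :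
    (Inst).badForgotten s t z c d = 0 ↔ ∀ w ∈ D.bag s \ D.bag t,
      d + oldHits G (D.bag s ∩ D.bag t) (fun u => (Inst).col ((Inst).vdig t z u)) c w ≤ Δ := by
  classical
  have h1 : ∀ v : Fin n, (∑ u ∈ range n, if (Inst).bag s u ≠ 0 then if (Inst).bag t u ≠ 0 then
      if (Inst).adj u v ≠ 0 then if (Inst).col ((Inst).vdig t z u) = c then 1 else 0 else 0 else 0
        else 0) =
      oldHits G (D.bag s ∩ D.bag t) (fun u => (Inst).col ((Inst).vdig t z u)) c v := by
    intro v
    have h2 : (∑ u ∈ range n, if (Inst).bag s u ≠ 0 then if (Inst).bag t u ≠ 0 then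
        if (Inst).adj u v ≠ 0 then if (Inst).col ((Inst).vdig t z u) = c then 1 else 0 else 0 else 0
          else 0) = ∑ u : Fin n, if u ∈ D.bag s ∩ D.bag t ∧
        (G.Adj u v ∧ (Inst).col ((Inst).vdig t z u) = c) then 1 else 0 := by
      refine (sum_range _).trans (sum_congr rfl fun u _ => ?_)
      simp only [bag_ne_zero, adj_ne_zero, mem_inter]
      by_cases g1 : u ∈ D.bag s <;> by_cases g2 : u ∈ D.bag t <;> by_cases g3 : G.Adj u v <;>
        simp [g1, g2, g3]
    rw [h2, oldHits, card_filter, ← sum_filter, ← sum_filter, ← filter_filter,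
      filter_mem_eq_inter, univ_inter, sum_filter]
  rw [badForgotten, show (Inst).n = n from rfl]
  refine sum_range_eq_zero_iff.trans ?_
  refine forall_congr' fun v => ?_
  rw [show (Inst).Δ = Δ from rfl, h1 v]
  simp only [bag_ne_zero, mem_sdiff]
  by_cases g1 : v ∈ D.bag t <;> by_cases g2 : v ∈ D.bag s <;> simp [g1, g2, Nat.sub_eq_zero_iff_le]

theorem badRoot_eq_zero_iff (z : ℕ) : (Inst).badRoot z = 0 ↔ ∀ v ∈ D.bag D.root,
    (Inst).dg ((Inst).vdig D.root z v) + oldHits G (D.bag D.root)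
      (fun u => (Inst).col ((Inst).vdig D.root z u)) ((Inst).col ((Inst).vdig D.root z v)) v
        ≤ Δ := by
  classical
  have h1 : ∀ (v : Fin n) (c : ℕ), (∑ u ∈ range n, if (Inst).bag D.root u ≠ 0 then
      if (Inst).adj u v ≠ 0 then if (Inst).col ((Inst).vdig D.root z u) = c then 1 else 0 else 0
        else 0) =
      oldHits G (D.bag D.root) (fun u => (Inst).col ((Inst).vdig D.root z u)) c v := by
    intro v c
    have h2 : (∑ u ∈ range n, if (Inst).bag D.root u ≠ 0 then
      if (Inst).adj u v ≠ 0 then if (Inst).col ((Inst).vdig D.root z u) = c then 1 else 0 else 0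
        else 0) = ∑ u : Fin n, if u ∈ D.bag D.root ∧
        (G.Adj u v ∧ (Inst).col ((Inst).vdig D.root z u) = c) then 1 else 0 := by
      refine (sum_range _).trans (sum_congr rfl fun u _ => ?_)
      simp only [bag_ne_zero, adj_ne_zero]
      by_cases g1 : u ∈ D.bag D.root <;> by_cases g3 : G.Adj u v <;> simp [g1, g3]
    rw [h2, oldHits, card_filter, ← sum_filter, ← sum_filter, ← filter_filter,
      filter_mem_eq_inter, univ_inter, sum_filter]
  rw [badRoot, show (Inst).n = n from rfl]
  refine sum_range_eq_zero_iff.trans ?_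
  refine forall_congr' fun v => ?_
  rw [show (Inst).Δ = Δ from rfl,
    show (Inst).root = (D.root : ℕ) from rfl, h1 v]
  simp only [bag_ne_zero]
  by_cases g2 : v ∈ D.bag D.root <;> simp [g2, Nat.sub_eq_zero_iff_le]

end DPData

theorem PartialColoring.congr {n χ Δ : ℕ} {G : SimpleGraph (Fin n)} {X F : Finset (Fin n)}
    {c d c' d' : Fin n → ℕ} (h : PartialColoring G χ Δ X F c d) (hc : ∀ v ∈ X, c v = c' v)
    (hd : ∀ v ∈ X, d v = d' v) : PartialColoring G χ Δ X F c' d' := by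
  obtain ⟨ψ, h1, h2, h3, h4⟩ := h
  exact ⟨ψ, h1, fun v hv => (h2 v hv).trans (hc v hv), h3, fun v hv => (h4 v hv).trans (hd v hv)⟩

/-- Only a forget node lacks a vertex of its child's bag, and it lacks just one. Niceness enters the
argument only here. -/
theorem NiceTreeDecomposition.eq_of_mem_sdiff {n m : ℕ} {G : SimpleGraph (Fin n)}
    (D : NiceTreeDecomposition G m) {s : Fin m} (hs : s ≠ D.root) :
    ∀ w ∈ D.bag s \ D.bag (D.parent s), ∀ w' ∈ D.bag s \ D.bag (D.parent s), w = w' := by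
  have hmem : s ∈ D.children (D.parent s) := ParentTree.mem_children.2 ⟨hs, rfl⟩
  intro w hw w' hw'
  rw [mem_sdiff] at hw hw'
  rcases D.nice (D.parent s) with ⟨h, -⟩ | ⟨s', v, h, -, h'⟩ | ⟨s', v, h, -, h'⟩ |
    ⟨s₁, s₂, -, h, h', h''⟩
  · rw [h] at hmem; simp at hmem
  · rw [h, mem_singleton] at hmem
    subst hmem
    exact absurd (h' ▸ mem_insert_of_mem hw.1) hw.2
  · rw [h, mem_singleton] at hmem
    subst hmem
    have g1 := hw.2
    have g2 := hw'.2
    rw [h', mem_erase] at g1 g2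
    have e1 : w = v := by tauto
    have e2 : w' = v := by tauto
    rw [e1, e2]
  · rw [h, mem_insert, mem_singleton] at hmem
    rcases hmem with rfl | rfl
    · exact absurd (h' ▸ hw.1) hw.2
    · exact absurd (h'' ▸ hw.1) hw.2

/-! ### Correctness of the tables -/

namespace DPData

/-- The entry `z` of the table of `t` describes a partial coloring. -/
def Valid {n m : ℕ} (G : SimpleGraph (Fin n)) (D : NiceTreeDecomposition G m) (χ Δ : ℕ)
    (t : Fin m) (z : ℕ) : Prop :=
  PartialColoring G χ Δ (D.bag t) (D.low t)
    (fun v => (ofInstance G D χ Δ).col ((ofInstance G D χ Δ).vdig t z v))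
    (fun v => (ofInstance G D χ Δ).dg ((ofInstance G D χ Δ).vdig t z v))

variable {n m : ℕ} {G : SimpleGraph (Fin n)} {D : NiceTreeDecomposition G m} {χ Δ : ℕ}

local notation "Inst" => ofInstance G D χ Δ

/-- The conditions match those of `partialColoring_lowParent_iff` one by one. Vanishing of `badKept`
makes the subtractions in `src` exact: they lower the degree part of a state without touching its
color. -/
theorem conv_correct (hχ : 0 < χ) (hχn : χ ≤ n) (hΔ : Δ < n) {s t : Fin m} (hs : s ∈ D.children t)
    {f : ℕ → ℕ} (hf : ∀ y < (Inst).Q ^ (Inst).card s, f y ≠ 0 ↔ Valid G D χ Δ s y) (z : ℕ) :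
    (Inst).conv f s t z ≠ 0 ↔ PartialColoring G χ Δ (D.bag t) (D.lowParent s)
      (fun v => (Inst).col ((Inst).vdig t z v)) (fun v => (Inst).dg ((Inst).vdig t z v)) := by
  classical
  obtain ⟨hsr, rfl⟩ := ParentTree.mem_children.1 hs
  have hQ : 0 < (Inst).Q := Q_pos hχ
  have hlt : ∀ v ∈ D.bag (D.parent s), (Inst).col ((Inst).vdig (D.parent s) z v) < χ :=
    fun v _ => col_lt (I := Inst) (dig_lt hQ _ _)
  rw [conv_ne_zero_iff (I := Inst) hχn hΔ,
    partialColoring_lowParent_iff hχ hsr (D.eq_of_mem_sdiff hsr) hlt]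
  refine exists_congr fun c => and_congr_right fun hc => exists_congr fun d =>
    and_congr_right fun hd => ?_
  rw [badKept_eq_zero_iff, badForgotten_eq_zero_iff, and_assoc]
  refine and_congr_right fun g1 => and_congr_right fun g2 => and_congr_right fun g3 => ?_
  have hd' : d < (Inst).D := Nat.lt_succ_iff.2 hd
  rw [hf _ (src_lt hc hd'), Valid]
  have hv : ∀ u ∈ D.bag s, (Inst).vdig s ((Inst).src s (D.parent s) z c d) u =
      if u ∈ D.bag (D.parent s) then (Inst).vdig (D.parent s) z u -
        newHits G (D.bag s \ D.bag (D.parent s))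
          (fun u => (Inst).col ((Inst).vdig (D.parent s) z u)) c u else c * (Inst).D + d := by
    intro u hu
    have h1 := vdig_enc (I := Inst) (t := s) (e := fun u => if (Inst).bag (D.parent s) u ≠ 0 then
      (Inst).vdig (D.parent s) z u - (Inst).hit s (D.parent s) z c u else c * (Inst).D + d)
      (bag_le_one _) (fun u _ _ => by
        split_ifs
        · exact (Nat.sub_le _ _).trans_lt (dig_lt hQ _ _)
        · exact add_lt_Q hc hd') u.2 (bag_ne_zero.2 hu)
    refine Eq.trans h1 ?_
    simp only [bag_ne_zero, hit_eq]
  have hcol : ∀ u ∈ D.bag s, (Inst).col ((Inst).vdig s ((Inst).src s (D.parent s) z c d) u) =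
      if u ∈ D.bag (D.parent s) then (Inst).col ((Inst).vdig (D.parent s) z u) else c := by
    intro u hu
    rw [hv u hu]
    split_ifs with h
    · exact (col_dg_sub (g2 u h hu)).1
    · exact col_mul_add hd'
  have hdg : ∀ u ∈ D.bag s, (Inst).dg ((Inst).vdig s ((Inst).src s (D.parent s) z c d) u) =
      if u ∈ D.bag (D.parent s) then (Inst).dg ((Inst).vdig (D.parent s) z u) -
        newHits G (D.bag s \ D.bag (D.parent s))
          (fun u => (Inst).col ((Inst).vdig (D.parent s) z u)) c u else d := by
    intro u hu
    rw [hv u hu]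
    split_ifs with h
    · exact (col_dg_sub (g2 u h hu)).2
    · exact dg_mul_add hd'
  exact ⟨fun h => h.congr hcol hdg, fun h => h.congr (fun v hv => (hcol v hv).symm)
    fun v hv => (hdg v hv).symm⟩

theorem card_le_n (t : ℕ) : (Inst).card t ≤ n := by
  calc (Inst).card t ≤ ∑ u ∈ range (Inst).n, 1 := sum_le_sum fun u _ => bag_le_one t u
    _ = n := by simp [ofInstance]

theorem rank_lt_n {t : ℕ} {v : ℕ} (hv : v < n) : (Inst).rank t v < n := by
  rw [rank_eq (I := Inst) (show v ≤ (Inst).n from hv.le)]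
  calc ∑ u ∈ range v, (Inst).bag t u ≤ ∑ u ∈ range v, 1 := sum_le_sum fun u _ => bag_le_one t u
    _ < n := by simpa using hv

-- Induction on the round: a child is one level deeper, so its table is already right one round
-- earlier.
open Classical in
theorem table_correct (hχ : 0 < χ) (hχn : χ ≤ n) (hΔ : Δ < n) (R : ℕ) (t : Fin m)
    (ht : m ≤ D.depth t + R) {z : ℕ} (hz : z < (Inst).Q ^ (Inst).card t) :
    (Inst).table R t z = if Valid G D χ Δ t z then 1 else 0 := by
  induction R generalizing t z with
  -- Depths are less than `m`, so nothing is claimed in round 0.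
  | zero => exact absurd (ParentTree.depth_lt (T := D.toParentTree) t) (by omega)
  | succ R ih =>
    have hQ : 0 < (Inst).Q := Q_pos hχ
    have hm : 0 < m := t.pos
    have hzn : z < (Inst).Q ^ (Inst).n := hz.trans_le (Nat.pow_le_pow_right hQ (card_le_n _))
    rw [table_succ (I := Inst) hQ hm hΔ R t hzn]
    have hconv : ∀ s ∈ D.children t, ∀ a, (Inst).conv ((Inst).table R s) s t a ≠ 0 ↔
        PartialColoring G χ Δ (D.bag t) (D.lowParent s)
          (fun v => (Inst).col ((Inst).vdig t a v)) (fun v => (Inst).dg ((Inst).vdig t a v)) := by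
      intro s hs a
      refine conv_correct hχ hχn hΔ hs (fun y hy => ?_) a
      have hd := ParentTree.depth_parent (ParentTree.mem_children.1 hs).1
      rw [(ParentTree.mem_children.1 hs).2] at hd
      rw [ih s (by omega) hy]
      split_ifs with h <;> simp [h]
    congr 1
    have hcol : ∀ v ∈ D.bag t, (Inst).col ((Inst).vdig t z v) < χ :=
      fun v _ => col_lt (I := Inst) (dig_lt hQ _ _)
    have hrk : ∀ v : Fin n, (Inst).rank t v < (Inst).n := fun v => rank_lt_n v.2
    rw [Valid, partialColoring_low_iff hχ hcol, eq_iff_iff]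
    constructor
    · rintro ⟨a, h1, h2⟩
      refine ⟨fun s v => (Inst).dg ((Inst).vdig t (a s) v), fun s hs => ?_, fun v _ => ?_⟩
      · obtain ⟨-, h4, h5⟩ := h1 s (mem_childSet.2 hs)
        exact ((hconv s hs _).1 h4).congr (fun v _ => h5 _ (hrk v)) fun v _ => rfl
      · have := h2 _ (hrk v)
        rw [sum_childSet] at this
        exact this
    · rintro ⟨δ, h1, h2⟩
      -- The entry used for the child `s` has the colors of `z` and the degrees `δ s`, which are at
      -- most those of `z` because they are summands of them.
      set e : ℕ → ℕ → ℕ := fun s u => if h : s < m ∧ u < n then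
        (Inst).col ((Inst).vdig t z u) * (Inst).D + δ ⟨s, h.1⟩ ⟨u, h.2⟩ else 0 with he
      have heq : ∀ (s : Fin m) (u : Fin n), e s u =
          (Inst).col ((Inst).vdig t z u) * (Inst).D + δ s u := fun s u => by simp [he]
      have hδ : ∀ s ∈ D.children t, ∀ u ∈ D.bag t, δ s u < (Inst).D := fun s hs u hu =>
        (single_le_sum (f := fun s => δ s u) (fun _ _ => Nat.zero_le _) hs).trans_lt
          (by rw [h2 u hu]; exact dg_lt_D _)
      have helt : ∀ s ∈ D.children t, ∀ u < (Inst).n, (Inst).bag t u ≠ 0 → e s u < (Inst).Q := by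
        intro s hs u hu hbu
        rw [heq s ⟨u, hu⟩]
        exact add_lt_Q (col_lt (dig_lt hQ _ _))
          (hδ s hs _ (bag_ne_zero (v := ⟨u, hu⟩) |>.1 hbu))
      have hvd : ∀ s ∈ D.children t, ∀ u ∈ D.bag t, (Inst).vdig t ((Inst).enc t (e s)) u =
          (Inst).col ((Inst).vdig t z u) * (Inst).D + δ s u := fun s hs u hu => by
        rw [vdig_enc (I := Inst) (bag_le_one _) (helt s hs) u.2 (bag_ne_zero.2 hu), heq]
      have hlt : ∀ s ∈ D.children t, (Inst).enc t (e s) < (Inst).Q ^ (Inst).card t :=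
        fun s hs => enc_lt (helt s hs)
      -- A digit position either belongs to a vertex of the bag or lies beyond the bag; in the
      -- latter case it is zero in all entries concerned.
      have hcases : ∀ i, (Inst).card t ≤ i ∨ ∃ v ∈ D.bag t, (Inst).rank t v = i := by
        intro i
        rcases le_or_gt ((Inst).card t) i with h | h
        · exact Or.inl h
        · obtain ⟨v, hv, h3, h4⟩ := exists_rank_eq (I := Inst) (bag_le_one t) h
          exact Or.inr ⟨⟨v, hv⟩, bag_ne_zero (v := ⟨v, hv⟩) |>.1 h3, h4⟩
      refine ⟨fun s => (Inst).enc t (e s), fun s hs => ?_, fun i hi => ?_⟩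
      · obtain ⟨s, rfl⟩ : ∃ s' : Fin m, (s' : ℕ) = s :=
          ⟨⟨s, mem_range.1 (mem_filter.1 hs).1⟩, rfl⟩
        have hs := mem_childSet.1 hs
        refine ⟨(hlt s hs).trans_le (Nat.pow_le_pow_right hQ (card_le_n _)),
          (hconv s hs _).2 ((h1 s hs).congr (fun v hv => ?_) fun v hv => ?_), fun i hi => ?_⟩
        · rw [hvd s hs v hv, col_mul_add (hδ s hs v hv)]
        · rw [hvd s hs v hv, dg_mul_add (hδ s hs v hv)]
        · rcases hcases i with h | ⟨v, hv, rfl⟩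
          · rw [dig_eq_zero hQ (hlt s hs) h, dig_eq_zero hQ hz h]
          · have := hvd s hs v hv
            rw [vdig] at this
            rw [this, col_mul_add (hδ s hs v hv), vdig]
      · rw [sum_childSet]
        rcases hcases i with h | ⟨v, hv, rfl⟩
        · rw [dig_eq_zero hQ hz h]
          refine (sum_eq_zero fun s hs => ?_).trans (Nat.zero_mod _).symm
          rw [dig_eq_zero hQ (hlt s hs) h]
          exact Nat.zero_mod _
        · refine Eq.trans (sum_congr rfl fun s hs => ?_) (h2 v hv)
          have := hvd s hs v hv
          rw [vdig] at this
          rw [this, dg_mul_add (hδ s hs v hv)]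

theorem defectiveColorable_iff_table (hχ : 0 < χ) (hχn : χ ≤ n) (hΔ : Δ < n) :
    DefectiveColorable G χ Δ ↔ ∃ z < (Inst).Q ^ (Inst).card D.root,
      (Inst).badRoot z = 0 ∧ (Inst).table m D.root z ≠ 0 := by
  classical
  have hQ : 0 < (Inst).Q := Q_pos hχ
  have htab : ∀ z < (Inst).Q ^ (Inst).card D.root,
      (Inst).table m D.root z ≠ 0 ↔ Valid G D χ Δ D.root z := fun z hz => by
    rw [table_correct hχ hχn hΔ m D.root (by omega) hz]
    split_ifs with h <;> simp [h]
  rw [defectiveColorable_iff, exists_coloring_iff_root (D := D)]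
  constructor
  · rintro ⟨c, d, hc, hd, hp, ho⟩
    set e : ℕ → ℕ := fun u => if h : u < n then c ⟨u, h⟩ * (Inst).D + d ⟨u, h⟩ else 0 with he
    have heq : ∀ u : Fin n, e u = c u * (Inst).D + d u := fun u => by simp [he]
    have hd' : ∀ v ∈ D.bag D.root, d v < (Inst).D := fun v hv => Nat.lt_succ_iff.2 (hd v hv)
    have helt : ∀ u < (Inst).n, (Inst).bag D.root u ≠ 0 → e u < (Inst).Q := by
      intro u hu hbu
      have hm := bag_ne_zero (v := ⟨u, hu⟩) |>.1 hbu
      rw [heq ⟨u, hu⟩]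
      exact add_lt_Q (hc _ hm) (hd' _ hm)
    have hvd : ∀ u ∈ D.bag D.root, (Inst).vdig D.root ((Inst).enc D.root e) u =
        c u * (Inst).D + d u := fun u hu => by
      rw [vdig_enc (I := Inst) (bag_le_one _) helt u.2 (bag_ne_zero.2 hu), heq]
    have hcol : ∀ u ∈ D.bag D.root,
        (Inst).col ((Inst).vdig D.root ((Inst).enc D.root e) u) = c u := fun u hu => by
      rw [hvd u hu, col_mul_add (hd' u hu)]
    have hdg : ∀ u ∈ D.bag D.root,
        (Inst).dg ((Inst).vdig D.root ((Inst).enc D.root e) u) = d u := fun u hu => by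
      rw [hvd u hu, dg_mul_add (hd' u hu)]
    refine ⟨_, enc_lt helt, (badRoot_eq_zero_iff _).2 fun v hv => ?_, (htab _ (enc_lt helt)).2
      (hp.congr (fun v hv => (hcol v hv).symm) fun v hv => (hdg v hv).symm)⟩
    rw [hdg v hv, hcol v hv]
    refine le_of_eq_of_le ?_ (ho v hv)
    congr 1
    rw [oldHits, oldHits]
    congr 1
    exact filter_congr fun u hu => by rw [hcol u hu]
  · rintro ⟨z, hz, h1, h2⟩
    exact ⟨_, _, fun v _ => col_lt (I := Inst) (dig_lt hQ _ _), fun v _ => (Inst).dg_le _,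
      (htab z hz).1 h2, (badRoot_eq_zero_iff z).1 h1⟩

end DPData

/-! ### The concrete expressions, over values and over registers -/

namespace RAM

namespace Expr

section

variable {n m δ : ℕ} {ρ : ℕ → ℕ}

/-- Together with its analogues for the other constructors, this makes `Rel` computable by `simp`:
the two instances of a parametric expression are related once its free variables are. -/
theorem rel_var_iff {v x : ℕ} : Rel n m δ ρ (.var v) (.var x) ↔ x < δ ∧ ρ x = v :=
  ⟨fun h => by cases h; exact ⟨‹_›, ‹_›⟩, fun h => .var h.1 h.2⟩

theorem rel_const (c : ℕ) : Rel n m δ ρ (.const c) (.const c) := .const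

theorem rel_op_iff {o : Op} {a b a' b' : Expr ℕ} :
    Rel n m δ ρ (.op o a b) (.op o a' b') ↔ Rel n m δ ρ a a' ∧ Rel n m δ ρ b b' :=
  ⟨fun h => by cases h; exact ⟨‹_›, ‹_›⟩, fun h => .op h.1 h.2⟩

theorem rel_load_iff {a a' : Expr ℕ} : Rel n m δ ρ (.load a) (.load a') ↔ Rel n m δ ρ a a' :=
  ⟨fun h => by cases h; assumption, .load⟩

theorem rel_ite_iff {c a b c' a' b' : Expr ℕ} : Rel n m δ ρ (.ite c a b) (.ite c' a' b') ↔
    Rel n m δ ρ c c' ∧ Rel n m δ ρ a a' ∧ Rel n m δ ρ b b' :=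
  ⟨fun h => by cases h; exact ⟨‹_›, ‹_›, ‹_›⟩, fun h => .ite h.1 h.2.1 h.2.2⟩

theorem rel_big_iff {p k : Bool} {f f' : ℕ → Expr ℕ} :
    Rel n m δ ρ (.big p k f) (.big p k f') ↔ ∀ i, i < (if k then m else n) →
      Rel n m (δ + 1) (Function.update ρ δ i) (f i) (f' δ) :=
  ⟨fun h => by cases h; assumption, .big⟩

theorem rel_trivialE : Rel n m 2 ρ trivialE trivialE := by
  simp [rel_const, rel_op_iff, rel_load_iff, rel_ite_iff, trivialE, ifLt, χE, ΔE, nE]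

theorem rel_LE : Rel n m 2 ρ LE LE := by
  simp [rel_var_iff, rel_const, rel_op_iff, rel_load_iff, rel_ite_iff, rel_big_iff, LE, powE,
    ifLt, QE, DE, cardE, bagE, χE, ΔE, nE, mE, nnE]

theorem rel_KE : Rel n m 3 ρ (KE (.var (ρ 2))) (KE (.var 2)) := by
  simp [rel_var_iff, rel_const, rel_op_iff, rel_load_iff, KE, SE, nE, mE, nnE]

theorem rel_rootCountE : Rel n m 3 ρ rootCountE rootCountE := by
  simp [rel_var_iff, rel_const, rel_op_iff, rel_load_iff, rel_ite_iff, rel_big_iff, rootCountE,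
    powE, ifLt, QE, DE, cardE, bagE, rootE, χE, ΔE, nE, mE, nnE]

theorem rel_address : Rel n m 5 ρ (.op .add baseE (.var (ρ 3))) (.op .add baseE (.var 3)) := by
  simp [rel_var_iff, rel_const, rel_op_iff, rel_load_iff, baseE, nE, mE, nnE]

set_option maxHeartbeats 2000000 in
theorem rel_rootOkE : Rel n m 6 ρ (rootOkE (.var (ρ 2)) (.var (ρ 3)))
    (rootOkE (.var 2) (.var 3)) := by
  simp [rel_var_iff, rel_const, rel_op_iff, rel_load_iff, rel_ite_iff, rel_big_iff, rootOkE,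
    badRootE, vdigE, digE, rankE, colE, dgE, modE, cellLoad, adjE, SE, baseE,
    powE, ifLt, ifEq, QE, DE, bagE, rootE, χE, ΔE, nE, mE, nnE]

set_option maxHeartbeats 2000000 in
theorem rel_cellE : Rel n m 5 ρ (cellE (.var (ρ 2)) (.var (ρ 3))) (cellE (.var 2) (.var 3)) := by
  simp [rel_var_iff, rel_const, rel_op_iff, rel_load_iff, rel_ite_iff, rel_big_iff, cellE, stageE,
    startE, convE, ifPass, wtE, BE, srcE, badForgottenE, badKeptE, hitE, parE,
    vdigE, digE, rankE, colE, dgE, modE, cellLoad, adjE, SE, baseE,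
    powE, ifLt, ifEq, QE, DE, bagE, rootE, χE, ΔE, nE, mE, nnE]

end

end Expr

end RAM

/-! ### Bit lengths of cells and addresses -/

namespace DPData

variable {I : DPData}

/-- From `m + 1 ≤ 2 ^ m` one gets `B ≤ 2 ^ (m n²)`, and the total degree is at most `n²`. -/
theorem wt_le (hΔ : I.Δ ≤ I.n) (x : ℕ) : I.wt x ≤ 2 ^ (I.m * I.n ^ 4) := by
  have h1 : I.B ≤ 2 ^ (I.m * (I.n * I.n)) := by
    rw [B, pow_mul 2]
    exact Nat.pow_le_pow_left Nat.lt_two_pow_self _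
  rw [wt_eq]
  calc I.B ^ I.dgSum x ≤ (2 ^ (I.m * (I.n * I.n))) ^ I.dgSum x := Nat.pow_le_pow_left h1 _
    _ ≤ (2 ^ (I.m * (I.n * I.n))) ^ (I.n * I.n) := Nat.pow_le_pow_right (by positivity)
        ((dgSum_le x).trans (Nat.mul_le_mul_left _ hΔ))
    _ = _ := by rw [← pow_mul]; congr 1; ring

theorem conv_le (hΔ : I.Δ ≤ I.n) (f : ℕ → ℕ) (s t x : ℕ) :
    I.conv f s t x ≤ 2 ^ (I.m * I.n ^ 4) := by
  rw [conv]
  split_ifs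
  · exact wt_le hΔ x
  · exact Nat.zero_le _

/-- Each pass at most doubles the maximum. -/
theorem fwd_le {g : ℕ → ℕ} {M : ℕ} (hg : ∀ x, g x ≤ M) (p x : ℕ) : I.fwd g p x ≤ 2 ^ p * M := by
  induction p generalizing x with
  | zero => simpa [fwd] using hg x
  | succ p ih =>
    rw [fwd, pow_succ]
    have h1 := ih x
    have h2 := ih (x - I.Q ^ (p / I.n))
    split_ifs <;> linarith [Nat.zero_le (2 ^ p * M)]

/-- Undoing passes only subtracts, so this holds for arbitrary arrays, without knowing that they are
transforms. -/
theorem inv_le (z : ℕ → ℕ) (j x : ℕ) : I.inv z j x ≤ z x := by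
  induction j with
  | zero => rw [inv]
  | succ j ih => rw [inv]; exact (Nat.sub_le _ _).trans ih

theorem table_le_one (R t x : ℕ) : I.table R t x ≤ 1 := by
  rw [table_eq, norm]
  split_ifs <;> omega

theorem fwd_conv_le (hΔ : I.Δ ≤ I.n) (f : ℕ → ℕ) (s t x : ℕ) {p : ℕ} (hp : p ≤ I.n * I.n) :
    I.fwd (I.conv f s t) p x ≤ 2 ^ (I.n * I.n + I.m * I.n ^ 4) := by
  rw [pow_add]
  exact (fwd_le (conv_le hΔ f s t) p x).trans
    (Nat.mul_le_mul_right _ (Nat.pow_le_pow_right (by norm_num) hp))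

theorem start_le (hΔ : I.Δ ≤ I.n) (R t x : ℕ) :
    I.start R t x ≤ 2 ^ ((I.n * I.n + I.m * I.n ^ 4) * I.m) := by
  cases R with
  | zero => exact Nat.zero_le _
  | succ R =>
    rw [start, joinAll, pow_mul]
    refine (prod_le_pow_card _ _ (2 ^ (I.n * I.n + I.m * I.n ^ 4)) fun s _ => ?_).trans_eq
      (by rw [card_range])
    have h1 : 1 ≤ 2 ^ (I.n * I.n + I.m * I.n ^ 4) := Nat.one_le_two_pow
    split_ifs
    · exact h1
    · exact fwd_conv_le hΔ _ _ _ _ le_rfl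
    · exact h1

theorem cellAt_le (hm : 0 < I.m) (hΔ : I.Δ ≤ I.n) (k : ℕ) :
    I.cellAt k ≤ 2 ^ ((I.n * I.n + I.m * I.n ^ 4) * I.m) := by
  have hj : k / I.L % I.S < I.S := Nat.mod_lt _ (by simp [S])
  rw [cellAt, cell]
  split_ifs with h1 h2
  · exact (inv_le _ _ _).trans (start_le hΔ _ _ _)
  · exact (table_le_one _ _ _).trans Nat.one_le_two_pow
  · refine (fwd_conv_le hΔ _ _ _ _ ?_).trans
      (Nat.pow_le_pow_right (by norm_num) (Nat.le_mul_of_pos_right _ hm))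
    have hS : I.S = 2 * (I.n * I.n) + 3 := rfl
    omega

/-- A bound on the bit lengths of the numbers handled. -/
def bits (I : DPData) : ℕ := (I.n * I.n + I.m * I.n ^ 4) * I.m + 5 * I.m + 6 * (I.n * I.n) +
  I.m * I.n + 20

theorem size_cellAt_le (hm : 0 < I.m) (hΔ : I.Δ ≤ I.n) (k : ℕ) : (I.cellAt k).size ≤ I.bits := by
  rw [Nat.size_le]
  exact (cellAt_le hm hΔ k).trans_lt (Nat.pow_lt_pow_right (by norm_num) (by rw [bits]; omega))

theorem Q_le (hχ : I.χ ≤ I.n) (hΔ : I.Δ < I.n) : I.Q ≤ I.n * I.n := Nat.mul_le_mul hχ hΔ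

theorem L_le (hχ : 0 < I.χ) {w : ℕ} (hw : ∀ t < I.m, I.card t ≤ w) : I.L ≤ I.m * I.Q ^ w := by
  rw [L]
  refine (sum_le_card_nsmul _ _ (I.Q ^ w) fun t ht =>
    Nat.pow_le_pow_right (Q_pos hχ) (hw t (mem_range.1 ht))).trans_eq (by simp)

theorem size_le_self (a : ℕ) : a.size ≤ a := Nat.size_le.2 Nat.lt_two_pow_self

theorem size_L_le (hχ : 0 < I.χ) (hχn : I.χ ≤ I.n) (hΔ : I.Δ < I.n)
    (hc : ∀ t < I.m, I.card t ≤ I.n) : I.L.size ≤ I.m + 2 * (I.n * I.n) := by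
  have h1 : I.Q ^ I.n < 2 ^ (2 * (I.n * I.n)) + 1 := by
    have h2 : I.Q ≤ 2 ^ (2 * I.n) := (Q_le hχn hΔ).trans (by
      rw [two_mul, pow_add]
      exact Nat.mul_le_mul Nat.lt_two_pow_self.le Nat.lt_two_pow_self.le)
    refine Nat.lt_succ_of_le ((Nat.pow_le_pow_left h2 _).trans_eq ?_)
    rw [← pow_mul]
    congr 1
    ring
  rw [Nat.size_le, pow_add]
  exact (L_le hχ hc).trans_lt
    (Nat.mul_lt_mul_of_lt_of_le Nat.lt_two_pow_self (Nat.lt_succ_iff.1 h1) (by positivity))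

/-- There are exponentially many cells, but their addresses have polynomially many bits. -/
theorem size_base_add_K_le (hχ : 0 < I.χ) (hχn : I.χ ≤ I.n) (hΔ : I.Δ < I.n)
    (hc : ∀ t < I.m, I.card t ≤ I.n) : (I.base + I.K).size ≤ I.bits := by
  have h1 := size_L_le hχ hχn hΔ hc
  have h2 := RAM.size_mul_le ((I.m + 1) * I.m * I.S) I.L
  have h3 := RAM.size_mul_le ((I.m + 1) * I.m) I.S
  have h4 := RAM.size_mul_le (I.m + 1) I.m
  have h5 := size_le_self (I.m + 1)
  have h6 := size_le_self I.m
  have h7 := size_le_self I.S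
  have h8 := size_le_self I.base
  have h9 := RAM.size_add_le I.base I.K
  have hS : I.S = 2 * (I.n * I.n) + 3 := rfl
  have hb : I.base = 5 + I.n * I.n + I.m + I.m * I.n := rfl
  rw [bits]
  simp only [K] at *
  omega

end DPData

theorem DPData.mul_add_lt_mul {a b x l : ℕ} (h : a < b) (hx : x < l) : a * l + x < b * l :=
  mul_add_lt (y := 0) h hx

/-- The tables are stored from `base` on, so filling them never disturbs the input. -/
theorem DPData.Encodes.congr {I : DPData} {μ μ' : ℕ → ℕ} (h : I.Encodes μ)
    (hμ : ∀ a < I.base, μ' a = μ a) : I.Encodes μ' where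
  hn := (hμ _ (by rw [base]; omega)).trans h.hn
  hm := (hμ _ (by rw [base]; omega)).trans h.hm
  hχ := (hμ _ (by rw [base]; omega)).trans h.hχ
  hΔ := (hμ _ (by rw [base]; omega)).trans h.hΔ
  hroot := (hμ _ (by rw [base]; omega)).trans h.hroot
  hadj u hu v hv := (hμ _ (by
    have := mul_add_lt_mul hu hv
    rw [base]; omega)).trans (h.hadj u hu v hv)
  hpar t ht := (hμ _ (by rw [base]; omega)).trans (h.hpar t ht)
  hbag t ht v hv := (hμ _ (by
    have := mul_add_lt_mul ht hv
    rw [base]; omega)).trans (h.hbag t ht v hv)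
  bag_le := h.bag_le
  par_lt := h.par_lt
  root_lt := h.root_lt
  Δ_lt := h.Δ_lt

namespace RAM

open RAM.Expr Polynomial

/-! ### The program -/

/-- Evaluate `e` into register `8`, and set register `6` to zero. -/
def setup (e : Expr ℕ) (δ : ℕ) : Prog :=
  .seq (e.compile 0 δ) <| .seq (.const 6 0) (.op .add 8 1 6)

/-- Compute one cell. -/
def fillBody : Prog :=
  .seq ((Expr.op .add baseE (.var 3)).compile 0 5) <|
  .seq ((cellE (.var 2) (.var 3)).compile 1 5) <|
  .seq (.store 1 3) <| .seq (.const 1 1) <| .seq (.op .add 6 6 1) (.op .sub 8 8 1)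

/-- Test one entry of the root table. -/
def rootBody : Prog :=
  .seq ((rootOkE (.var 2) (.var 3)).compile 0 6) <|
  .seq (.ite 1 (.const 10 1) .skip) <|
  .seq (.const 1 1) <| .seq (.op .add 6 6 1) (.op .sub 8 8 1)

/-- The dynamic program. -/
def dpProg : Prog :=
  .seq (setup LE 2) <| .seq (.op .add 4 8 6) <| .seq (setup (KE (.var 2)) 3) <|
  .seq (.loop 8 fillBody) <| .seq (setup rootCountE 3) <| .seq (.const 10 0) <|
  .seq (.loop 8 rootBody) <| .seq (.const 6 0) (.op .add 0 10 6)

/-- The decision procedure. -/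
def mainProg : Prog :=
  .seq (.load 0 1) <| .seq (.const 1 1) <| .seq (.load 2 1) <|
  .seq (trivialE.compile 0 2) (.ite 1 (.const 0 1) dpProg)

/-- A bound on the cost of `setup`. -/
noncomputable def setupCost (e : Expr ℕ) (δ : ℕ) : ℕ[X] := e.costBound δ + (e.sizeBound δ + 2)

theorem halts_setup {n m δ : ℕ} {s : State} {e e' : Expr ℕ}
    (h : Rel n m δ (fun x => s.reg (2 * x)) e e') {N : ℕ} (hn : n ≤ N) (hm : m ≤ N)
    (hμ : ∀ a, (s.mem a).size ≤ N) (hρ : ∀ x < δ, (s.reg (2 * x)).size ≤ N) (hδ : 2 ≤ δ)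
    (hδ' : δ ≤ 3) (h0 : s.reg 0 = n) (h2 : s.reg 2 = m) :
    Halts (setup e' δ) s ((setupCost e' δ).eval N) fun s' => s'.mem = s.mem ∧
      (∀ x < δ, s'.reg (2 * x) = s.reg (2 * x)) ∧ s'.reg 6 = 0 ∧ s'.reg 8 = e.eval n m s.mem := by
  have hsz := h.size_eval_le hn hm hμ hρ
  refine Halts.mono (Halts.seq (h.halts_compile hn hm hμ hρ hδ h0 h2 (d := 0) rfl fun _ _ => rfl)
    fun s1 ⟨k1, e1⟩ => ?_) (C := (e'.costBound δ).eval N +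
      (1 + Nat.size 0 + (1 + (e'.sizeBound δ).eval N) * (1 + 0))) ?_ fun _ h => h
  · have e1 : s1.reg 1 = e.eval n m s.mem := e1
    refine Halts.seq (Halts.const rfl) fun s2 hs2 => Halts.op ?_ ?_ ⟨?_, ?_, ?_, ?_⟩
    · subst hs2
      simpa [e1] using hsz
    · subst hs2
      simp
    · subst hs2
      exact k1.mem
    · intro x hx
      subst hs2
      simp only
      rw [Function.update_of_ne (by omega), Function.update_of_ne (by omega), k1.var x hx]
    · subst hs2
      simp
    · subst hs2
      simp [Op.eval, e1]
  · simp only [setupCost, eval_add, Nat.size_zero, eval_ofNat]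
    omega

/-- The numbers handled in solving the instance `I` have at most `N` bits. -/
structure Fits (I : DPData) (N : ℕ) : Prop where
  n_le : I.n ≤ N
  m_le : I.m ≤ N
  cell : ∀ k, (I.cellAt k).size ≤ N
  L : I.L.size ≤ N
  K : (I.base + I.K).size ≤ N

/-- The state holds the instance `I` and the first `i` cells. -/
structure Holds (I : DPData) (N i : ℕ) (s : State) : Prop where
  reg0 : s.reg 0 = I.n
  reg2 : s.reg 2 = I.m
  enc : I.Encodes s.mem
  size : ∀ a, (s.mem a).size ≤ N
  cells : ∀ k < i, s.mem (I.base + k) = I.cellAt k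

/-- A bound on the cost of `fillBody`. -/
noncomputable def fillCost : ℕ[X] :=
  (Expr.op .add baseE (.var 3)).costBound 5 + ((cellE (.var 2) (.var 3)).costBound 5 +
    (6 * X + 7))

/-- A bound on the cost of `rootBody`. -/
noncomputable def rootCost : ℕ[X] :=
  (rootOkE (.var 2) (.var 3)).costBound 6 + ((rootOkE (.var 2) (.var 3)).sizeBound 6 + (4 * X + 10))

variable {I : DPData} {N : ℕ}

/-- With `δ = 5` the registers 0, 2, 4, 6, 8 survive: `n`, `m`, `L`, the cell number and the
remaining count. The address, computed at depth 0, stays in register 1 while the content is computed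
at depth 1 into register 3. -/
theorem halts_fillBody (hI : Fits I N) {i : ℕ} (hi : i < I.K) {s : State} (hs : Holds I N i s)
    (h4 : s.reg 4 = I.L) (h6 : s.reg 6 = i) (h8 : s.reg 8 = I.K - i) :
    Halts fillBody s (fillCost.eval N) fun s' => Holds I N (i + 1) s' ∧ s'.reg 4 = I.L ∧
      s'.reg 6 = i + 1 ∧ s'.reg 8 = I.K - (i + 1) := by
  have hsz : ∀ a ≤ I.base + I.K, a.size ≤ N := fun a ha => (Nat.size_le_size ha).trans hI.K
  have hρ : ∀ x < 5, (s.reg (2 * x)).size ≤ N := by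
    intro x hx
    interval_cases x
    · simpa [hs.reg0] using (DPData.size_le_self _).trans hI.n_le
    · simpa [hs.reg2] using (DPData.size_le_self _).trans hI.m_le
    · simpa [h4] using hI.L
    · simpa [h6] using hsz i (by omega)
    · simpa [h8] using hsz (I.K - i) (by omega)
  refine Halts.mono (Halts.seq ((rel_address (ρ := fun x => s.reg (2 * x))).halts_compile hI.n_le
    hI.m_le hs.size hρ (by norm_num) hs.reg0 hs.reg2 (d := 0) rfl fun _ _ => rfl)
    fun s1 ⟨k1, e1⟩ => Halts.seq ((rel_cellE (ρ := fun x => s.reg (2 * x))).halts_compile hI.n_le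
    hI.m_le hs.size hρ (by norm_num) hs.reg0 hs.reg2 (d := 1) k1.mem k1.var)
    fun s2 ⟨k2, e2⟩ => ?_) (C := (((Expr.op .add baseE (.var 3)).costBound 5).eval N +
      (((cellE (.var 2) (.var 3)).costBound 5).eval N + ((1 + N + N) + (1 + 1 +
        ((1 + N) * (1 + 1) + (1 + N) * (1 + 1))))))) ?_ fun _ h => h
  · have f1 : s2.reg 1 = I.base + i := by
      refine (k2.tmp 0 (by norm_num)).trans (e1.trans ?_)
      simp only [Expr.eval, Op.eval]
      rw [eval_baseE hs.enc]
      simp [h6]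
    have f3 : s2.reg 3 = I.cellAt i := by
      refine e2.trans ?_
      have hv : Expr.eval I.n I.m s.mem (.var (s.reg (2 * 3))) = i := h6
      rw [eval_cellE hs.enc (L := .var (s.reg (2 * 2))) (k := .var (s.reg (2 * 3))) h4 (by rw [hv]; exact hi)
        (by rw [hv]; exact hs.cells), hv]
    have hv : ∀ x < 5, s2.reg (2 * x) = s.reg (2 * x) := fun x hx =>
      (k2.var x hx).trans (k1.var x hx)
    have f0 : s2.reg 0 = I.n := (hv 0 (by norm_num)).trans hs.reg0
    have f2 : s2.reg 2 = I.m := (hv 1 (by norm_num)).trans hs.reg2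
    have f4 : s2.reg 4 = I.L := (hv 2 (by norm_num)).trans h4
    have f6 : s2.reg 6 = i := (hv 3 (by norm_num)).trans h6
    have f8 : s2.reg 8 = I.K - i := (hv 4 (by norm_num)).trans h8
    have fm : s2.mem = s.mem := k2.mem.trans k1.mem
    refine Halts.seq (Halts.store (A := N) (B := N) (by rw [f1]; exact hsz _ (by omega))
      (by rw [f3]; exact hI.cell _) rfl) fun s3 hs3 => Halts.seq (Halts.const rfl) fun s4 hs4 =>
      Halts.seq (Halts.op (A := N) (B := 1) ?_ ?_ rfl) fun s5 hs5 =>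
      Halts.op (A := N) (B := 1) ?_ ?_ ⟨⟨?_, ?_, ?_, ?_, ?_⟩, ?_, ?_, ?_⟩
    · subst hs3 hs4; simpa [f6] using hsz i (by omega)
    · subst hs3 hs4; simp
    · subst hs3 hs4 hs5; simpa [f8] using hsz (I.K - i) (by omega)
    · subst hs3 hs4 hs5; simp
    · subst hs3 hs4 hs5; simpa using f0
    · subst hs3 hs4 hs5; simpa using f2
    · subst hs3 hs4 hs5
      refine hs.enc.congr fun a ha => ?_
      simp only [f1]
      rw [Function.update_of_ne (by omega), fm]
    · subst hs3 hs4 hs5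
      intro a
      simp only [Function.update_apply]
      split_ifs
      · rw [f3]; exact hI.cell _
      · rw [fm]; exact hs.size a
    · subst hs3 hs4 hs5
      intro k hk
      simp only [Function.update_apply, f1, Nat.add_left_cancel_iff]
      split_ifs with h
      · rw [f3, h]
      · rw [fm]; exact hs.cells k (by omega)
    · subst hs3 hs4 hs5; simpa using f4
    · subst hs3 hs4 hs5; simp [f6, Op.eval]
    · subst hs3 hs4 hs5; simp [f8, Op.eval]; omega
  · simp only [fillCost, eval_add, eval_mul, eval_X, eval_ofNat]
    omega

open Classical in
/-- The answer after the first `i` entries of the root table. -/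
noncomputable def answer (I : DPData) (i : ℕ) : ℕ :=
  if ∃ z < i, I.badRoot z = 0 ∧ I.table I.m I.root z ≠ 0 then 1 else 0

theorem answer_succ (I : DPData) (i : ℕ) : answer I (i + 1) =
    if I.badRoot i = 0 ∧ I.table I.m I.root i ≠ 0 then 1 else answer I i := by
  classical
  rw [answer, answer]
  by_cases h : I.badRoot i = 0 ∧ I.table I.m I.root i ≠ 0
  · rw [if_pos h, if_pos ⟨i, by omega, h⟩]
  · rw [if_neg h]
    congr 1
    refine propext ⟨?_, fun ⟨z, hz, h'⟩ => ⟨z, by omega, h'⟩⟩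
    rintro ⟨z, hz, h'⟩
    rcases Nat.lt_succ_iff_lt_or_eq.1 hz with hz | rfl
    · exact ⟨z, hz, h'⟩
    · exact absurd h' h

/-- The address is that of round `m`, the last one, at the root and at stage `n² + 1`, where the
normalized table is stored. -/
theorem eval_rootOkE_eq {μ : ℕ → ℕ} (h : I.Encodes μ)
    (hc : ∀ k < I.K, μ (I.base + k) = I.cellAt k) {i : ℕ} (hi : i < I.L) :
    (rootOkE (.var I.L) (.var i)).eval I.n I.m μ =
      if I.badRoot i ≠ 0 then 0 else I.table I.m I.root i := by
  have hj : I.n * I.n + 1 < I.S := by rw [DPData.S]; omega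
  have h1 := DPData.mul_add_lt_mul (DPData.mul_add_lt_mul (DPData.mul_add_lt_mul (Nat.lt_succ_self I.m)
    h.root_lt) hj) hi
  rw [eval_rootOkE h]
  simp only [Expr.eval]
  rw [hc _ h1, DPData.cellAt_eq h.root_lt hj hi, DPData.cell, if_neg (by omega), if_pos rfl]
  split_ifs with hb
  · exact if_pos hb
  · exact if_neg hb

theorem halts_rootBody (hI : Fits I N) {c : ℕ} (hc : c ≤ I.L) {i : ℕ} (hi : i < c) {s : State}
    (hs : Holds I N I.K s) (h4 : s.reg 4 = I.L) (h6 : s.reg 6 = i) (h8 : s.reg 8 = c - i)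
    (h10 : s.reg 10 = answer I i) :
    Halts rootBody s (rootCost.eval N) fun s' => Holds I N I.K s' ∧ s'.reg 4 = I.L ∧
      s'.reg 6 = i + 1 ∧ s'.reg 8 = c - (i + 1) ∧ s'.reg 10 = answer I (i + 1) := by
  have hsz : ∀ a ≤ I.L, a.size ≤ N := fun a ha => (Nat.size_le_size ha).trans hI.L
  have hN : 1 ≤ N := by
    have := hsz 1 (by omega)
    simpa using this
  have hρ : ∀ x < 6, (s.reg (2 * x)).size ≤ N := by
    intro x hx
    interval_cases x
    · simpa [hs.reg0] using (DPData.size_le_self _).trans hI.n_le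
    · simpa [hs.reg2] using (DPData.size_le_self _).trans hI.m_le
    · simpa [h4] using hI.L
    · simpa [h6] using hsz i (by omega)
    · simpa [h8] using hsz (c - i) (by omega)
    · simp only [Nat.reduceMul, h10, answer]
      split_ifs <;> simp [hN]
  have hrel := rel_rootOkE (n := I.n) (m := I.m) (ρ := fun x => s.reg (2 * x))
  have hsize := hrel.size_eval_le hI.n_le hI.m_le hs.size hρ
  set v := Expr.eval I.n I.m s.mem (rootOkE (.var (s.reg (2 * 2))) (.var (s.reg (2 * 3)))) with hv
  have hv' : v = if I.badRoot i ≠ 0 then 0 else I.table I.m I.root i := by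
    rw [hv, show s.reg (2 * 2) = I.L from h4, show s.reg (2 * 3) = i from h6,
      eval_rootOkE_eq hs.enc hs.cells (by omega)]
  refine Halts.mono (Halts.seq (hrel.halts_compile hI.n_le
    hI.m_le hs.size hρ (by norm_num) hs.reg0 hs.reg2 (d := 0) rfl fun _ _ => rfl)
    fun s1 ⟨k1, e1⟩ => ?_) (C := (((rootOkE (.var 2) (.var 3)).costBound 6).eval N +
      ((1 + ((rootOkE (.var 2) (.var 3)).sizeBound 6).eval N + (1 + 1) + 1) + (1 + 1 +
        ((1 + N) * (1 + 1) + (1 + N) * (1 + 1)))))) ?_ fun _ h => h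
  · have hv1 : s1.reg 1 = v := e1
    have f0 : s1.reg 0 = I.n := (k1.var 0 (by norm_num)).trans hs.reg0
    have f2 : s1.reg 2 = I.m := (k1.var 1 (by norm_num)).trans hs.reg2
    have f4 : s1.reg 4 = I.L := (k1.var 2 (by norm_num)).trans h4
    have f6 : s1.reg 6 = i := (k1.var 3 (by norm_num)).trans h6
    have f8 : s1.reg 8 = c - i := (k1.var 4 (by norm_num)).trans h8
    have f10 : s1.reg 10 = answer I i := (k1.var 5 (by norm_num)).trans h10
    -- Both branches are described by the same state: if the assignment is skipped, register 10
    -- already holds the updated answer.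
    refine Halts.seq (Q := fun s2 => s2 = ⟨Function.update s1.reg 10 (answer I (i + 1)), s1.mem⟩)
      (Halts.ite (by rw [hv1]; exact hsize) (fun h => Halts.const ?_) fun h => Halts.skip ?_)
      fun s2 hs2 => Halts.seq (Halts.const rfl) fun s3 hs3 =>
      Halts.seq (Halts.op (A := N) (B := 1) ?_ ?_ rfl) fun s4 hs4 =>
      Halts.op (A := N) (B := 1) ?_ ?_ ⟨⟨?_, ?_, ?_, ?_, ?_⟩, ?_, ?_, ?_, ?_⟩
    · rw [hv1, hv'] at h
      have h' : I.badRoot i = 0 := by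
        by_contra h'
        exact h (if_pos h')
      rw [if_neg (not_not.2 h')] at h
      rw [answer_succ, if_pos ⟨h', h⟩]
    · rw [hv1, hv'] at h
      rw [answer_succ, if_neg (by rintro ⟨h1, h2⟩; exact h2 (by simpa [h1] using h)), ← f10,
        Function.update_eq_self]
    · subst hs2 hs3; simpa [f6] using hsz i (by omega)
    · subst hs2 hs3; simp
    · subst hs2 hs3 hs4; simpa [f8] using hsz (c - i) (by omega)
    · subst hs2 hs3 hs4; simp
    · subst hs2 hs3 hs4; simpa using f0
    · subst hs2 hs3 hs4; simpa using f2
    · subst hs2 hs3 hs4; simpa [k1.mem] using hs.enc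
    · subst hs2 hs3 hs4; simpa [k1.mem] using hs.size
    · subst hs2 hs3 hs4; simpa [k1.mem] using hs.cells
    · subst hs2 hs3 hs4; simpa using f4
    · subst hs2 hs3 hs4; simp [f6, Op.eval]
    · subst hs2 hs3 hs4; simp [f8, Op.eval]; omega
    · subst hs2 hs3 hs4; simp
  · simp only [rootCost, eval_add, eval_mul, eval_X, eval_ofNat]
    omega

end RAM

namespace RAM

open RAM.Expr Polynomial

/-- The part of the cost of `dpProg` outside its loops. -/
noncomputable def dpCost : ℕ[X] :=
  setupCost LE 2 + (setupCost (KE (.var 2)) 3 + (setupCost rootCountE 3 + (X + 7)))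

theorem halts_dpProg {I : DPData} {N : ℕ} {s : State} (h : I.Encodes s.mem) (hI : Fits I N)
    (hsz : ∀ a, (s.mem a).size ≤ N) (h0 : s.reg 0 = I.n) (h2 : s.reg 2 = I.m) :
    Halts dpProg s (dpCost.eval N + I.K * (fillCost + X + 1).eval N +
      I.Q ^ I.card I.root * (rootCost + X + 1).eval N)
      fun s' => s'.reg 0 = answer I (I.Q ^ I.card I.root) := by
  have hL : I.L.size ≤ N := hI.L
  have hK : I.K.size ≤ N := (Nat.size_le_size (Nat.le_add_left _ _)).trans hI.K
  have hcL : I.Q ^ I.card I.root ≤ I.L := DPData.pow_card_le_L h.root_lt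
  have hc : (I.Q ^ I.card I.root).size ≤ N := (Nat.size_le_size hcL).trans hL
  have hn : I.n.size ≤ N := (DPData.size_le_self _).trans hI.n_le
  have hm : I.m.size ≤ N := (DPData.size_le_self _).trans hI.m_le
  refine Halts.mono (Halts.seq (halts_setup rel_LE hI.n_le hI.m_le hsz ?_ le_rfl (by norm_num) h0 h2)
    fun s1 ⟨m1, v1, z1, e1⟩ => ?_) (C := (setupCost LE 2).eval N + ((1 + N) * (1 + 0) +
      ((setupCost (KE (.var 2)) 3).eval N + ((I.K * (fillCost.eval N + 1 + I.K.size) + 1) +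
      ((setupCost rootCountE 3).eval N + (1 + Nat.size 0 + ((I.Q ^ I.card I.root *
        (rootCost.eval N + 1 + (I.Q ^ I.card I.root).size) + 1) + (1 + Nat.size 0 +
          (1 + 1) * (1 + 0))))))))) ?_ fun _ h => h
  · intro x hx
    interval_cases x
    · simpa [h0] using hn
    · simpa [h2] using hm
  · rw [eval_LE h] at e1
    refine Halts.seq (Halts.op (A := N) (B := 0) (by rwa [e1]) (by simp [z1]) rfl) fun s2 hs2 => ?_
    have f0 : s2.reg 0 = I.n := by subst hs2; simpa using (v1 0 (by norm_num)).trans h0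
    have f2 : s2.reg 2 = I.m := by subst hs2; simpa using (v1 1 (by norm_num)).trans h2
    have f4 : s2.reg 4 = I.L := by subst hs2; simp [Op.eval, e1, z1]
    have fm : s2.mem = s.mem := by subst hs2; exact m1
    refine Halts.seq (halts_setup (rel_KE (ρ := fun x => s2.reg (2 * x))) hI.n_le hI.m_le
      (by rwa [fm]) ?_ (by norm_num) le_rfl f0 f2) fun s3 ⟨m3, v3, z3, e3⟩ => ?_
    · intro x hx
      interval_cases x
      · simpa [f0] using hn
      · simpa [f2] using hm
      · simpa [f4] using hL
    have g4 : s3.reg 4 = I.L := (v3 2 (by norm_num)).trans f4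
    have gm : s3.mem = s.mem := m3.trans fm
    have g8 : s3.reg 8 = I.K := by
      rw [e3, fm, eval_KE h]
      exact congrArg ((I.m + 1) * I.m * I.S * ·) f4
    have hs3 : Holds I N 0 s3 := ⟨(v3 0 (by norm_num)).trans f0, (v3 1 (by norm_num)).trans f2,
      by rwa [gm], by rwa [gm], fun k hk => absurd hk (by omega)⟩
    refine Halts.seq (Halts.loop I.K (fillCost.eval N) (fun i t => Holds I N i t ∧ t.reg 4 = I.L ∧
      t.reg 6 = i ∧ t.reg 8 = I.K - i) (fun i t ht => ht.2.2.2)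
      (fun i hi t ⟨t1, t2, t3, t4⟩ => halts_fillBody hI hi t1 t2 t3 t4) ⟨hs3, g4, z3, g8⟩)
      fun s4 ⟨hs4, k4, _, _⟩ => ?_
    refine Halts.seq (halts_setup (rel_rootCountE (ρ := fun x => s4.reg (2 * x))) hI.n_le hI.m_le
      hs4.size ?_ (by norm_num) le_rfl hs4.reg0 hs4.reg2) fun s5 ⟨m5, v5, z5, e5⟩ =>
      Halts.seq (Halts.const rfl) fun s6 hs6 => ?_
    · intro x hx
      interval_cases x
      · simpa [hs4.reg0] using hn
      · simpa [hs4.reg2] using hm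
      · simpa [k4] using hL
    rw [eval_rootCountE hs4.enc] at e5
    have hs6' : Holds I N I.K s6 := by
      subst hs6
      refine ⟨?_, ?_, by simpa [m5] using hs4.enc, by simpa [m5] using hs4.size,
        by simpa [m5] using hs4.cells⟩
      · simpa using (v5 0 (by norm_num)).trans hs4.reg0
      · simpa using (v5 1 (by norm_num)).trans hs4.reg2
    refine Halts.seq (Halts.loop (I.Q ^ I.card I.root) (rootCost.eval N)
      (fun i t => Holds I N I.K t ∧ t.reg 4 = I.L ∧ t.reg 6 = i ∧
        t.reg 8 = I.Q ^ I.card I.root - i ∧ t.reg 10 = answer I i) (fun i t ht => ht.2.2.2.1)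
      (fun i hi t ⟨t1, t2, t3, t4, t5⟩ => halts_rootBody hI hcL hi t1 t2 t3 t4 t5)
      ⟨hs6', ?_, ?_, ?_, ?_⟩)
      fun s7 ⟨_, _, _, _, k7⟩ => Halts.seq (Halts.const rfl) fun s8 hs8 => Halts.op ?_ ?_ ?_
    · subst hs6; simpa using (v5 2 (by norm_num)).trans k4
    · subst hs6; simpa using z5
    · subst hs6; simpa using e5
    · subst hs6; simp [answer]
    · subst hs8
      simp only
      rw [Function.update_of_ne (by norm_num), k7, answer]
      split_ifs <;> simp
    · subst hs8; simp
    · subst hs8; simp [Op.eval, k7]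
  · simp only [dpCost, eval_add, eval_X, eval_ofNat, eval_one, Nat.size_zero]
    have i1 := Nat.mul_le_mul_left I.K (show fillCost.eval N + 1 + I.K.size ≤
      fillCost.eval N + N + 1 by omega)
    have i2 := Nat.mul_le_mul_left (I.Q ^ I.card I.root) (show rootCost.eval N + 1 +
      (I.Q ^ I.card I.root).size ≤ rootCost.eval N + N + 1 by omega)
    omega

/-- The cost of reading the numbers of vertices and nodes and of testing for trivial instances. -/
noncomputable def mainCost : ℕ[X] :=
  trivialE.costBound 2 + (trivialE.sizeBound 2 + (2 * X + 8))

theorem halts_mainProg {s : State} {N C a : ℕ} (h0 : ∀ x, s.reg x = 0) (hn : s.mem 0 ≤ N)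
    (hm : s.mem 1 ≤ N) (hsz : ∀ a, (s.mem a).size ≤ N)
    (htriv : ¬ (s.mem 2 < s.mem 0 ∧ s.mem 3 < s.mem 0) → a = 1)
    (hdp : s.mem 2 < s.mem 0 → s.mem 3 < s.mem 0 → ∀ s' : State, s'.mem = s.mem →
      s'.reg 0 = s.mem 0 → s'.reg 2 = s.mem 1 → Halts dpProg s' C fun t => t.reg 0 = a) :
    Halts mainProg s (mainCost.eval N + C) fun t => t.reg 0 = a := by
  -- Register 1 is initially zero, so the first load fetches `n` from address 0.
  refine Halts.mono (Halts.seq (Halts.load (A := 0) (B := N) (by simp [h0]) (hsz _) rfl)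
    fun s1 hs1 => Halts.seq (Halts.const rfl) fun s2 hs2 =>
    Halts.seq (Halts.load (A := 1) (B := N) ?_ ?_ rfl) fun s3 hs3 => ?_)
    (C := (1 + 0 + N) + (1 + Nat.size 1 + ((1 + 1 + N) + ((trivialE.costBound 2).eval N +
      (1 + (trivialE.sizeBound 2).eval N + (1 + Nat.size 1) + C))))) ?_ fun _ h => h
  · subst hs1 hs2; simp
  · subst hs1 hs2; exact hsz _
  · have f0 : s3.reg 0 = s.mem 0 := by subst hs1 hs2 hs3; simp [h0]
    have f2 : s3.reg 2 = s.mem 1 := by subst hs1 hs2 hs3; simp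
    have fm : s3.mem = s.mem := by subst hs1 hs2 hs3; rfl
    have hρ : ∀ x < 2, (s3.reg (2 * x)).size ≤ N := by
      intro x hx
      interval_cases x
      · simpa [f0] using hsz _
      · simpa [f2] using hsz _
    have hrel := rel_trivialE (n := s.mem 0) (m := s.mem 1) (ρ := fun x => s3.reg (2 * x))
    have hsize := hrel.size_eval_le hn hm hsz hρ
    refine Halts.seq (hrel.halts_compile hn hm hsz hρ le_rfl f0 f2 (d := 0) fm fun _ _ => rfl)
      fun s4 ⟨k4, e4⟩ => ?_
    have e4 : s4.reg 1 = trivialE.eval (s.mem 0) (s.mem 1) s.mem := e4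
    have hv : trivialE.eval (s.mem 0) (s.mem 1) s.mem =
        if s.mem 2 < s.mem 0 then if s.mem 3 < s.mem 0 then 0 else 1 else 1 := by
      by_cases g1 : s.mem 2 < s.mem 0 <;> by_cases g2 : s.mem 3 < s.mem 0 <;>
        simp [trivialE, χE, nE, ΔE, Expr.eval, g1, g2]
    refine Halts.ite (by rw [e4]; exact hsize) (fun h => Halts.const ?_) fun h => ?_
    · rw [e4, hv] at h
      simp only [Function.update_self]
      refine (htriv ?_).symm
      rintro ⟨g1, g2⟩
      simp [g1, g2] at h
    · rw [e4, hv] at h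
      have g1 : s.mem 2 < s.mem 0 := by by_contra g; simp [g] at h
      have g2 : s.mem 3 < s.mem 0 := by by_contra g; simp [g] at h
      exact hdp g1 g2 s4 (k4.mem.trans fm) ((k4.var 0 (by norm_num)).trans f0)
        ((k4.var 1 (by norm_num)).trans f2)
  · simp only [mainCost, eval_add, eval_mul, eval_X, eval_ofNat, Nat.size_one]
    omega

end RAM

/-- With `n` colors all vertices get different ones; with `Δ ≥ n` a single color is enough. -/
theorem defectiveColorable_of_le {n χ Δ : ℕ} {G : SimpleGraph (Fin n)} (hχ : 0 < χ)
    (h : n ≤ χ ∨ n ≤ Δ) : DefectiveColorable G χ Δ := by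
  classical
  rw [defectiveColorable_iff]
  rcases h with h | h
  · refine ⟨fun v => v, fun v => v.2.trans_le h, fun v => ?_⟩
    rw [sameColor, filter_false_of_mem, card_empty]
    · exact Nat.zero_le _
    · rintro u - ⟨h1, h2⟩
      exact h1.ne (Fin.ext h2.symm)
  · refine ⟨fun _ => 0, fun _ => hχ, fun v => (card_filter_le _ _).trans ?_⟩
    simpa using h

/-! ### The encoded input and the running time -/

namespace RAM

open Polynomial

theorem size_initState_le (l : List ℕ) (a : ℕ) : ((initState l).mem a).size ≤ inputLength l := by
  simp only [initState, inputLength]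
  rcases lt_or_ge a l.length with h | h
  · rw [List.getD_eq_getElem _ _ h]
    have := List.single_le_sum (l := l.map fun w => w.size + 1) (fun _ _ => Nat.zero_le _)
      (l[a].size + 1) (List.mem_map.2 ⟨_, List.getElem_mem h, rfl⟩)
    omega
  · rw [List.getD_eq_default _ _ h]
    simp

theorem length_le_inputLength (l : List ℕ) : l.length ≤ inputLength l := by
  induction l with
  | nil => simp
  | cons w l ih =>
    simp only [inputLength, List.map_cons, List.sum_cons, List.length_cons] at *
    omega

section

variable {n m : ℕ} {G : SimpleGraph (Fin n)} {D : NiceTreeDecomposition G m} {χ Δ : ℕ}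

theorem length_encodeInstance :
    (encodeInstance G D χ Δ).length = 5 + n * n + m + m * n := by
  simp [encodeInstance]
  omega

theorem encodes_initState (hΔ : Δ < n) :
    (DPData.ofInstance G D χ Δ).Encodes (initState (encodeInstance G D χ Δ)).mem := by
  classical
  have hA : ([n, m, χ, Δ, (D.root : ℕ)] : List ℕ).length = 5 := rfl
  refine ⟨?_, ?_, ?_, ?_, ?_, ?_, ?_, ?_, DPData.bag_le_one, ?_, D.root.2, hΔ⟩
  · simp [initState, encodeInstance, DPData.ofInstance]
  · simp [initState, encodeInstance, DPData.ofInstance]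
  · simp [initState, encodeInstance, DPData.ofInstance]
  · simp [initState, encodeInstance, DPData.ofInstance]
  · simp [initState, encodeInstance, DPData.ofInstance]
  · intro u hu v hv
    have hu : u < n := hu
    have hv : v < n := hv
    have huv : u * n + v < n * n := DPData.mul_add_lt_mul hu hv
    have h1 : (u * n + v) / n = u := by
      rw [mul_comm, Nat.mul_add_div (by omega), Nat.div_eq_of_lt hv, Nat.add_zero]
    have h2 : (u * n + v) % n = v := by rw [mul_comm, Nat.mul_add_mod, Nat.mod_eq_of_lt hv]
    simp only [initState, encodeInstance]
    change List.getD _ (5 + (u * n + v)) 0 = _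
    rw [List.getD_append _ _ _ _ (by simp; omega), List.getD_append _ _ _ _ (by simp; omega),
      List.getD_append_right _ _ _ _ (by simp), List.getD_eq_getElem _ _ (by simp; omega)]
    simp only [hA, List.getElem_ofFn, Nat.add_sub_cancel_left, DPData.ofInstance]
    simp [Fin.divNat, Fin.modNat, h1, h2, hu, hv]
  · intro t ht
    have ht : t < m := ht
    simp only [initState, encodeInstance]
    change List.getD _ (5 + n * n + t) 0 = _
    rw [List.getD_append _ _ _ _ (by simp; omega), List.getD_append_right _ _ _ _ (by simp; omega),
      List.getD_eq_getElem _ _ (by simp; omega)]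
    have e : 5 + n * n + t - (n * n + 1 + 1 + 1 + 1 + 1) = t := by omega
    simp [DPData.ofInstance, ht, e]
  · intro t ht v hv
    have ht : t < m := ht
    have hv : v < n := hv
    have htv : t * n + v < m * n := DPData.mul_add_lt_mul ht hv
    have h1 : (t * n + v) / n = t := by
      rw [mul_comm, Nat.mul_add_div (by omega), Nat.div_eq_of_lt hv, Nat.add_zero]
    have h2 : (t * n + v) % n = v := by rw [mul_comm, Nat.mul_add_mod, Nat.mod_eq_of_lt hv]
    simp only [initState, encodeInstance]
    change List.getD _ (5 + n * n + m + (t * n + v)) 0 = _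
    rw [List.getD_append_right _ _ _ _ (by simp; omega), List.getD_eq_getElem _ _ (by simp; omega)]
    have e : 5 + n * n + m + (t * n + v) - (n * n + m + 1 + 1 + 1 + 1 + 1) = t * n + v := by omega
    simp [DPData.ofInstance, ht, hv, e, Fin.divNat, Fin.modNat, h1, h2]
  · intro t ht
    exact (DPData.par_eq (χ := χ) (Δ := Δ) (D := D) ⟨t, ht⟩).trans_lt (D.parent _).2

theorem card_le_width (t : ℕ) : (DPData.ofInstance G D χ Δ).card t ≤ D.width + 1 := by
  classical
  by_cases ht : t < m
  · have h1 : (DPData.ofInstance G D χ Δ).card t = (D.bag ⟨t, ht⟩).card := by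
      rw [DPData.card, show (DPData.ofInstance G D χ Δ).n = n from rfl]
      refine (sum_range _).trans ?_
      simp only [DPData.ofInstance, ht, exists_true_left, Fin.is_lt, Fin.eta]
      rw [sum_boole, filter_mem_eq_inter, univ_inter, Nat.cast_id]
    rw [h1, NiceTreeDecomposition.width]
    have : (D.bag ⟨t, ht⟩).card ≤ univ.sup fun t => (D.bag t).card :=
      le_sup (f := fun t => (D.bag t).card) (mem_univ _)
    omega
  · refine (sum_eq_zero fun u _ => ?_).trans_le (Nat.zero_le _)
    simp [DPData.ofInstance, ht]

end

/-- A bound on `DPData.bits` in terms of the length of the input. -/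
noncomputable def bitsBound : ℕ[X] := X ^ 6 + X ^ 3 + 8 * X ^ 2 + 5 * X + 20

/-- A bound on the running time, apart from the exponential factor. -/
noncomputable def timeBound : ℕ[X] :=
  (mainCost + dpCost).comp bitsBound +
    (X + 1) * X * (2 * X ^ 2 + 3) * X ^ 3 * (fillCost + X + 1).comp bitsBound +
    X ^ 2 * (rootCost + X + 1).comp bitsBound

theorem bits_le {I : DPData} {l : ℕ} (hn : I.n ≤ l) (hm : I.m ≤ l) :
    I.bits ≤ bitsBound.eval l := by
  simp only [bitsBound, eval_add, eval_mul, eval_pow, eval_X, eval_ofNat, DPData.bits]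
  calc (I.n * I.n + I.m * I.n ^ 4) * I.m + 5 * I.m + 6 * (I.n * I.n) + I.m * I.n + 20
      ≤ (l * l + l * l ^ 4) * l + 5 * l + 6 * (l * l) + l * l + 20 := by gcongr
    _ ≤ _ := by ring_nf; omega

theorem le_bitsBound (l : ℕ) : l ≤ bitsBound.eval l := by
  simp only [bitsBound, eval_add, eval_mul, eval_pow, eval_X, eval_ofNat]
  omega

/-- Here the exponent falls from `w + 1` to `w`: the spare factor `Q` is at most `n² ≤ l²`, since `χ
≤ n` and `Δ < n`. -/
theorem K_le {I : DPData} {l w : ℕ} (hn : I.n ≤ l) (hm : I.m ≤ l) (hχ : 0 < I.χ)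
    (hχn : I.χ ≤ I.n) (hΔ : I.Δ < I.n) (hw : ∀ t, I.card t ≤ w + 1) :
    I.K ≤ (l + 1) * l * (2 * l ^ 2 + 3) * l ^ 3 * I.Q ^ w := by
  have h1 : I.L ≤ l ^ 3 * I.Q ^ w := by
    calc I.L ≤ I.m * I.Q ^ (w + 1) := DPData.L_le hχ fun t _ => hw t
      _ = I.m * I.Q * I.Q ^ w := by ring
      _ ≤ l * (l * l) * I.Q ^ w := by
        gcongr
        exact (DPData.Q_le hχn hΔ).trans (Nat.mul_le_mul hn hn)
      _ = _ := by ring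
  have h2 : I.S ≤ 2 * l ^ 2 + 3 := by
    rw [DPData.S, sq]
    gcongr
  rw [DPData.K, mul_assoc _ (l ^ 3)]
  gcongr

theorem exists_exec {n m : ℕ} (G : SimpleGraph (Fin n)) (D : NiceTreeDecomposition G m) {χ Δ : ℕ}
    (hχ : 0 < χ) {a : ℕ} (h1 : DefectiveColorable G χ Δ → a = 1)
    (h0 : ¬ DefectiveColorable G χ Δ → a = 0) :
    Halts mainProg (initState (encodeInstance G D χ Δ))
      (timeBound.eval (inputLength (encodeInstance G D χ Δ)) * (χ * (Δ + 1)) ^ D.width)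
      fun s => s.reg 0 = a := by
  set I := DPData.ofInstance G D χ Δ with hI
  set l := inputLength (encodeInstance G D χ Δ) with hl
  set w := D.width with hw
  set s := initState (encodeInstance G D χ Δ) with hs
  set N := bitsBound.eval l with hN
  have hlen : 5 + n * n + m + m * n ≤ l := by
    rw [← length_encodeInstance (G := G) (D := D) (χ := χ) (Δ := Δ)]
    exact length_le_inputLength _
  have hnl : n ≤ l := (Nat.le_mul_self n).trans (by omega)
  have hml : m ≤ l := by omega
  have hlN : l ≤ N := le_bitsBound l
  have hsz : ∀ b, (s.mem b).size ≤ N := fun b => (size_initState_le _ b).trans hlN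
  have e0 : s.mem 0 = n := by simp [hs, initState, encodeInstance]
  have e1 : s.mem 1 = m := by simp [hs, initState, encodeInstance]
  have e2 : s.mem 2 = χ := by simp [hs, initState, encodeInstance]
  have e3 : s.mem 3 = Δ := by simp [hs, initState, encodeInstance]
  have hQ : 0 < χ * (Δ + 1) := Nat.mul_pos hχ (Nat.succ_pos _)
  -- The dynamic program is allotted what the total bound leaves after `mainCost`; the last bullet
  -- shows that this truncated subtraction is exact.
  refine (halts_mainProg (N := N) (C := timeBound.eval l * (χ * (Δ + 1)) ^ w - mainCost.eval N)
    (a := a) (fun _ => rfl) (by omega) (by omega) hsz ?_ ?_).mono ?_ fun _ h => h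
  · rw [e0, e2, e3]
    intro h
    exact h1 (defectiveColorable_of_le hχ (by omega))
  · rw [e0, e1, e2, e3]
    intro hχn hΔ s' hm hr0 hr2
    have henc : I.Encodes s'.mem := by rw [hm]; exact encodes_initState hΔ
    have hcard : ∀ t, I.card t ≤ I.n := fun t => DPData.card_le_n t
    have hbits : I.bits ≤ N := bits_le hnl hml
    have hK := DPData.size_base_add_K_le (I := I) hχ hχn.le hΔ fun t _ => hcard t
    have hLs := DPData.size_L_le (I := I) hχ hχn.le hΔ fun t _ => hcard t
    refine (halts_dpProg henc ⟨hnl.trans hlN, hml.trans hlN, fun k =>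
      (DPData.size_cellAt_le D.root.pos hΔ.le k).trans hbits, hLs.trans (le_trans ?_ hbits),
      hK.trans hbits⟩ (by rwa [hm]) hr0 hr2).mono ?_ fun t ht => ?_
    · rw [DPData.bits]
      omega
    · have hKl := K_le (I := I) (w := w) hnl hml hχ hχn.le hΔ card_le_width
      have hc : I.Q ^ I.card I.root ≤ l ^ 2 * I.Q ^ w := by
        calc I.Q ^ I.card I.root ≤ I.Q ^ (w + 1) :=
              Nat.pow_le_pow_right hQ (card_le_width _)
          _ = I.Q * I.Q ^ w := by ring
          _ ≤ _ := by
            gcongr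
            exact (DPData.Q_le (I := I) hχn.le hΔ).trans (by rw [sq]; exact Nat.mul_le_mul hnl hnl)
      have hQI : I.Q = χ * (Δ + 1) := rfl
      rw [hQI] at hKl hc
      have hw1 : 1 ≤ (χ * (Δ + 1)) ^ w := Nat.one_le_pow _ _ hQ
      refine Nat.le_sub_of_add_le ?_
      simp only [timeBound, eval_add, eval_mul, eval_comp, eval_pow, eval_X, eval_ofNat, eval_one,
        ← hN, hQI] at *
      calc _ ≤ dpCost.eval N * (χ * (Δ + 1)) ^ w +
            ((l + 1) * l * (2 * l ^ 2 + 3) * l ^ 3 * (χ * (Δ + 1)) ^ w) *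
              (fillCost.eval N + N + 1) +
            (l ^ 2 * (χ * (Δ + 1)) ^ w) * (rootCost.eval N + N + 1) +
            mainCost.eval N * (χ * (Δ + 1)) ^ w := by
              gcongr
              · exact Nat.le_mul_of_pos_right _ hw1
              · exact Nat.le_mul_of_pos_right _ hw1
        _ = _ := by ring
    · rw [ht]
      have hiff := DPData.defectiveColorable_iff_table (D := D) hχ hχn.le hΔ
      rw [answer]
      split_ifs with h
      · exact (h1 (hiff.2 h)).symm
      · exact (h0 fun g => h (hiff.1 g)).symm
  · have hw1 : 1 ≤ (χ * (Δ + 1)) ^ w := Nat.one_le_pow _ _ hQ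
    have : mainCost.eval N ≤ timeBound.eval l * (χ * (Δ + 1)) ^ w := by
      refine le_trans ?_ (Nat.le_mul_of_pos_right _ hw1)
      simp only [timeBound, eval_add, eval_mul, eval_comp, ← hN]
      omega
    omega

end RAM

theorem mainTheorem9 :
    ∃ (p : RAM.Prog) (P : Polynomial ℕ),
      ∀ (n m : ℕ) (G : SimpleGraph (Fin n)) (D : NiceTreeDecomposition G m) (χ Δ : ℕ), 1 ≤ χ →
        ∃ (T : ℕ) (s : RAM.State),
          RAM.Exec p (RAM.initState (encodeInstance G D χ Δ)) T s ∧
          (DefectiveColorable G χ Δ → s.reg 0 = 1) ∧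
          (¬ DefectiveColorable G χ Δ → s.reg 0 = 0) ∧
          T ≤ P.eval (RAM.inputLength (encodeInstance G D χ Δ)) * (χ * (Δ + 1)) ^ D.width := by
  classical
  refine ⟨RAM.mainProg, RAM.timeBound, fun n m G D χ Δ hχ => ?_⟩
  obtain ⟨T, s, h1, h2, h3⟩ := RAM.exists_exec G D hχ
    (a := if DefectiveColorable G χ Δ then 1 else 0) (fun h => if_pos h) fun h => if_neg h
  exact ⟨T, s, h1, fun h => h3.trans (if_pos h), fun h => h3.trans (if_neg h), h2⟩
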